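/- Let $d\ge 2$ be an integer and $\nu=\frac d2-1$. For $\ell\in\mathbb N$ let $$\mathcal G_{d,\ell}=\binom{\ell+\nu}{\ell}^{-1}P_\ell^{(\nu,\nu)}$$ be the normalized Gegenbauer polynomial, where $P_\ell^{(\nu,\nu)}$ is the Jacobi polynomial, so that $\mathcal G_{d,\ell}(1)=1$. For $0<a\le\pi$ and $q\in\mathbb N$ write $$A_{d,q,\ell}(a)=\int_0^a \mathcal G_{d,\ell}(\cos r)^q(\sin r)^{d-1}\,dr .$$ Let $j_d(r)=\Gamma(\nu+1)\,2^\nu r^{-\nu}J_\nu(r)$ for $r>0$ and $j_d(0)=1$, with $J_\nu$ the Bessel function of the first kind. All asymptotic relations below are as $\ell\to\infty$. (i) ($q=2$) There is a constant $C_d>0$, depending only on $d$, such that for all $a\in(0,\pi)$ $$A_{d,2,\ell}(a)=(1+o(1))\,C_d\,a\,\ell^{1-d},$$ and $A_{d,2,\ell}(\pi)=(1+o(1))\,2\,C_d\,\frac{\pi}{2}\,\ell^{1-d}$, that is, twice the asymptotics for $a=\pi/2$. (ii) ($d=2$, $q=4$) There is an absolute constant $C>0$ such that for all $a\in(0,\pi)$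 $$A_{2,4,\ell}(a)=(1+o(1))\,C\,\frac{\log \ell}{\ell^2},$$ and $A_{2,4,\ell}(\pi)=(1+o(1))\,2C\,\frac{\log \ell}{\ell^2}$. (iii) For every integer $q\ge3$ with $(d,q)\ne(2,4)$ the improper integral $$I^d_q=\int_0^\infty j_d(t)^q\,t^{d-1}\,dt=\lim_{T\to\infty}\int_0^T j_d(t)^q\,t^{d-1}\,dt$$ converges to a finite positive number, for all $a\in(0,\pi)$ $$A_{d,q,\ell}(a)=(1+o(1))\,\frac{I^d_q}{\ell^d},$$ and $A_{d,q,\ell}(\pi)=(1+o(1))\,\frac{2I^d_q}{\ell^d}$ as $\ell\to\infty$ along those $\ell$ for which $q$ and $\ell$ are not both odd. (iv) If $q$ and $\ell$ are both odd, then $A_{d,q,\ell}(\pi)=0$. -/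

import Mathlib

open Filter Topology Asymptotics Polynomial

/-- The Jacobi polynomial `P_n^{(α,β)}`, in the explicit form
`∑ s, binom(n+α, n-s) binom(n+β, s) ((x-1)/2)^s ((x+1)/2)^(n-s)`
with generalized binomial coefficients. -/
noncomputable def jacobiPoly (n : ℕ) (α β : ℝ) : ℝ[X] :=
  ∑ s ∈ Finset.range (n + 1),
    C (Ring.choose ((n : ℝ) + α) (n - s) * Ring.choose ((n : ℝ) + β) s) *
      (C (1 / 2) * (X - 1)) ^ s * (C (1 / 2) * (X + 1)) ^ (n - s)

/-- The index `ν = d/2 - 1` attached to the dimension `d`. -/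
noncomputable def nuOf (d : ℕ) : ℝ := (d : ℝ) / 2 - 1

/-- The normalized Gegenbauer polynomial
`G_{d,ℓ} = binom(ℓ+ν, ℓ)⁻¹ P_ℓ^{(ν,ν)}`, `ν = d/2 - 1`. -/
noncomputable def gegenbauerNormalized (d l : ℕ) : ℝ[X] :=
  C (Ring.choose ((l : ℝ) + nuOf d) l)⁻¹ * jacobiPoly l (nuOf d) (nuOf d)

/-- `∫_0^a G_{d,ℓ}(cos r)^q (sin r)^(d-1) dr`. -/
noncomputable def gegenbauerIntegral (d q l : ℕ) (a : ℝ) : ℝ :=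
  ∫ r in (0 : ℝ)..a,
    (gegenbauerNormalized d l).eval (Real.cos r) ^ q * Real.sin r ^ (d - 1)

/-- The Bessel function of the first kind `J_ν(x)`, for real `ν ≥ 0` and `x ≥ 0`, through its
(everywhere convergent) power series. -/
noncomputable def besselJ (ν x : ℝ) : ℝ :=
  ∑' k : ℕ, (-1 : ℝ) ^ k / ((k.factorial : ℝ) * Real.Gamma ((k : ℝ) + ν + 1)) *
    (x / 2) ^ (2 * (k : ℝ) + ν)

/-- The function `j_d(r) = ν! 2^ν r^(-ν) J_ν(r)` for `r > 0`, with `ν = d/2 - 1` and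
`ν! = Γ(ν + 1)`, extended by its limit `j_d(0) = 1`: the Fourier transform of the uniform
probability measure on the unit sphere of `ℝ^d`. -/
noncomputable def sphereFourier (d : ℕ) (r : ℝ) : ℝ :=
  if r = 0 then 1
  else Real.Gamma (nuOf d + 1) * 2 ^ nuOf d / r ^ nuOf d * besselJ (nuOf d) r

/-- `I` is the value of the convergent improper Riemann integral
`I^d_q = ∫_0^∞ j_d(t)^q t^(d-1) dt` (which need not converge absolutely). -/
def IsBesselMoment (d q : ℕ) (I : ℝ) : Prop :=
  Tendsto (fun T : ℝ => ∫ t in (0 : ℝ)..T, sphereFourier d t ^ q * t ^ (d - 1)) atTop (𝓝 I)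

/-!
Write `λ = (d - 1) / 2`. After the substitution `u(r) = (sin r) ^ λ G(cos r)`, the Gegenbauer
equation becomes `u'' + ((n + λ) ^ 2 - λ (λ - 1) / sin ^ 2) u = 0`, a perturbed harmonic oscillator.
Variation of constants from `π / 2` gives
`u(r) = α_n (cos ((n + λ) r - λ π / 2) + O(1 / (n r)))` uniformly for `n r` bounded below
(`abs_gegenbauerLiouville_sub_le`), while at the scale `r = t / n` the polynomial converges to
`j_d(t)` (`tendsto_gegenbauer_cos`). Comparing the two regimes shows that `α_n n ^ λ` has a limit `c`
(`exists_tendsto_amplitude`).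

The integrand is `u ^ q (sin r) ^ (-(q - 2) λ)`. By parity only `a ≤ π / 2` matters. On the bulk
`r ≥ K / n` the power `cos ^ q` may be replaced by its mean value, up to an error controlled by
integration by parts (`abs_bulk_integral_sub_le`). For `q = 2` the bulk dominates and yields
`c ^ 2 / 2 * a`; for `(d, q) = (2, 4)` it yields `3 / 8 * c ^ 4 * log n`; in all other cases it is
negligible against `n ^ (-d)`, uniformly as `K → ∞` (`exists_bulk_integral_le`), and the pole
`r ≤ K / n` yields the Bessel moment, whose convergence comes out of the same comparison
(`exists_moment`).

It remains to see that the limits do not vanish. Since `j_d(‖ξ‖)` is the Fourier transform of the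
uniform probability measure on the sphere (`sphereChar_eq`), the Gaussian regularization
`∫ j_d(t) ^ q exp (-ε t ^ 2) t ^ (d - 1) dt` is, up to a positive factor, the density at the origin
of a random walk with `q` independent steps, uniform on the unit sphere, smoothed by a Gaussian of
width about `√ε`. After one step the density near the sphere is of order `ε ^ (-1/2)`; after two or
more steps it is bounded below on the unit ball, uniformly in `ε` (`exists_gaussianWalk_ge`). Abel
summation then gives positive moments (`IsBesselMoment.pos`). Moreover, `c = 0` would force `j_d` to
have compact support, so that the density at the origin after two steps would stay bounded as
`ε → 0`; but that density is of order `ε ^ (-1/2)`, as the second step has to undo the first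
(`amplitude_limit_ne_zero`).
-/

/-! ### Gegenbauer polynomials -/

theorem choose_succ_mul_real (x : ℝ) (k : ℕ) :
    ((k : ℝ) + 1) * Ring.choose x (k + 1) = (x - k) * Ring.choose x k := by
  have h := Ring.choose_add_smul_choose x k 1
  have h' := Ring.choose_smul_choose x (n := k + 1) (k := k) (Nat.le_succ k)
  have e : k + 1 - k = 1 := by omega
  rw [e, Nat.choose_succ_self_right, Ring.choose_one_right, nsmul_eq_mul] at h'
  push_cast at h'
  linarith

theorem choose_real_pos {x : ℝ} {n : ℕ} (hx : (n : ℝ) - 1 < x) : ∀ k ≤ n, 0 < Ring.choose x k := by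
  intro k
  induction k with
  | zero => intro _; simp
  | succ k ih =>
    intro hk
    have h1 := ih (by omega)
    have h2 := choose_succ_mul_real x k
    have h3 : ((k : ℝ) + 1) ≤ n := by exact_mod_cast hk
    have h4 : 0 < ((k : ℝ) + 1) * Ring.choose x (k + 1) := by
      rw [h2]; exact mul_pos (by linarith) h1
    exact pos_of_mul_pos_right h4 (by positivity)

/-- The coefficient of `((x - 1) / 2) ^ s * ((x + 1) / 2) ^ (n - s)` in the normalized
Gegenbauer polynomial of degree `n`; it vanishes for `s > n`. -/
noncomputable def gegenbauerCoeff (d n : ℕ) : ℕ → ℝ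
  | 0 => 1
  | s + 1 => gegenbauerCoeff d n s *
      (((n - s : ℕ) : ℝ) * ((n - s : ℕ) + nuOf d) / ((s + 1) * (s + 1 + nuOf d)))

theorem nuOf_nonneg {d : ℕ} (hd : 2 ≤ d) : 0 ≤ nuOf d := by
  have : (2 : ℝ) ≤ d := by exact_mod_cast hd
  unfold nuOf; linarith

theorem gegenbauerCoeff_nonneg {d : ℕ} (hd : 2 ≤ d) (n s : ℕ) : 0 ≤ gegenbauerCoeff d n s := by
  have := nuOf_nonneg hd
  induction s with
  | zero => simp [gegenbauerCoeff]
  | succ s ih => unfold gegenbauerCoeff; positivity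

theorem gegenbauerCoeff_succ_mul {d : ℕ} (hd : 2 ≤ d) (n s : ℕ) :
    gegenbauerCoeff d n (s + 1) * ((s + 1) * (s + 1 + nuOf d)) =
      ((n - s : ℕ) : ℝ) * ((n - s : ℕ) + nuOf d) * gegenbauerCoeff d n s := by
  have := nuOf_nonneg hd
  have h : ((s : ℝ) + 1) * (s + 1 + nuOf d) ≠ 0 := by positivity
  rw [gegenbauerCoeff]; field_simp

theorem gegenbauerCoeff_of_lt {d n s : ℕ} (h : n < s) : gegenbauerCoeff d n s = 0 := by
  induction s with
  | zero => omega
  | succ s ih =>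
    rcases Nat.lt_or_ge n s with h' | h'
    · simp [gegenbauerCoeff, ih h']
    · have : n - s = 0 := by omega
      simp [gegenbauerCoeff, this]

theorem gegenbauerCoeff_eq {d n s : ℕ} (hd : 2 ≤ d) (hs : s ≤ n) :
    gegenbauerCoeff d n s = (Ring.choose ((n : ℝ) + nuOf d) n)⁻¹ *
      (Ring.choose ((n : ℝ) + nuOf d) (n - s) * Ring.choose ((n : ℝ) + nuOf d) s) := by
  have hν := nuOf_nonneg hd
  have hpos := choose_real_pos (x := (n : ℝ) + nuOf d) (n := n) (by linarith)
  induction s with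
  | zero => simp [gegenbauerCoeff, (hpos n le_rfl).ne']
  | succ s ih =>
    have h1 := choose_succ_mul_real ((n : ℝ) + nuOf d) s
    have h2 := choose_succ_mul_real ((n : ℝ) + nuOf d) (n - (s + 1))
    have e : n - (s + 1) + 1 = n - s := by omega
    have e' : ((n - s : ℕ) : ℝ) = n - s := by rw [Nat.cast_sub (by omega)]
    have e'' : ((n - (s + 1) : ℕ) : ℝ) = n - (s + 1) := by
      rw [Nat.cast_sub (by omega)]; push_cast; ring
    rw [e, e''] at h2
    rw [gegenbauerCoeff, ih (by omega), e']
    have h3 : (0 : ℝ) < s + 1 + nuOf d := by positivity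
    have hn := (hpos n le_rfl).ne'
    have h4 : Ring.choose ((n : ℝ) + nuOf d) (s + 1) =
        (n + nuOf d - s) * Ring.choose ((n : ℝ) + nuOf d) s / (s + 1) := by
      rw [← h1]; field_simp
    have h5 : Ring.choose ((n : ℝ) + nuOf d) (n - (s + 1)) =
        (n - s) * Ring.choose ((n : ℝ) + nuOf d) (n - s) / (s + 1 + nuOf d) := by
      rw [eq_div_iff h3.ne']; linarith
    rw [h4, h5]
    field_simp
    ring

theorem gegenbauerCoeff_symm {d n s : ℕ} (hd : 2 ≤ d) (hs : s ≤ n) :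
    gegenbauerCoeff d n (n - s) = gegenbauerCoeff d n s := by
  rw [gegenbauerCoeff_eq hd hs, gegenbauerCoeff_eq hd (Nat.sub_le n s), Nat.sub_sub_self hs]
  ring

theorem gegenbauer_eval {d : ℕ} (hd : 2 ≤ d) (n : ℕ) (x : ℝ) :
    (gegenbauerNormalized d n).eval x = ∑ s ∈ Finset.range (n + 1),
      gegenbauerCoeff d n s * (((x - 1) / 2) ^ s * ((x + 1) / 2) ^ (n - s)) := by
  rw [gegenbauerNormalized, jacobiPoly, eval_mul, eval_C, eval_finsetSum, Finset.mul_sum]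
  refine Finset.sum_congr rfl fun s hs => ?_
  rw [gegenbauerCoeff_eq hd (by simpa [Nat.lt_succ_iff] using hs)]
  simp only [eval_mul, eval_pow, eval_sub, eval_add, eval_X, eval_C, eval_one]
  ring

theorem gegenbauer_neg {d : ℕ} (hd : 2 ≤ d) (n : ℕ) (x : ℝ) :
    (gegenbauerNormalized d n).eval (-x) = (-1) ^ n * (gegenbauerNormalized d n).eval x := by
  rw [gegenbauer_eval hd, gegenbauer_eval hd, ← Finset.sum_range_reflect, Finset.mul_sum]
  refine Finset.sum_congr rfl fun s hs => ?_
  have hs' : s ≤ n := by simpa [Nat.lt_succ_iff] using hs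
  have e : n + 1 - 1 - s = n - s := by omega
  have h1 : (-x - 1) / 2 = (-1) * ((x + 1) / 2) := by ring
  have h2 : (-x + 1) / 2 = (-1) * ((x - 1) / 2) := by ring
  rw [e, gegenbauerCoeff_symm hd hs', Nat.sub_sub_self hs', h1, h2, mul_pow, mul_pow]
  have h3 : (-1 : ℝ) ^ n = (-1) ^ (n - s) * (-1) ^ s := by rw [← pow_add]; congr 1; omega
  rw [h3]; ring

/-- The Gegenbauer differential equation. -/
theorem gegenbauer_ode {d : ℕ} (hd : 2 ≤ d) (n : ℕ) (x : ℝ) :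
    (1 - x ^ 2) * (derivative (derivative (gegenbauerNormalized d n))).eval x
      - d * x * (derivative (gegenbauerNormalized d n)).eval x
      + n * (n + d - 1) * (gegenbauerNormalized d n).eval x = 0 := by
  set Y : ℝ[X] := C (1 / 2) * (X - 1) with hY
  set Z : ℝ[X] := C (1 / 2) * (X + 1) with hZ
  have hG : gegenbauerNormalized d n = ∑ s ∈ Finset.range (n + 1),
      C (gegenbauerCoeff d n s) * (Y ^ s * Z ^ (n - s)) := by
    refine Polynomial.funext fun z => ?_
    rw [gegenbauer_eval hd, eval_finsetSum]
    refine Finset.sum_congr rfl fun s _ => ?_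
    simp only [hY, hZ, eval_mul, eval_pow, eval_sub, eval_add, eval_X, eval_C, eval_one]
    ring
  have dY : derivative Y = C (1 / 2) := by simp [hY]
  have dZ : derivative Z = C (1 / 2) := by simp [hZ]
  set y : ℝ := (x - 1) / 2 with hy
  set z : ℝ := (x + 1) / 2 with hz
  have eY : Y.eval x = y := by simp [hY, hy]; ring
  have eZ : Z.eval x = z := by simp [hZ, hz]; ring
  have hx : x = y + z := by rw [hy, hz]; ring
  have hx2 : 1 - x ^ 2 = -4 * (y * z) := by rw [hy, hz]; ring
  have hzy : z - y = 1 := by rw [hy, hz]; ring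
  have hν : (d : ℝ) = 2 * nuOf d + 2 := by unfold nuOf; ring
  -- The defect of each summand telescopes.
  let D : ℕ → ℝ := fun s => gegenbauerCoeff d n s * (s * (s + nuOf d)) *
    (y ^ (s - 1) * z ^ (n - s + 1) - y ^ s * z ^ (n - s))
  have hD : ∑ s ∈ Finset.range (n + 1), (D (s + 1) - D s) = 0 := by
    rw [Finset.sum_range_sub]
    simp [D, gegenbauerCoeff_of_lt]
  rw [hG]
  simp only [derivative_sum, eval_finsetSum, Finset.mul_sum]
  rw [← Finset.sum_sub_distrib, ← Finset.sum_add_distrib, ← hD]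
  refine Finset.sum_congr rfl fun s hs => ?_
  have hs' : s ≤ n := by simpa [Nat.lt_succ_iff] using hs
  obtain ⟨m, rfl⟩ := Nat.exists_eq_add_of_le hs'
  have hc := gegenbauerCoeff_succ_mul hd (s + m) s
  have e1 : s + m - s = m := by omega
  have e2 : s + m - (s + 1) = m - 1 := by omega
  rw [e1] at hc
  simp only [D, e1, e2]
  push_cast
  rw [hc, hx2]
  clear_value y z Y Z
  clear hD D hY hZ hG
  simp only [derivative_mul, derivative_C, derivative_pow, derivative_add,
    dY, dZ, eY, eZ, eval_pow, eval_mul, eval_add, eval_C, zero_mul, zero_add, hν]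
  subst hx
  rcases s with _ | _ | s <;> rcases m with _ | _ | m <;>
    simp [pow_succ] <;> ring

/-! ### The Mehler–Heine limit -/

theorem gegenbauer_cos {d : ℕ} (hd : 2 ≤ d) (n : ℕ) (θ : ℝ) :
    (gegenbauerNormalized d n).eval (Real.cos θ) = ∑ s ∈ Finset.range (n + 1),
      gegenbauerCoeff d n s * ((-1) ^ s * Real.sin (θ / 2) ^ (2 * s) *
        Real.cos (θ / 2) ^ (2 * (n - s))) := by
  rw [gegenbauer_eval hd]
  refine Finset.sum_congr rfl fun s _ => ?_
  have h1 : (Real.cos θ + 1) / 2 = Real.cos (θ / 2) ^ 2 := by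
    rw [Real.cos_sq]; ring_nf
  have h2 : (Real.cos θ - 1) / 2 = (-1) * Real.sin (θ / 2) ^ 2 := by
    rw [Real.sin_sq, ← h1]; ring
  rw [h1, h2, mul_pow, ← pow_mul, ← pow_mul]

/-- The coefficients `1 / (s! (ν + 1) ⋯ (ν + s))` of the power series of
`Γ(ν + 1) 2 ^ ν r ^ (-ν) J_ν(r)` in the variable `- (r / 2) ^ 2`. -/
noncomputable def besselCoeff (ν : ℝ) : ℕ → ℝ
  | 0 => 1
  | s + 1 => besselCoeff ν s / ((s + 1) * (s + 1 + ν))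

theorem besselCoeff_nonneg {ν : ℝ} (hν : 0 ≤ ν) (s : ℕ) : 0 ≤ besselCoeff ν s := by
  induction s with
  | zero => simp [besselCoeff]
  | succ s ih => unfold besselCoeff; positivity

theorem besselCoeff_le {ν : ℝ} (hν : 0 ≤ ν) (s : ℕ) :
    besselCoeff ν s ≤ 1 / (s.factorial : ℝ) := by
  induction s with
  | zero => simp [besselCoeff]
  | succ s ih =>
    rw [besselCoeff, Nat.factorial_succ, div_le_div_iff₀ (by positivity) (by positivity)]
    rw [le_div_iff₀ (by positivity)] at ih
    push_cast
    have h0 := besselCoeff_nonneg hν s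
    have : (0 : ℝ) ≤ s := by positivity
    calc besselCoeff ν s * ((s + 1) * s.factorial) = (s + 1) * (besselCoeff ν s * s.factorial) := by
          ring
      _ ≤ (s + 1) * 1 := by gcongr
      _ ≤ 1 * ((s + 1) * (s + 1 + ν)) := by
          rw [one_mul]; gcongr; linarith

theorem besselCoeff_eq_gamma {ν : ℝ} (hν : 0 ≤ ν) (s : ℕ) :
    besselCoeff ν s =
      Real.Gamma (ν + 1) / ((s.factorial : ℝ) * Real.Gamma ((s : ℝ) + ν + 1)) := by
  induction s with
  | zero =>
    have : Real.Gamma (ν + 1) ≠ 0 := (Real.Gamma_pos_of_pos (by linarith)).ne'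
    simp [besselCoeff, this]
  | succ s ih =>
    have h1 : Real.Gamma (((s + 1 : ℕ) : ℝ) + ν + 1) = (s + ν + 1) * Real.Gamma (s + ν + 1) := by
      rw [← Real.Gamma_add_one (by positivity)]; push_cast; ring_nf
    have h2 : Real.Gamma (s + ν + 1) ≠ 0 := (Real.Gamma_pos_of_pos (by positivity)).ne'
    have h3 : (s : ℝ) + ν + 1 ≠ 0 := by positivity
    have h4 : (s : ℝ) + 1 + ν ≠ 0 := by positivity
    rw [besselCoeff, ih, h1, Nat.factorial_succ]
    push_cast
    field_simp
    ring

theorem sphereFourier_eq_tsum {d : ℕ} (hd : 2 ≤ d) {t : ℝ} (ht : 0 ≤ t) :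
    sphereFourier d t = ∑' s : ℕ, (-1) ^ s * besselCoeff (nuOf d) s * (t / 2) ^ (2 * s) := by
  rcases ht.eq_or_lt with rfl | ht
  · rw [tsum_eq_single 0]
    · simp [sphereFourier, besselCoeff]
    · intro s hs; simp [hs]
  · rw [sphereFourier, if_neg ht.ne', besselJ, ← tsum_mul_left]
    refine tsum_congr fun s => ?_
    rw [besselCoeff_eq_gamma (nuOf_nonneg hd), Real.rpow_add (by positivity),
      Real.div_rpow ht.le (by norm_num) (nuOf d)]
    have h1 : (t / 2) ^ (2 * (s : ℝ)) = (t / 2) ^ (2 * s) := by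
      rw [← Real.rpow_natCast]; push_cast; rfl
    have h2 : (2 : ℝ) ^ nuOf d ≠ 0 := (Real.rpow_pos_of_pos (by norm_num) _).ne'
    have h3 : t ^ nuOf d ≠ 0 := (Real.rpow_pos_of_pos ht _).ne'
    rw [h1]
    field_simp

theorem gegenbauerCoeff_le {d : ℕ} (hd : 2 ≤ d) {n : ℕ} (hn : 1 ≤ n) (s : ℕ) :
    gegenbauerCoeff d n s ≤ ((1 + nuOf d) * (n : ℝ) ^ 2) ^ s * besselCoeff (nuOf d) s := by
  have hν := nuOf_nonneg hd
  induction s with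
  | zero => simp [gegenbauerCoeff, besselCoeff]
  | succ s ih =>
    have hle : ((n - s : ℕ) : ℝ) ≤ n := by exact_mod_cast Nat.sub_le n s
    have hn' : (1 : ℝ) ≤ n := by exact_mod_cast hn
    have h1 : ((n - s : ℕ) : ℝ) * ((n - s : ℕ) + nuOf d) ≤ (1 + nuOf d) * (n : ℝ) ^ 2 := by
      calc ((n - s : ℕ) : ℝ) * ((n - s : ℕ) + nuOf d) ≤ n * (n + nuOf d * n) := by
            gcongr; nlinarith
        _ = _ := by ring
    have h0 := besselCoeff_nonneg hν s
    rw [gegenbauerCoeff, besselCoeff, pow_succ]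
    calc _ ≤ (((1 + nuOf d) * (n : ℝ) ^ 2) ^ s * besselCoeff (nuOf d) s) *
          ((1 + nuOf d) * (n : ℝ) ^ 2 / ((s + 1) * (s + 1 + nuOf d))) := by gcongr
      _ = _ := by ring

/-- The terms of `gegenbauer_cos` at `θ = t / n` are dominated by an exponential series. -/
theorem gegenbauer_term_bound {d : ℕ} (hd : 2 ≤ d) {n : ℕ} (hn : 1 ≤ n) (t : ℝ) (s : ℕ) :
    |gegenbauerCoeff d n s * ((-1) ^ s * Real.sin (t / n / 2) ^ (2 * s) *
        Real.cos (t / n / 2) ^ (2 * (n - s)))| ≤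
      ((1 + nuOf d) * (t / 2) ^ 2) ^ s / (s.factorial : ℝ) := by
  have hν := nuOf_nonneg hd
  have hn' : (0 : ℝ) < n := by exact_mod_cast hn
  rw [abs_mul, abs_mul, abs_mul, abs_pow, abs_pow, abs_pow, abs_neg, abs_one, one_pow, one_mul,
    abs_of_nonneg (gegenbauerCoeff_nonneg hd n s)]
  have h1 : |Real.cos (t / n / 2)| ^ (2 * (n - s)) ≤ 1 :=
    pow_le_one₀ (abs_nonneg _) (Real.abs_cos_le_one _)
  have h2 : |Real.sin (t / n / 2)| ^ (2 * s) ≤ |t / n / 2| ^ (2 * s) := by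
    exact pow_le_pow_left₀ (abs_nonneg _) Real.abs_sin_le_abs _
  have h0 := besselCoeff_nonneg hν s
  calc _ ≤ (((1 + nuOf d) * (n : ℝ) ^ 2) ^ s * besselCoeff (nuOf d) s) *
        (|t / n / 2| ^ (2 * s) * 1) := by
        gcongr
        exact gegenbauerCoeff_le hd hn s
    _ = (((1 + nuOf d) * (t / 2) ^ 2)) ^ s * besselCoeff (nuOf d) s := by
        rw [pow_mul, sq_abs, mul_one, mul_right_comm, ← mul_pow]
        congr 2; field_simp
    _ ≤ (((1 + nuOf d) * (t / 2) ^ 2)) ^ s * (1 / (s.factorial : ℝ)) := by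
        gcongr; exact besselCoeff_le hν s
    _ = _ := by ring

theorem abs_gegenbauer_le_exp {d : ℕ} (hd : 2 ≤ d) {n : ℕ} (hn : 1 ≤ n) (t : ℝ) :
    |(gegenbauerNormalized d n).eval (Real.cos (t / n))| ≤
      Real.exp ((1 + nuOf d) * (t / 2) ^ 2) := by
  have hν := nuOf_nonneg hd
  rw [gegenbauer_cos hd]
  refine (Finset.abs_sum_le_sum_abs _ _).trans ?_
  refine (Finset.sum_le_sum fun s _ => gegenbauer_term_bound hd hn t s).trans ?_
  exact Real.sum_le_exp_of_nonneg (by positivity) _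

theorem tendsto_gegenbauerCoeff {d : ℕ} (hd : 2 ≤ d) (s : ℕ) :
    Tendsto (fun n : ℕ => gegenbauerCoeff d n s / (n : ℝ) ^ (2 * s)) atTop
      (𝓝 (besselCoeff (nuOf d) s)) := by
  have hν := nuOf_nonneg hd
  induction s with
  | zero => simp [gegenbauerCoeff, besselCoeff]
  | succ s ih =>
    have hinv : Tendsto (fun n : ℕ => (1 : ℝ) / n) atTop (𝓝 0) := tendsto_one_div_atTop_nhds_zero_nat
    have h1 : Tendsto (fun n : ℕ => (1 - s * ((1 : ℝ) / n)) * (1 - (s - nuOf d) * ((1 : ℝ) / n)))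
        atTop (𝓝 ((1 - s * 0) * (1 - (s - nuOf d) * 0))) :=
      ((hinv.const_mul _).const_sub _).mul ((hinv.const_mul _).const_sub _)
    have h2 := (ih.mul h1).div_const (((s : ℝ) + 1) * (s + 1 + nuOf d))
    simp only [mul_zero, sub_zero, mul_one] at h2
    rw [besselCoeff]
    refine h2.congr' ?_
    filter_upwards [eventually_ge_atTop (s + 1)] with n hn
    have hn0 : (n : ℝ) ≠ 0 := Nat.cast_ne_zero.2 (by omega)
    rw [gegenbauerCoeff, Nat.cast_sub (by omega)]
    have h3 : (s : ℝ) + 1 + nuOf d ≠ 0 := by positivity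
    field_simp
    ring

theorem tendsto_mul_sin_div (t : ℝ) :
    Tendsto (fun n : ℕ => (n : ℝ) * Real.sin (t / n)) atTop (𝓝 t) := by
  have h0 : Tendsto (fun n : ℕ => t / (n : ℝ)) atTop (𝓝 0) :=
    tendsto_const_div_atTop_nhds_zero_nat t
  have h1 : Tendsto (fun n : ℕ => t * Real.sinc (t / n)) atTop (𝓝 (t * Real.sinc 0)) :=
    ((Real.continuous_sinc.tendsto 0).comp h0).const_mul t
  rw [Real.sinc_zero, mul_one] at h1
  refine h1.congr' ?_
  filter_upwards [eventually_ge_atTop 1] with n hn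
  have hn0 : (n : ℝ) ≠ 0 := Nat.cast_ne_zero.2 (by omega)
  rcases eq_or_ne t 0 with rfl | ht
  · simp
  · rw [Real.sinc_of_ne_zero (div_ne_zero ht hn0)]
    field_simp

theorem tendsto_cos_pow (t : ℝ) (s : ℕ) :
    Tendsto (fun n : ℕ => Real.cos (t / n) ^ (2 * (n - s))) atTop (𝓝 1) := by
  have h0 : Tendsto (fun n : ℕ => 1 - t ^ 2 / (n : ℝ)) atTop (𝓝 1) := by
    simpa using (tendsto_const_div_atTop_nhds_zero_nat (t ^ 2)).const_sub 1
  have h1 : Tendsto (fun n : ℕ => t / (n : ℝ)) atTop (𝓝 0) :=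
    tendsto_const_div_atTop_nhds_zero_nat t
  refine tendsto_of_tendsto_of_tendsto_of_le_of_le' h0 tendsto_const_nhds ?_ ?_
  · filter_upwards [eventually_ge_atTop 1, h1.eventually (Metric.ball_mem_nhds 0 one_pos)]
      with n hn hsmall
    have hn0 : (n : ℝ) ≠ 0 := Nat.cast_ne_zero.2 (by omega)
    have h2 : (t / (n : ℝ)) ^ 2 ≤ 1 := by
      have h : |t / (n : ℝ)| < 1 := by rwa [Real.dist_eq, sub_zero] at hsmall
      exact (sq_le_one_iff_abs_le_one _).2 h.le
    have h3 : 1 - (t / (n : ℝ)) ^ 2 / 2 ≤ Real.cos (t / n) := Real.one_sub_sq_div_two_le_cos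
    have h4 : 0 ≤ Real.cos (t / n) := by linarith
    calc 1 - t ^ 2 / (n : ℝ) = 1 + ((2 * n : ℕ) : ℝ) * (-((t / (n : ℝ)) ^ 2 / 2)) := by
          push_cast; field_simp; ring
      _ ≤ (1 + -((t / (n : ℝ)) ^ 2 / 2)) ^ (2 * n) := one_add_mul_le_pow (by linarith) _
      _ ≤ Real.cos (t / n) ^ (2 * n) := by
          apply pow_le_pow_left₀ <;> linarith
      _ ≤ Real.cos (t / n) ^ (2 * (n - s)) :=
          pow_le_pow_of_le_one h4 (Real.cos_le_one _) (by omega)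
  · filter_upwards with n
    rw [pow_mul]
    exact pow_le_one₀ (sq_nonneg _) (Real.cos_sq_le_one _)

/-- Mehler–Heine: near the north pole, at the scale `1 / n`, the normalized Gegenbauer polynomial
of degree `n` looks like `j_d`. -/
theorem tendsto_gegenbauer_cos {d : ℕ} (hd : 2 ≤ d) {t : ℝ} (ht : 0 ≤ t) :
    Tendsto (fun n : ℕ => (gegenbauerNormalized d n).eval (Real.cos (t / n))) atTop
      (𝓝 (sphereFourier d t)) := by
  rw [sphereFourier_eq_tsum hd ht]
  have key : Tendsto (fun n : ℕ => ∑' s : ℕ, gegenbauerCoeff d n s *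
      ((-1) ^ s * Real.sin (t / n / 2) ^ (2 * s) * Real.cos (t / n / 2) ^ (2 * (n - s)))) atTop
      (𝓝 (∑' s : ℕ, (-1) ^ s * besselCoeff (nuOf d) s * (t / 2) ^ (2 * s))) := by
    refine tendsto_tsum_of_dominated_convergence
      (bound := fun s => ((1 + nuOf d) * (t / 2) ^ 2) ^ s / (s.factorial : ℝ))
      (Real.summable_pow_div_factorial _) (fun s => ?_) ?_
    · have h1 := ((tendsto_gegenbauerCoeff hd s).mul ((tendsto_mul_sin_div (t / 2)).pow (2 * s))).mul
        ((tendsto_cos_pow (t / 2) s).const_mul ((-1) ^ s))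
      refine Tendsto.congr' ?_ (h1.trans (le_of_eq (by ring_nf)))
      filter_upwards [eventually_ge_atTop 1] with n hn
      have hn0 : (n : ℝ) ≠ 0 := by positivity
      rw [show t / 2 / (n : ℝ) = t / n / 2 by ring, mul_pow]
      field_simp
    · filter_upwards [eventually_ge_atTop 1] with n hn s
      exact gegenbauer_term_bound hd hn t s
  refine key.congr fun n => ?_
  rw [gegenbauer_cos hd, tsum_eq_sum]
  intro s hs
  rw [gegenbauerCoeff_of_lt (by simpa [Nat.lt_succ_iff] using hs), zero_mul]

/-! ### Uniform oscillatory asymptotics -/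

theorem abs_sub_le_of_abs_deriv_le {F F' B B' : ℝ → ℝ} {x b : ℝ} (hxb : x ≤ b)
    (hF : ∀ ξ ∈ Set.Icc x b, HasDerivAt F (F' ξ) ξ)
    (hB : ∀ ξ ∈ Set.Icc x b, HasDerivAt B (B' ξ) ξ)
    (h : ∀ ξ ∈ Set.Icc x b, |F' ξ| ≤ B' ξ) : |F b - F x| ≤ B b - B x := by
  have hmono : ∀ σ : ℝ, |σ| = 1 → σ * F b - σ * F x ≤ B b - B x := by
    intro σ hσ
    have hd : ∀ ξ ∈ Set.Icc x b, HasDerivAt (fun ξ => B ξ - σ * F ξ) (B' ξ - σ * F' ξ) ξ :=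
      fun ξ hξ => (hB ξ hξ).sub ((hF ξ hξ).const_mul σ)
    have hm : MonotoneOn (fun ξ => B ξ - σ * F ξ) (Set.Icc x b) := by
      refine monotoneOn_of_deriv_nonneg (convex_Icc x b)
        (fun ξ hξ => (hd ξ hξ).continuousAt.continuousWithinAt)
        (fun ξ hξ => (hd ξ (interior_subset hξ)).differentiableAt.differentiableWithinAt)
        fun ξ hξ => ?_
      rw [(hd ξ (interior_subset hξ)).deriv]
      have := h ξ (interior_subset hξ)
      have h2 : σ * F' ξ ≤ |F' ξ| := by
        calc σ * F' ξ ≤ |σ * F' ξ| := le_abs_self _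
          _ = |F' ξ| := by rw [abs_mul, hσ, one_mul]
      linarith
    have := hm (Set.left_mem_Icc.2 hxb) (Set.right_mem_Icc.2 hxb) hxb
    simp only at this
    linarith
  have h1 := hmono 1 (by simp)
  have h2 := hmono (-1) (by simp)
  rw [abs_le]; constructor <;> linarith

/-- A solution of `u'' + (N ^ 2 - g) u = 0` with `|g| ≤ κ / sin ^ 2` is approximated by the
solution of `v'' + N ^ 2 v = 0` with the same data at `π / 2`. The bound is uniform in the
whole range `N x ≥ 2 κ`, since there the supremum of `|u|` over `[x, π / 2]` can be absorbed. -/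
theorem oscillator_perturbation {u w g : ℝ → ℝ} {N κ x A : ℝ} (hN : 0 < N) (hκ : 0 ≤ κ)
    (hx : 0 < x) (hx' : x ≤ Real.pi / 2) (hNx : 2 * κ ≤ N * x)
    (hu : ∀ ξ ∈ Set.Ioo 0 Real.pi, HasDerivAt u (w ξ) ξ)
    (hw : ∀ ξ ∈ Set.Ioo 0 Real.pi, HasDerivAt w ((g ξ - N ^ 2) * u ξ) ξ)
    (hg : ∀ ξ ∈ Set.Ioo 0 Real.pi, |g ξ| ≤ κ / Real.sin ξ ^ 2)
    (hA : ∀ y : ℝ, |u (Real.pi / 2) * Real.cos y - w (Real.pi / 2) / N * Real.sin y| ≤ A) :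
    |u x - (u (Real.pi / 2) * Real.cos (N * (Real.pi / 2 - x)) -
      w (Real.pi / 2) / N * Real.sin (N * (Real.pi / 2 - x)))| ≤ 2 * A * κ / (N * x) := by
  have hpi := Real.pi_pos
  have hsub : ∀ ξ ∈ Set.Icc x (Real.pi / 2), ξ ∈ Set.Ioo 0 Real.pi := fun ξ hξ =>
    ⟨by linarith [hξ.1], by linarith [hξ.2]⟩
  set V : ℝ → ℝ := fun y => u (Real.pi / 2) * Real.cos (N * (Real.pi / 2 - y)) -
      w (Real.pi / 2) / N * Real.sin (N * (Real.pi / 2 - y)) with hV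
  -- Variation of constants, as a bound: `F` interpolates between `u y` and `V y`, and the
  -- bound `κ / sin ^ 2` on the perturbation integrates to a cotangent, which is at most `1 / x`.
  have duhamel : ∀ M : ℝ, (∀ ξ ∈ Set.Icc x (Real.pi / 2), |u ξ| ≤ M) →
      ∀ y ∈ Set.Icc x (Real.pi / 2), |u y - V y| ≤ M * κ / (N * x) := by
    intro M hM y hy
    have hM0 : 0 ≤ M := (abs_nonneg _).trans (hM y hy)
    set F : ℝ → ℝ := fun ξ =>
      u ξ * Real.cos (N * (ξ - y)) - w ξ / N * Real.sin (N * (ξ - y)) with hF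
    have hys : ∀ ξ ∈ Set.Icc y (Real.pi / 2), ξ ∈ Set.Icc x (Real.pi / 2) := fun ξ hξ =>
      ⟨hy.1.trans hξ.1, hξ.2⟩
    have dF : ∀ ξ ∈ Set.Icc y (Real.pi / 2),
        HasDerivAt F (-(g ξ * u ξ / N * Real.sin (N * (ξ - y)))) ξ := by
      intro ξ hξ
      have h0 := hsub ξ (hys ξ hξ)
      have hl : HasDerivAt (fun ξ => N * (ξ - y)) N ξ := by
        simpa using ((hasDerivAt_id ξ).sub_const y).const_mul N
      refine (((hu ξ h0).mul hl.cos).sub (((hw ξ h0).div_const N).mul hl.sin)).congr_deriv ?_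
      field_simp
      ring
    have dB : ∀ ξ ∈ Set.Icc y (Real.pi / 2),
        HasDerivAt (fun ξ => -(M * κ / N * (Real.cos ξ / Real.sin ξ)))
          (M * κ / N * (1 / Real.sin ξ ^ 2)) ξ := by
      intro ξ hξ
      have h0 := hsub ξ (hys ξ hξ)
      have hs : Real.sin ξ ≠ 0 := (Real.sin_pos_of_pos_of_lt_pi h0.1 h0.2).ne'
      refine ((((Real.hasDerivAt_cos ξ).div (Real.hasDerivAt_sin ξ) hs).const_mul
        (M * κ / N)).neg).congr_deriv ?_
      field_simp
      linear_combination (M * κ) * Real.sin_sq_add_cos_sq ξ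
    have key := abs_sub_le_of_abs_deriv_le hy.2 dF dB ?_
    · have e1 : F (Real.pi / 2) = V y := by simp [hF, hV]
      have e2 : F y = u y := by simp [hF]
      rw [e1, e2, abs_sub_comm, Real.cos_pi_div_two] at key
      refine key.trans ?_
      have hy0 := hsub y hy
      have hs := Real.sin_pos_of_pos_of_lt_pi hy0.1 hy0.2
      have hcot : Real.cos y / Real.sin y ≤ 1 / x := by
        rw [div_le_div_iff₀ hs hx]
        rcases hy.2.eq_or_lt with h | h
        · rw [h, Real.cos_pi_div_two]; simp
        · have hc := Real.cos_pos_of_mem_Ioo ⟨by linarith [hy0.1], h⟩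
          have ht := Real.le_tan hy0.1.le h
          rw [Real.tan_eq_sin_div_cos, le_div_iff₀ hc] at ht
          nlinarith [hy.1]
      calc _ = M * κ / N * (Real.cos y / Real.sin y) := by ring
        _ ≤ M * κ / N * (1 / x) := by gcongr
        _ = _ := by field_simp
    · intro ξ hξ
      have h1 := hM ξ (hys ξ hξ)
      have h2 := hg ξ (hsub ξ (hys ξ hξ))
      rw [abs_neg, abs_mul, abs_div, abs_mul, abs_of_pos hN]
      calc |g ξ| * |u ξ| / N * |Real.sin (N * (ξ - y))|
          ≤ κ / Real.sin ξ ^ 2 * M / N * 1 := by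
            gcongr
            exact Real.abs_sin_le_one _
        _ = _ := by ring
  -- At a maximum point `y` of `|u|` the bound reads `|u y| ≤ A + |u y| / 2`.
  have hcont : ContinuousOn (fun ξ => |u ξ|) (Set.Icc x (Real.pi / 2)) := fun ξ hξ =>
    (hu ξ (hsub ξ hξ)).continuousAt.abs.continuousWithinAt
  obtain ⟨y, hy, hmax⟩ := isCompact_Icc.exists_isMaxOn (Set.nonempty_Icc.2 hx') hcont
  have h1 := duhamel |u y| (fun ξ hξ => hmax hξ) y hy
  have h2 : |u y| ≤ 2 * A := by
    have h3 : |u y| * κ / (N * x) ≤ |u y| / 2 := by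
      rw [div_le_div_iff₀ (by positivity) (by norm_num)]
      nlinarith [abs_nonneg (u y)]
    have h4 : |V y| ≤ A := hA _
    have h5 : |u y| ≤ |u y - V y| + |V y| := by
      simpa using abs_add_le (u y - V y) (V y)
    linarith
  exact duhamel (2 * A) (fun ξ hξ => (hmax hξ).trans h2) x (Set.left_mem_Icc.2 hx')

/-- The exponent `(d - 1) / 2`. -/
noncomputable def lamOf (d : ℕ) : ℝ := ((d : ℝ) - 1) / 2

theorem lamOf_ge {d : ℕ} (hd : 2 ≤ d) : 1 / 2 ≤ lamOf d := by
  have : (2 : ℝ) ≤ d := by exact_mod_cast hd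
  unfold lamOf; linarith

/-- The Liouville normal form `(sin r) ^ λ G(cos r)`, `λ = (d - 1) / 2`, of the normalized
Gegenbauer polynomial. -/
noncomputable def gegenbauerLiouville (d n : ℕ) (r : ℝ) : ℝ :=
  Real.sin r ^ lamOf d * (gegenbauerNormalized d n).eval (Real.cos r)

/-- The derivative of `gegenbauerLiouville` on `(0, π)`. -/
noncomputable def gegenbauerLiouvilleDeriv (d n : ℕ) (r : ℝ) : ℝ :=
  Real.sin r ^ lamOf d * (lamOf d * Real.cos r / Real.sin r *
    (gegenbauerNormalized d n).eval (Real.cos r) -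
      Real.sin r * (derivative (gegenbauerNormalized d n)).eval (Real.cos r))

theorem hasDerivAt_sin_rpow {d : ℕ} {r : ℝ} (hr : r ∈ Set.Ioo 0 Real.pi) :
    HasDerivAt (fun r => Real.sin r ^ lamOf d)
      (Real.sin r ^ lamOf d * (lamOf d * Real.cos r / Real.sin r)) r := by
  have hs := Real.sin_pos_of_pos_of_lt_pi hr.1 hr.2
  refine ((Real.hasDerivAt_sin r).rpow_const (p := lamOf d) (Or.inl hs.ne')).congr_deriv ?_
  rw [Real.rpow_sub_one hs.ne']
  ring

theorem hasDerivAt_eval_cos (p : ℝ[X]) (r : ℝ) :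
    HasDerivAt (fun r => p.eval (Real.cos r)) (-(Real.sin r * (derivative p).eval (Real.cos r))) r := by
  refine ((p.hasDerivAt (Real.cos r)).comp r (Real.hasDerivAt_cos r)).congr_deriv ?_
  ring

theorem hasDerivAt_gegenbauerLiouville {d n : ℕ} {r : ℝ} (hr : r ∈ Set.Ioo 0 Real.pi) :
    HasDerivAt (gegenbauerLiouville d n) (gegenbauerLiouvilleDeriv d n r) r := by
  refine ((hasDerivAt_sin_rpow hr).mul (hasDerivAt_eval_cos _ r)).congr_deriv ?_
  rw [gegenbauerLiouvilleDeriv]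
  ring

theorem hasDerivAt_gegenbauerLiouvilleDeriv {d : ℕ} (hd : 2 ≤ d) {n : ℕ} {r : ℝ}
    (hr : r ∈ Set.Ioo 0 Real.pi) :
    HasDerivAt (gegenbauerLiouvilleDeriv d n)
      ((lamOf d * (lamOf d - 1) / Real.sin r ^ 2 - (n + lamOf d) ^ 2) *
        gegenbauerLiouville d n r) r := by
  have hs := (Real.sin_pos_of_pos_of_lt_pi hr.1 hr.2).ne'
  have h1 := (((Real.hasDerivAt_cos r).const_mul (lamOf d)).div (Real.hasDerivAt_sin r) hs).mul
    (hasDerivAt_eval_cos (gegenbauerNormalized d n) r)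
  have h2 := (Real.hasDerivAt_sin r).mul
    (hasDerivAt_eval_cos (derivative (gegenbauerNormalized d n)) r)
  refine ((hasDerivAt_sin_rpow hr).mul (h1.sub h2)).congr_deriv ?_
  have ode := gegenbauer_ode hd n (Real.cos r)
  have hd' : (d : ℝ) = 2 * lamOf d + 1 := by unfold lamOf; ring
  have hc := Real.sin_sq_add_cos_sq r
  rw [hd'] at ode
  simp only [gegenbauerLiouville, Pi.sub_apply, Pi.mul_apply, Pi.div_apply]
  generalize Real.sin r ^ lamOf d = p at *
  generalize (gegenbauerNormalized d n).eval (Real.cos r) = y0 at *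
  generalize (derivative (gegenbauerNormalized d n)).eval (Real.cos r) = y1 at *
  generalize (derivative (derivative (gegenbauerNormalized d n))).eval (Real.cos r) = y2 at *
  generalize Real.sin r = s at *
  generalize Real.cos r = c at *
  generalize lamOf d = l at *
  field_simp
  linear_combination p * s ^ 2 * ode + p * (l ^ 2 * y0 - l * y0 + s ^ 2 * y2) * hc

/-- The signed amplitude of the oscillation of `gegenbauerLiouville d n`, read off from its
Cauchy data at `π / 2`, one of which vanishes by parity. -/
noncomputable def gegenbauerAmplitude (d n : ℕ) : ℝ :=
  (-1) ^ (n / 2) * if Even n then (gegenbauerNormalized d n).eval 0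
    else (derivative (gegenbauerNormalized d n)).eval 0 / (n + lamOf d)

theorem gegenbauer_eval_zero_of_odd {d : ℕ} (hd : 2 ≤ d) {n : ℕ} (hn : ¬ Even n) :
    (gegenbauerNormalized d n).eval 0 = 0 := by
  have h := gegenbauer_neg hd n 0
  rw [(Nat.not_even_iff_odd.1 hn).neg_one_pow, neg_zero] at h
  linarith

theorem gegenbauer_derivative_eval_zero_of_even {d : ℕ} (hd : 2 ≤ d) {n : ℕ} (hn : Even n) :
    (derivative (gegenbauerNormalized d n)).eval 0 = 0 := by
  have h : (gegenbauerNormalized d n).comp (-X) = gegenbauerNormalized d n := by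
    refine Polynomial.funext fun x => ?_
    simpa [hn.neg_one_pow] using gegenbauer_neg hd n x
  have h2 := congrArg (fun p => (derivative p).eval 0) h
  simp [derivative_comp] at h2
  linarith

/-- The oscillatory asymptotics of Gegenbauer polynomials, uniform for `x ≥ C / n`. -/
theorem abs_gegenbauerLiouville_sub_le {d : ℕ} (hd : 2 ≤ d) {n : ℕ} (hn : 1 ≤ n) {x : ℝ}
    (hx : 0 < x) (hx' : x ≤ Real.pi / 2) (hnx : 2 * |lamOf d * (lamOf d - 1)| ≤ n * x) :
    |gegenbauerLiouville d n x -
      gegenbauerAmplitude d n * Real.cos ((n + lamOf d) * x - lamOf d * (Real.pi / 2))| ≤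
      2 * |gegenbauerAmplitude d n| * |lamOf d * (lamOf d - 1)| / (n * x) := by
  have hl := lamOf_ge hd
  have hn' : (1 : ℝ) ≤ n := by exact_mod_cast hn
  have hN : 0 < (n : ℝ) + lamOf d := by linarith
  have hpi := Real.pi_pos
  set a := gegenbauerAmplitude d n with ha
  have hu : gegenbauerLiouville d n (Real.pi / 2) = (gegenbauerNormalized d n).eval 0 := by
    simp [gegenbauerLiouville]
  have hw : gegenbauerLiouvilleDeriv d n (Real.pi / 2) =
      -(derivative (gegenbauerNormalized d n)).eval 0 := by
    simp [gegenbauerLiouvilleDeriv]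
  have hV : ∀ y : ℝ, gegenbauerLiouville d n (Real.pi / 2) * Real.cos y -
      gegenbauerLiouvilleDeriv d n (Real.pi / 2) / (n + lamOf d) * Real.sin y =
      a * Real.cos (n * (Real.pi / 2) - y) := by
    intro y
    rw [hu, hw, ha, gegenbauerAmplitude]
    by_cases he : Even n
    · rw [if_pos he, gegenbauer_derivative_eval_zero_of_even hd he]
      obtain ⟨m, rfl⟩ := he
      have e : ((m + m : ℕ) : ℝ) * (Real.pi / 2) - y = m * Real.pi - y := by push_cast; ring
      have e2 : (m + m) / 2 = m := by omega
      rw [e, e2, Real.cos_nat_mul_pi_sub]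
      have : ((-1 : ℝ) ^ m) * (-1) ^ m = 1 := by rw [← mul_pow]; simp
      linear_combination (- eval 0 (gegenbauerNormalized d (m + m)) * Real.cos y) * this
    · rw [if_neg he, gegenbauer_eval_zero_of_odd hd he]
      obtain ⟨m, rfl⟩ := Nat.not_even_iff_odd.1 he
      have e : ((2 * m + 1 : ℕ) : ℝ) * (Real.pi / 2) - y = m * Real.pi - (y - Real.pi / 2) := by
        push_cast; ring
      have e2 : (2 * m + 1) / 2 = m := by omega
      rw [e, e2, Real.cos_nat_mul_pi_sub, Real.cos_sub_pi_div_two]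
      have : ((-1 : ℝ) ^ m) * (-1) ^ m = 1 := by rw [← mul_pow]; simp
      linear_combination (- eval 0 (derivative (gegenbauerNormalized d (2 * m + 1))) /
        (((2 * m + 1 : ℕ) : ℝ) + lamOf d) * Real.sin y) * this
  have key := oscillator_perturbation (u := gegenbauerLiouville d n)
    (w := gegenbauerLiouvilleDeriv d n) (N := n + lamOf d) (A := |a|) hN
    (abs_nonneg (lamOf d * (lamOf d - 1))) hx hx' (hnx.trans (by gcongr; linarith))
    (fun ξ hξ => hasDerivAt_gegenbauerLiouville hξ)
    (fun ξ hξ => hasDerivAt_gegenbauerLiouvilleDeriv hd hξ)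
    (fun ξ hξ => by rw [abs_div, abs_of_nonneg (sq_nonneg (Real.sin ξ))]) ?_
  · rw [hV] at key
    have e : n * (Real.pi / 2) - (n + lamOf d) * (Real.pi / 2 - x) =
        (n + lamOf d) * x - lamOf d * (Real.pi / 2) := by ring
    rw [e] at key
    refine key.trans ?_
    gcongr
    linarith
  · intro y
    rw [hV, abs_mul]
    exact mul_le_of_le_one_right (abs_nonneg _) (Real.abs_cos_le_one _)

/-! ### The amplitude of the oscillation -/

theorem tendsto_gegenbauerLiouville {d : ℕ} (hd : 2 ≤ d) {t : ℝ} (ht : 0 < t) :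
    Tendsto (fun n : ℕ => gegenbauerLiouville d n (t / n) * (n : ℝ) ^ lamOf d) atTop
      (𝓝 (t ^ lamOf d * sphereFourier d t)) := by
  have hl := lamOf_ge hd
  have h1 : Tendsto (fun n : ℕ => ((n : ℝ) * Real.sin (t / n)) ^ lamOf d) atTop
      (𝓝 (t ^ lamOf d)) :=
    (tendsto_mul_sin_div t).rpow_const (Or.inl ht.ne')
  refine (h1.mul (tendsto_gegenbauer_cos hd ht.le)).congr' ?_
  have hpi := Real.pi_pos
  filter_upwards [eventually_ge_atTop 1,
    (tendsto_const_div_atTop_nhds_zero_nat t).eventually (gt_mem_nhds hpi)] with n hn hsmall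
  have hn0 : (0 : ℝ) < n := by exact_mod_cast hn
  have hs : 0 ≤ Real.sin (t / n) := (Real.sin_pos_of_pos_of_lt_pi (by positivity) hsmall).le
  rw [gegenbauerLiouville, Real.mul_rpow hn0.le hs]
  ring

/-- The pointwise comparison of `n ^ λ u(t / n)` with the oscillation at fixed `t`. -/
theorem abs_scaled_gegenbauerLiouville_sub_le {d : ℕ} (hd : 2 ≤ d) {t : ℝ} (ht : 0 < t)
    (htk : 2 * |lamOf d * (lamOf d - 1)| ≤ t) : ∀ᶠ n : ℕ in atTop,
    |gegenbauerLiouville d n (t / n) * (n : ℝ) ^ lamOf d -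
      gegenbauerAmplitude d n * (n : ℝ) ^ lamOf d *
        Real.cos ((n + lamOf d) * (t / n) - lamOf d * (Real.pi / 2))| ≤
      2 * |gegenbauerAmplitude d n * (n : ℝ) ^ lamOf d| * |lamOf d * (lamOf d - 1)| / t := by
  have hpi := Real.pi_div_two_pos
  filter_upwards [eventually_ge_atTop 1,
    (tendsto_const_div_atTop_nhds_zero_nat t).eventually (gt_mem_nhds hpi)] with n hn hsmall
  have hn0 : (0 : ℝ) < n := by exact_mod_cast hn
  have e : (n : ℝ) * (t / n) = t := by field_simp
  have h := abs_gegenbauerLiouville_sub_le hd hn (x := t / n) (by positivity) hsmall.le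
    (by rwa [e])
  rw [e] at h
  have hp : 0 < (n : ℝ) ^ lamOf d := Real.rpow_pos_of_pos hn0 _
  have h2 := mul_le_mul_of_nonneg_right h hp.le
  rw [← abs_of_pos hp, ← abs_mul, abs_of_pos hp] at h2
  calc _ = _ := by congr 1; ring
    _ ≤ _ := h2
    _ = _ := by rw [abs_mul (gegenbauerAmplitude d n), abs_of_pos hp]; ring

theorem tendsto_phase (d : ℕ) (t : ℝ) :
    Tendsto (fun n : ℕ => Real.cos ((n + lamOf d) * (t / n) - lamOf d * (Real.pi / 2))) atTop
      (𝓝 (Real.cos (t - lamOf d * (Real.pi / 2)))) := by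
  have h0 : Tendsto (fun n : ℕ => t + lamOf d * (t / (n : ℝ)) - lamOf d * (Real.pi / 2)) atTop
      (𝓝 (t + lamOf d * 0 - lamOf d * (Real.pi / 2))) :=
    (((tendsto_const_div_atTop_nhds_zero_nat t).const_mul _).const_add _).sub_const _
  rw [mul_zero, add_zero] at h0
  refine ((Real.continuous_cos.tendsto _).comp h0).congr' ?_
  filter_upwards [eventually_ge_atTop 1] with n hn
  have hn0 : (n : ℝ) ≠ 0 := Nat.cast_ne_zero.2 (by omega)
  simp only [Function.comp]
  congr 1
  field_simp

/-- There are arbitrarily large `t` at which the phase of the oscillation is a multiple of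
`2 π`. -/
theorem exists_phase_eq_one (d : ℕ) (M : ℝ) :
    ∃ t : ℝ, M ≤ t ∧ Real.cos (t - lamOf d * (Real.pi / 2)) = 1 := by
  obtain ⟨k, hk⟩ := exists_nat_ge (M - lamOf d * (Real.pi / 2))
  refine ⟨k * (2 * Real.pi) + lamOf d * (Real.pi / 2), ?_, ?_⟩
  · have : (k : ℝ) ≤ k * (2 * Real.pi) :=
      le_mul_of_one_le_right (by positivity) (by linarith [Real.pi_gt_three])
    linarith
  · rw [add_sub_cancel_right, Real.cos_nat_mul_two_pi]

/-- At a fixed `t` with phase `1`, the rescaled Liouville normal form converges, and it differs from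
the rescaled amplitude by at most a fraction of the latter. -/
theorem amplitude_bounded {d : ℕ} (hd : 2 ≤ d) :
    ∃ B : ℝ, 0 < B ∧ ∀ᶠ n : ℕ in atTop,
      |gegenbauerAmplitude d n * (n : ℝ) ^ lamOf d| ≤ B := by
  set κ := |lamOf d * (lamOf d - 1)| with hκ
  have hκ0 : 0 ≤ κ := abs_nonneg _
  obtain ⟨t, ht, hcos⟩ := exists_phase_eq_one d (8 * κ + 1)
  have ht0 : 0 < t := by linarith
  set L := t ^ lamOf d * sphereFourier d t with hL
  refine ⟨2 * (|L| + 1), by positivity, ?_⟩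
  have h1 := tendsto_phase d t
  rw [hcos] at h1
  filter_upwards [abs_scaled_gegenbauerLiouville_sub_le hd ht0 (by linarith),
    h1.eventually (lt_mem_nhds (show (3 / 4 : ℝ) < 1 by norm_num)),
    (tendsto_gegenbauerLiouville hd ht0).abs.eventually
      (gt_mem_nhds (show |L| < |L| + 1 by linarith))] with n hn hc hu
  set b := gegenbauerAmplitude d n * (n : ℝ) ^ lamOf d with hb
  set U := gegenbauerLiouville d n (t / n) * (n : ℝ) ^ lamOf d with hU
  set c := Real.cos ((n + lamOf d) * (t / n) - lamOf d * (Real.pi / 2)) with hc'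
  have h3 : 2 * |b| * κ / t ≤ |b| / 4 := by
    rw [div_le_div_iff₀ ht0 (by norm_num)]
    nlinarith [abs_nonneg b]
  have h4 : |b * c| ≤ |U| + |U - b * c| := by
    have := abs_sub U (U - b * c)
    simpa using this
  rw [abs_mul, abs_of_pos (show 0 < c by linarith)] at h4
  nlinarith [abs_nonneg b]

/-- A real sequence that is eventually within `ε` of some constant, for each `ε`, is Cauchy. -/
theorem tendsto_of_approx {S : ℕ → ℝ} (h : ∀ ε > 0, ∃ L : ℝ, ∀ᶠ n in atTop, |S n - L| ≤ ε) :
    ∃ c, Tendsto S atTop (𝓝 c) := by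
  refine cauchySeq_tendsto_of_complete (Metric.cauchySeq_iff'.2 fun ε hε => ?_)
  obtain ⟨L, hL⟩ := h (ε / 3) (by positivity)
  obtain ⟨N, hN⟩ := eventually_atTop.1 hL
  refine ⟨N, fun n hn => ?_⟩
  have h1 := hN n hn
  have h2 := hN N le_rfl
  rw [Real.dist_eq]
  rw [abs_le] at h1 h2
  rw [abs_lt]
  constructor <;> linarith [h1.1, h1.2, h2.1, h2.2]

/-- The rescaled amplitudes converge: at a large `t` with phase `1` they are within `ε` of the
Mehler–Heine limit `t ^ λ j_d(t)`. No asymptotics of Bessel functions enter. -/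
theorem exists_tendsto_amplitude {d : ℕ} (hd : 2 ≤ d) :
    ∃ c : ℝ, Tendsto (fun n : ℕ => gegenbauerAmplitude d n * (n : ℝ) ^ lamOf d) atTop (𝓝 c) := by
  set κ := |lamOf d * (lamOf d - 1)| with hκ
  have hκ0 : 0 ≤ κ := abs_nonneg _
  obtain ⟨B, hB, hbound⟩ := amplitude_bounded hd
  refine tendsto_of_approx fun ε hε => ?_
  obtain ⟨t, ht, hcos⟩ := exists_phase_eq_one d (2 * κ + 1 + 6 * B * κ / ε)
  have hpos : 0 ≤ 6 * B * κ / ε := by positivity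
  have ht0 : 0 < t := by linarith
  set L := t ^ lamOf d * sphereFourier d t with hL
  refine ⟨L, ?_⟩
  have h1 := tendsto_phase d t
  rw [hcos] at h1
  filter_upwards [abs_scaled_gegenbauerLiouville_sub_le hd ht0 (by linarith), hbound,
    h1.eventually (lt_mem_nhds (show 1 - ε / (3 * B) < (1 : ℝ) by
      have : 0 < ε / (3 * B) := by positivity
      linarith)),
    Metric.tendsto_nhds.1 (tendsto_gegenbauerLiouville hd ht0) (ε / 3) (by positivity)]
    with n hn hb hc hu
  rw [Real.dist_eq] at hu
  set b := gegenbauerAmplitude d n * (n : ℝ) ^ lamOf d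
  set U := gegenbauerLiouville d n (t / n) * (n : ℝ) ^ lamOf d
  set c := Real.cos ((n + lamOf d) * (t / n) - lamOf d * (Real.pi / 2)) with hc'
  have h3 : 2 * |b| * κ / t ≤ ε / 3 := by
    have h5 : 6 * B * κ ≤ ε * t := by
      have : 6 * B * κ / ε ≤ t := by linarith
      rw [div_le_iff₀ hε] at this; linarith
    rw [div_le_div_iff₀ ht0 (by norm_num)]
    nlinarith [mul_le_mul_of_nonneg_right hb hκ0]
  have h4 : |b - b * c| ≤ ε / 3 := by
    have hc1 : c ≤ 1 := Real.cos_le_one _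
    rw [show b - b * c = b * (1 - c) by ring, abs_mul, abs_of_nonneg (by linarith : 0 ≤ 1 - c)]
    calc |b| * (1 - c) ≤ B * (ε / (3 * B)) := by
          gcongr
          linarith
      _ = ε / 3 := by field_simp
  have h5 := hn.trans h3
  rw [abs_le] at h4 h5 ⊢
  rw [abs_lt] at hu
  constructor <;> linarith [h4.1, h4.2, h5.1, h5.2, hu.1, hu.2]

/-- With vanishing amplitude the oscillatory asymptotics leave nothing in the Mehler–Heine limit. -/
theorem sphereFourier_eq_zero_of_amplitude {d : ℕ} (hd : 2 ≤ d)
    (h : Tendsto (fun n : ℕ => gegenbauerAmplitude d n * (n : ℝ) ^ lamOf d) atTop (𝓝 0)) {t : ℝ}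
    (ht : 0 < t) (ht' : 2 * |lamOf d * (lamOf d - 1)| ≤ t) : sphereFourier d t = 0 := by
  have h1 := ((tendsto_gegenbauerLiouville hd ht).sub (h.mul (tendsto_phase d t))).abs
  have h2 := ((h.abs.const_mul 2).mul_const |lamOf d * (lamOf d - 1)|).div_const t
  have h3 := le_of_tendsto_of_tendsto h1 h2 (abs_scaled_gegenbauerLiouville_sub_le hd ht ht')
  simp only [abs_zero, mul_zero, zero_mul, zero_div, sub_zero, abs_nonpos_iff] at h3
  exact (mul_eq_zero.1 h3).resolve_left (Real.rpow_pos_of_pos ht _).ne'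

/-! ### Oscillatory integrals over the bulk -/

theorem continuousOn_sin_rpow (p : ℝ) :
    ContinuousOn (fun x => Real.sin x ^ p) (Set.Ioo 0 Real.pi) := fun _ hx =>
  (Real.continuous_sin.continuousAt.rpow_const
    (Or.inl (Real.sin_pos_of_pos_of_lt_pi hx.1 hx.2).ne')).continuousWithinAt

theorem Icc_subset_Ioo_zero_pi {r₁ r₂ : ℝ} (h₁ : 0 < r₁) (h₂ : r₂ ≤ Real.pi / 2) :
    Set.Icc r₁ r₂ ⊆ Set.Ioo 0 Real.pi := fun x hx =>
  ⟨by linarith [hx.1], by linarith [hx.2, Real.pi_pos]⟩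

/-- Integration by parts: an oscillation with bounded primitive, against the monotone weight
`(sin x) ^ (-p)`. -/
theorem abs_integral_oscillation_le {h H : ℝ → ℝ} {H₀ N φ p r₁ r₂ : ℝ} (hN : 0 < N)
    (hp : 0 ≤ p) (hh : Continuous h) (hH : ∀ y, HasDerivAt H (h y) y) (hH₀ : ∀ y, |H y| ≤ H₀)
    (h₁ : 0 < r₁) (h₁₂ : r₁ ≤ r₂) (h₂ : r₂ ≤ Real.pi / 2) :
    |∫ x in r₁..r₂, h (N * x - φ) * Real.sin x ^ (-p)| ≤
      2 * H₀ / N * Real.sin r₁ ^ (-p) := by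
  have hsub := Icc_subset_Ioo_zero_pi h₁ h₂
  have hHc : Continuous H := continuous_iff_continuousAt.2 fun y => (hH y).continuousAt
  have hH0 : 0 ≤ H₀ := (abs_nonneg _).trans (hH₀ 0)
  set g : ℝ → ℝ := fun x => Real.sin x ^ (-p) with hg
  set g' : ℝ → ℝ := fun x => Real.cos x * (-p) * Real.sin x ^ (-p - 1) with hg'
  have dg : ∀ x ∈ Set.Icc r₁ r₂, HasDerivAt g (g' x) x := fun x hx =>
    (Real.hasDerivAt_sin x).rpow_const
      (Or.inl (Real.sin_pos_of_pos_of_lt_pi (hsub hx).1 (hsub hx).2).ne')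
  have cg : ContinuousOn g (Set.Icc r₁ r₂) := (continuousOn_sin_rpow _).mono hsub
  have cg' : ContinuousOn g' (Set.Icc r₁ r₂) :=
    ((Real.continuous_cos.mul continuous_const).continuousOn).mul
      ((continuousOn_sin_rpow _).mono hsub)
  have g'nonpos : ∀ x ∈ Set.Icc r₁ r₂, g' x ≤ 0 := by
    intro x hx
    have h0 := hsub hx
    have hc : 0 ≤ Real.cos x := Real.cos_nonneg_of_mem_Icc ⟨by linarith [h0.1, Real.pi_pos],
      hx.2.trans h₂⟩
    have hs : 0 ≤ Real.sin x ^ (-p - 1) :=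
      Real.rpow_nonneg (Real.sin_pos_of_pos_of_lt_pi h0.1 h0.2).le _
    have := mul_nonneg (mul_nonneg hc hp) hs
    simp only [hg']
    linarith
  have cl : Continuous fun x : ℝ => N * x - φ := by fun_prop
  have u : Set.uIcc r₁ r₂ = Set.Icc r₁ r₂ := Set.uIcc_of_le h₁₂
  have i1 : IntervalIntegrable (fun x => h (N * x - φ) * g x) MeasureTheory.volume r₁ r₂ :=
    ContinuousOn.intervalIntegrable (by rw [u]; exact (hh.comp cl).continuousOn.mul cg)
  have i2 : IntervalIntegrable (fun x => H (N * x - φ) / N * g' x) MeasureTheory.volume r₁ r₂ :=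
    ContinuousOn.intervalIntegrable (by
      rw [u]; exact ((hHc.comp cl).div_const N).continuousOn.mul cg')
  have i3 : IntervalIntegrable g' MeasureTheory.volume r₁ r₂ :=
    ContinuousOn.intervalIntegrable (by rwa [u])
  have dF : ∀ x ∈ Set.uIcc r₁ r₂, HasDerivAt (fun x => H (N * x - φ) / N * g x)
      (h (N * x - φ) * g x + H (N * x - φ) / N * g' x) x := by
    intro x hx
    rw [u] at hx
    have hl : HasDerivAt (fun x : ℝ => N * x - φ) N x := by
      simpa using ((hasDerivAt_id x).const_mul N).sub_const φ
    refine ((((hH (N * x - φ)).comp x hl).div_const N).mul (dg x hx)).congr_deriv ?_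
    simp only [Function.comp]
    field_simp
  have e1 := intervalIntegral.integral_eq_sub_of_hasDerivAt dF (i1.add i2)
  rw [intervalIntegral.integral_add i1 i2] at e1
  have e2 : ∫ x in r₁..r₂, g' x = g r₂ - g r₁ :=
    intervalIntegral.integral_eq_sub_of_hasDerivAt (fun x hx => dg x (by rwa [u] at hx)) i3
  have e3 : |∫ x in r₁..r₂, H (N * x - φ) / N * g' x| ≤ H₀ / N * (g r₁ - g r₂) := by
    rw [← neg_sub (g r₂), ← e2, ← intervalIntegral.integral_neg,
      ← intervalIntegral.integral_const_mul, ← Real.norm_eq_abs]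
    refine intervalIntegral.norm_integral_le_of_norm_le h₁₂ ?_ (i3.neg.const_mul _)
    refine MeasureTheory.ae_of_all _ fun x hx => ?_
    have hx' : x ∈ Set.Icc r₁ r₂ := ⟨hx.1.le, hx.2⟩
    rw [Real.norm_eq_abs, abs_mul, abs_div, abs_of_pos hN, abs_of_nonpos (g'nonpos x hx')]
    gcongr
    · linarith [g'nonpos x hx']
    · exact hH₀ _
  have gpos : ∀ x ∈ Set.Icc r₁ r₂, 0 ≤ g x := fun x hx =>
    Real.rpow_nonneg (Real.sin_pos_of_pos_of_lt_pi (hsub hx).1 (hsub hx).2).le _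
  have e4 : ∀ x ∈ Set.Icc r₁ r₂, |H (N * x - φ) / N * g x| ≤ H₀ / N * g x := by
    intro x hx
    rw [abs_mul, abs_div, abs_of_pos hN, abs_of_nonneg (gpos x hx)]
    have := gpos x hx
    gcongr
    exact hH₀ _
  have e5 := e4 r₁ (Set.left_mem_Icc.2 h₁₂)
  have e6 := e4 r₂ (Set.right_mem_Icc.2 h₁₂)
  have e7 : 2 * H₀ / N * g r₁ = H₀ / N * g r₁ + H₀ / N * g r₁ := by ring
  change |∫ x in r₁..r₂, h (N * x - φ) * g x| ≤ 2 * H₀ / N * g r₁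
  rw [e7]
  rw [abs_le] at e3 e5 e6 ⊢
  constructor <;> nlinarith [e3.1, e3.2, e5.1, e5.2, e6.1, e6.2]

/-- The integrand in terms of the Liouville normal form. -/
theorem integrand_eq_liouville {d : ℕ} (hd : 2 ≤ d) (q n : ℕ) {r : ℝ}
    (hr : r ∈ Set.Ioo 0 Real.pi) :
    (gegenbauerNormalized d n).eval (Real.cos r) ^ q * Real.sin r ^ (d - 1) =
      gegenbauerLiouville d n r ^ q * Real.sin r ^ (-(((q : ℝ) - 2) * lamOf d)) := by
  have hs := Real.sin_pos_of_pos_of_lt_pi hr.1 hr.2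
  rw [gegenbauerLiouville, mul_pow, ← Real.rpow_mul_natCast hs.le, mul_right_comm,
    ← Real.rpow_add hs, mul_comm]
  congr 1
  rw [← Real.rpow_natCast, Nat.cast_sub (by omega)]
  congr 1
  unfold lamOf
  push_cast
  ring

theorem abs_liouville_le {d : ℕ} (hd : 2 ≤ d) {n : ℕ} (hn : 1 ≤ n) {x : ℝ}
    (hx : 0 < x) (hx' : x ≤ Real.pi / 2) (hnx : 2 * |lamOf d * (lamOf d - 1)| ≤ n * x) :
    |gegenbauerLiouville d n x| ≤ 2 * |gegenbauerAmplitude d n| := by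
  have hn0 : (0 : ℝ) < n := by exact_mod_cast hn
  have h := abs_gegenbauerLiouville_sub_le hd hn hx hx' hnx
  set a := gegenbauerAmplitude d n
  set c := Real.cos ((n + lamOf d) * x - lamOf d * (Real.pi / 2))
  have h1 : |a * c| ≤ |a| := by
    rw [abs_mul]; exact mul_le_of_le_one_right (abs_nonneg _) (Real.abs_cos_le_one _)
  have h2 : 2 * |a| * |lamOf d * (lamOf d - 1)| / (n * x) ≤ |a| := by
    rw [div_le_iff₀ (by positivity)]
    nlinarith [abs_nonneg a]
  have h3 : |gegenbauerLiouville d n x| ≤ |gegenbauerLiouville d n x - a * c| + |a * c| := by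
    simpa using abs_add_le (gegenbauerLiouville d n x - a * c) (a * c)
  linarith

theorem continuousOn_liouville (d n : ℕ) :
    ContinuousOn (gegenbauerLiouville d n) (Set.Ioo 0 Real.pi) := fun _ hx =>
  (hasDerivAt_gegenbauerLiouville hx).continuousAt.continuousWithinAt

/-- On the bulk the integral is its oscillatory average: replacing `u ^ q` by `m a ^ q`, with `m`
the mean value of `cos ^ q`, costs an error smaller by a factor `n`. -/
theorem abs_bulk_integral_sub_le {d : ℕ} (hd : 2 ≤ d) {q n : ℕ} (hq : 2 ≤ q) (hn : 1 ≤ n)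
    {H : ℝ → ℝ} {H₀ m r₁ r₂ : ℝ} (hH : ∀ y, HasDerivAt H (Real.cos y ^ q - m) y)
    (hH₀ : ∀ y, |H y| ≤ H₀)
    (h₁ : 0 < r₁) (h₁₂ : r₁ ≤ r₂) (h₂ : r₂ ≤ Real.pi / 2)
    (hnr : 2 * |lamOf d * (lamOf d - 1)| ≤ n * r₁) :
    |(∫ r in r₁..r₂, (gegenbauerNormalized d n).eval (Real.cos r) ^ q * Real.sin r ^ (d - 1)) -
      m * gegenbauerAmplitude d n ^ q *
        ∫ r in r₁..r₂, Real.sin r ^ (-(((q : ℝ) - 2) * lamOf d))| ≤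
    |gegenbauerAmplitude d n| ^ q / n * (q * 2 ^ q * |lamOf d * (lamOf d - 1)| *
      (∫ r in r₁..r₂, 1 / r * Real.sin r ^ (-(((q : ℝ) - 2) * lamOf d))) +
        2 * H₀ * Real.sin r₁ ^ (-(((q : ℝ) - 2) * lamOf d))) := by
  have hl := lamOf_ge hd
  have hn0 : (0 : ℝ) < n := by exact_mod_cast hn
  have hsub := Icc_subset_Ioo_zero_pi h₁ h₂
  have hq' : (2 : ℝ) ≤ q := by exact_mod_cast hq
  set p := ((q : ℝ) - 2) * lamOf d with hp
  have hp0 : 0 ≤ p := mul_nonneg (by linarith) (by linarith)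
  set a := gegenbauerAmplitude d n with ha
  set κ := |lamOf d * (lamOf d - 1)| with hκ
  have hκ0 : 0 ≤ κ := abs_nonneg _
  set N := (n : ℝ) + lamOf d with hN
  have hN0 : 0 < N := by linarith
  set φ := lamOf d * (Real.pi / 2) with hφ
  set u := gegenbauerLiouville d n with hu
  have uI : Set.uIcc r₁ r₂ = Set.Icc r₁ r₂ := Set.uIcc_of_le h₁₂
  have cs : ContinuousOn (fun x => Real.sin x ^ (-p)) (Set.Icc r₁ r₂) :=
    (continuousOn_sin_rpow _).mono hsub
  have cu : ContinuousOn u (Set.Icc r₁ r₂) := (continuousOn_liouville d n).mono hsub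
  have hs0 : ∀ x ∈ Set.Icc r₁ r₂, 0 ≤ Real.sin x ^ (-p) := fun x hx =>
    Real.rpow_nonneg (Real.sin_pos_of_pos_of_lt_pi (hsub hx).1 (hsub hx).2).le _
  have i1 : IntervalIntegrable (fun r => (u r ^ q - (a * Real.cos (N * r - φ)) ^ q) *
      Real.sin r ^ (-p)) MeasureTheory.volume r₁ r₂ := by
    refine ContinuousOn.intervalIntegrable ?_
    rw [uI]
    exact ((cu.pow q).sub (by fun_prop)).mul cs
  have i2 : IntervalIntegrable (fun r => a ^ q * ((Real.cos (N * r - φ) ^ q - m) *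
      Real.sin r ^ (-p))) MeasureTheory.volume r₁ r₂ := by
    refine ContinuousOn.intervalIntegrable ?_
    rw [uI]
    exact continuousOn_const.mul (ContinuousOn.mul (by fun_prop) cs)
  have i3 : IntervalIntegrable (fun r => m * a ^ q * Real.sin r ^ (-p))
      MeasureTheory.volume r₁ r₂ := by
    refine ContinuousOn.intervalIntegrable ?_
    rw [uI]
    exact continuousOn_const.mul cs
  have i4 : IntervalIntegrable (fun r => 1 / r * Real.sin r ^ (-p))
      MeasureTheory.volume r₁ r₂ := by
    refine ContinuousOn.intervalIntegrable ?_
    rw [uI]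
    exact (continuousOn_const.div continuousOn_id fun x hx => (hsub hx).1.ne').mul cs
  have split : (∫ r in r₁..r₂,
      (gegenbauerNormalized d n).eval (Real.cos r) ^ q * Real.sin r ^ (d - 1)) -
      m * a ^ q * ∫ r in r₁..r₂, Real.sin r ^ (-p) =
      (∫ r in r₁..r₂, (u r ^ q - (a * Real.cos (N * r - φ)) ^ q) * Real.sin r ^ (-p)) +
      a ^ q * ∫ r in r₁..r₂, (Real.cos (N * r - φ) ^ q - m) * Real.sin r ^ (-p) := by
    rw [← intervalIntegral.integral_const_mul, ← intervalIntegral.integral_const_mul,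
      ← intervalIntegral.integral_add i1 i2, sub_eq_iff_eq_add,
      ← intervalIntegral.integral_add (i1.add i2) i3]
    refine intervalIntegral.integral_congr fun r hr => ?_
    rw [uI] at hr
    rw [integrand_eq_liouville hd q n (hsub hr), mul_pow]
    ring
  rw [split]
  have b1 : |∫ r in r₁..r₂, (u r ^ q - (a * Real.cos (N * r - φ)) ^ q) * Real.sin r ^ (-p)| ≤
      |a| ^ q / n * (q * 2 ^ q * κ) * ∫ r in r₁..r₂, 1 / r * Real.sin r ^ (-p) := by
    rw [← intervalIntegral.integral_const_mul, ← Real.norm_eq_abs]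
    refine intervalIntegral.norm_integral_le_of_norm_le h₁₂ ?_ (i4.const_mul _)
    refine MeasureTheory.ae_of_all _ fun r hr => ?_
    have hr' : r ∈ Set.Icc r₁ r₂ := ⟨hr.1.le, hr.2⟩
    have hr0 := (hsub hr').1
    have hnr' : 2 * κ ≤ n * r := hnr.trans (by gcongr; exact hr.1.le)
    have k1 := abs_gegenbauerLiouville_sub_le hd hn hr0 (hr.2.trans h₂) hnr'
    have k2 := abs_liouville_le hd hn hr0 (hr.2.trans h₂) hnr'
    have k3 : |a * Real.cos (N * r - φ)| ≤ 2 * |a| := by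
      rw [abs_mul]
      nlinarith [Real.abs_cos_le_one (N * r - φ), abs_nonneg a]
    have k4 := abs_pow_sub_pow_le (u r) (a * Real.cos (N * r - φ)) q
    rw [Real.norm_eq_abs, abs_mul, abs_of_nonneg (hs0 r hr')]
    have hs := hs0 r hr'
    calc _ ≤ (q * (2 * |a|) ^ (q - 1) * (2 * |a| * κ / (n * r))) * Real.sin r ^ (-p) := by
          gcongr
          calc _ ≤ _ := k4
            _ ≤ (2 * |a| * κ / (n * r)) * q * (2 * |a|) ^ (q - 1) := by
                gcongr
                exact max_le k2 k3
            _ = _ := by ring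
      _ = (q * ((2 * |a|) ^ (q - 1) * (2 * |a|)) * κ / (n * r)) * Real.sin r ^ (-p) := by ring
      _ = _ := by
          rw [← pow_succ, Nat.sub_add_cancel (by omega), mul_pow]
          field_simp
  have b2 := abs_integral_oscillation_le (φ := φ) hN0 hp0
    (h := fun y => Real.cos y ^ q - m) (by fun_prop) hH hH₀ h₁ h₁₂ h₂
  have hH0 : 0 ≤ H₀ := (abs_nonneg _).trans (hH₀ 0)
  have hs1 := hs0 r₁ (Set.left_mem_Icc.2 h₁₂)
  refine (abs_add_le _ _).trans ?_
  rw [abs_mul, abs_pow]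
  calc _ ≤ |a| ^ q / n * (q * 2 ^ q * κ) * (∫ r in r₁..r₂, 1 / r * Real.sin r ^ (-p)) +
        |a| ^ q * (2 * H₀ / n * Real.sin r₁ ^ (-p)) := by
        refine add_le_add b1 (mul_le_mul_of_nonneg_left (b2.trans ?_) (by positivity))
        gcongr
        linarith
    _ = _ := by ring

theorem sin_rpow_neg_le {p r : ℝ} (hp : 0 ≤ p) (hr : 0 < r) (hr' : r ≤ Real.pi / 2) :
    Real.sin r ^ (-p) ≤ (Real.pi / 2) ^ p * r ^ (-p) := by
  have hpi := Real.pi_pos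
  have h := Real.mul_le_sin hr.le hr'
  have h1 : 0 < 2 / Real.pi * r := by positivity
  calc Real.sin r ^ (-p) ≤ (2 / Real.pi * r) ^ (-p) :=
        Real.rpow_le_rpow_of_nonpos h1 h (by linarith)
    _ = (Real.pi / 2) ^ p * r ^ (-p) := by
        rw [Real.mul_rpow (by positivity) hr.le, Real.rpow_neg (by positivity), ←
          Real.inv_rpow (by positivity), inv_div]

theorem integral_rpow_neg_le {s r₁ r₂ : ℝ} (hs : 1 < s) (h₁ : 0 < r₁) (h₁₂ : r₁ ≤ r₂) :
    ∫ r in r₁..r₂, r ^ (-s) ≤ r₁ ^ (1 - s) / (s - 1) := by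
  have h0 : (0 : ℝ) ∉ Set.uIcc r₁ r₂ := by
    rw [Set.uIcc_of_le h₁₂]; exact fun h => absurd h.1 (by linarith)
  rw [integral_rpow (Or.inr ⟨by linarith, h0⟩)]
  have h2 : 0 ≤ r₂ ^ (-s + 1) := Real.rpow_nonneg (by linarith) _
  rw [show (r₂ ^ (-s + 1) - r₁ ^ (-s + 1)) / (-s + 1) =
    (r₁ ^ (1 - s) - r₂ ^ (-s + 1)) / (s - 1) by
      rw [← neg_div_neg_eq]; ring_nf]
  gcongr
  · linarith

theorem intervalIntegrable_sin_rpow {p r₁ r₂ : ℝ} (h₁ : 0 < r₁) (h₁₂ : r₁ ≤ r₂)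
    (h₂ : r₂ ≤ Real.pi / 2) :
    IntervalIntegrable (fun r => Real.sin r ^ p) MeasureTheory.volume r₁ r₂ := by
  refine ContinuousOn.intervalIntegrable ?_
  rw [Set.uIcc_of_le h₁₂]
  exact (continuousOn_sin_rpow _).mono (Icc_subset_Ioo_zero_pi h₁ h₂)

theorem intervalIntegrable_rpow_of_pos {s r₁ r₂ : ℝ} (h₁ : 0 < r₁) (h₁₂ : r₁ ≤ r₂) :
    IntervalIntegrable (fun r => r ^ s) MeasureTheory.volume r₁ r₂ := by
  refine intervalIntegral.intervalIntegrable_rpow (Or.inr ?_)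
  rw [Set.uIcc_of_le h₁₂]; exact fun h => absurd h.1 (by linarith)

theorem integral_sin_rpow_neg_le {p r₁ r₂ : ℝ} (hp : 1 < p) (h₁ : 0 < r₁) (h₁₂ : r₁ ≤ r₂)
    (h₂ : r₂ ≤ Real.pi / 2) :
    ∫ r in r₁..r₂, Real.sin r ^ (-p) ≤ (Real.pi / 2) ^ p / (p - 1) * r₁ ^ (1 - p) := by
  have hpi := Real.pi_pos
  calc _ ≤ ∫ r in r₁..r₂, (Real.pi / 2) ^ p * r ^ (-p) :=
        intervalIntegral.integral_mono_on h₁₂ (intervalIntegrable_sin_rpow h₁ h₁₂ h₂)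
          ((intervalIntegrable_rpow_of_pos h₁ h₁₂).const_mul _) fun r hr =>
            sin_rpow_neg_le (by linarith) (h₁.trans_le hr.1) (hr.2.trans h₂)
    _ ≤ (Real.pi / 2) ^ p * (r₁ ^ (1 - p) / (p - 1)) := by
        rw [intervalIntegral.integral_const_mul]
        gcongr
        exact integral_rpow_neg_le hp h₁ h₁₂
    _ = _ := by ring

theorem integral_inv_mul_sin_rpow_neg_le {p r₁ r₂ : ℝ} (hp : 0 < p) (h₁ : 0 < r₁)
    (h₁₂ : r₁ ≤ r₂) (h₂ : r₂ ≤ Real.pi / 2) :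
    ∫ r in r₁..r₂, 1 / r * Real.sin r ^ (-p) ≤ (Real.pi / 2) ^ p / p * r₁ ^ (-p) := by
  have hpi := Real.pi_pos
  calc _ ≤ ∫ r in r₁..r₂, (Real.pi / 2) ^ p * r ^ (-(1 + p)) := by
        refine intervalIntegral.integral_mono_on h₁₂ ?_
          ((intervalIntegrable_rpow_of_pos h₁ h₁₂).const_mul _) fun r hr => ?_
        · refine ContinuousOn.intervalIntegrable ?_
          rw [Set.uIcc_of_le h₁₂]
          have hsub := Icc_subset_Ioo_zero_pi h₁ h₂
          exact (continuousOn_const.div continuousOn_id fun x hx => (hsub hx).1.ne').mul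
            ((continuousOn_sin_rpow _).mono hsub)
        · have hr0 : 0 < r := h₁.trans_le hr.1
          calc 1 / r * Real.sin r ^ (-p) ≤ 1 / r * ((Real.pi / 2) ^ p * r ^ (-p)) := by
                gcongr
                exact sin_rpow_neg_le hp.le hr0 (hr.2.trans h₂)
            _ = _ := by
                rw [neg_add, Real.rpow_add hr0, Real.rpow_neg_one]; ring
    _ ≤ (Real.pi / 2) ^ p * (r₁ ^ (1 - (1 + p)) / ((1 + p) - 1)) := by
        rw [intervalIntegral.integral_const_mul]
        gcongr
        exact integral_rpow_neg_le (by linarith) h₁ h₁₂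
    _ = _ := by rw [show 1 - (1 + p) = -p by ring, show 1 + p - 1 = p by ring]; ring

/-- An odd power of the cosine has mean value zero, hence a bounded primitive. -/
theorem exists_primitive_cos_pow_odd {q : ℕ} (hq : Odd q) :
    ∃ H : ℝ → ℝ, (∀ y, HasDerivAt H (Real.cos y ^ q - 0) y) ∧ ∀ y, |H y| ≤ 1 := by
  obtain ⟨m, rfl⟩ := hq
  have hc : Continuous fun s : ℝ => (1 - s ^ 2) ^ m := by fun_prop
  refine ⟨fun y => ∫ s in (0 : ℝ)..Real.sin y, (1 - s ^ 2) ^ m, fun y => ?_, fun y => ?_⟩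
  · refine ((hc.integral_hasStrictDerivAt 0 (Real.sin y)).hasDerivAt.comp y
      (Real.hasDerivAt_sin y)).congr_deriv ?_
    rw [← Real.cos_sq']
    ring
  · rw [← Real.norm_eq_abs]
    refine (intervalIntegral.norm_integral_le_of_norm_le_const (C := 1) fun s hs => ?_).trans ?_
    · have h1 : |s| ≤ 1 := by
        have h2 := Set.uIoc_subset_uIcc hs
        have h3 := Real.neg_one_le_sin y
        have h4 := Real.sin_le_one y
        rw [Set.mem_uIcc] at h2
        rw [abs_le]
        rcases h2 with h | h <;> constructor <;> linarith [h.1, h.2]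
      have h2 : s ^ 2 ≤ 1 := (sq_le_one_iff_abs_le_one _).2 h1
      rw [Real.norm_eq_abs, abs_pow]
      exact pow_le_one₀ (abs_nonneg _) (by rw [abs_le]; constructor <;> nlinarith [sq_nonneg s])
    · simpa using Real.abs_sin_le_one y

theorem amplitude_pow_le {d : ℕ} (hd : 2 ≤ d) {n : ℕ} (hn : 1 ≤ n) {B : ℝ}
    (hB : |gegenbauerAmplitude d n * (n : ℝ) ^ lamOf d| ≤ B) (q : ℕ) :
    |gegenbauerAmplitude d n| ^ q * (n : ℝ) ^ (d - 1) ≤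
      B ^ q * (n : ℝ) ^ (-(((q : ℝ) - 2) * lamOf d)) := by
  have hn0 : (0 : ℝ) < n := by exact_mod_cast hn
  have hp : 0 < (n : ℝ) ^ lamOf d := Real.rpow_pos_of_pos hn0 _
  have e : (n : ℝ) ^ (d - 1) = ((n : ℝ) ^ lamOf d) ^ q *
      (n : ℝ) ^ (-(((q : ℝ) - 2) * lamOf d)) := by
    rw [← Real.rpow_mul_natCast hn0.le, ← Real.rpow_add hn0, ← Real.rpow_natCast,
      Nat.cast_sub (by omega)]
    congr 1
    unfold lamOf
    push_cast
    ring
  rw [e, ← mul_assoc, ← mul_pow]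
  rw [abs_mul, abs_of_pos hp] at hB
  gcongr

/-- The bulk does not contribute at the scale `n ^ (-d)`. For odd `q` this is due to cancellation,
for even `q` to the integrability at infinity of `t ^ (-(q - 2) λ)`. -/
theorem exists_bulk_integral_le {d q : ℕ} (hd : 2 ≤ d) (hq : 3 ≤ q) (hdq : ¬ (d = 2 ∧ q = 4)) :
    ∃ C δ : ℝ, 0 ≤ C ∧ 0 < δ ∧ ∀ᶠ n : ℕ in atTop, ∀ r₁ r₂ : ℝ, 0 < r₁ → r₁ ≤ r₂ →
      r₂ ≤ Real.pi / 2 → 2 * |lamOf d * (lamOf d - 1)| ≤ n * r₁ →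
      (n : ℝ) ^ d * |∫ r in r₁..r₂,
        (gegenbauerNormalized d n).eval (Real.cos r) ^ q * Real.sin r ^ (d - 1)| ≤
        C * (n * r₁) ^ (-δ) := by
  have hl := lamOf_ge hd
  have hpi := Real.pi_pos
  obtain ⟨B, hB, hbound⟩ := amplitude_bounded hd
  have hq' : (3 : ℝ) ≤ q := by exact_mod_cast hq
  set p := ((q : ℝ) - 2) * lamOf d with hp
  have hp0 : 0 < p := mul_pos (by linarith) (by linarith)
  set κ := |lamOf d * (lamOf d - 1)| with hκ
  have hκ0 : 0 ≤ κ := abs_nonneg _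
  rcases Nat.even_or_odd q with he | ho
  · -- This is where `(d, q) = (2, 4)`, for which `p = 1`, has to be excluded.
    have hp1 : 1 < p := by
      obtain ⟨k, hk⟩ := he
      by_cases hq4 : q = 4
      · have hd3 : (3 : ℝ) ≤ d := by
          have : 3 ≤ d := by omega
          exact_mod_cast this
        have : 1 ≤ lamOf d := by unfold lamOf; linarith
        rw [hp, hq4]; push_cast; linarith
      · have h6 : (6 : ℝ) ≤ q := by
          have : 6 ≤ q := by omega
          exact_mod_cast this
        rw [hp]; nlinarith
    refine ⟨2 ^ q * B ^ q * ((Real.pi / 2) ^ p / (p - 1)), p - 1, ?_, by linarith, ?_⟩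
    · have : 0 < p - 1 := by linarith
      positivity
    filter_upwards [eventually_ge_atTop 1, hbound] with n hn hb r₁ r₂ h₁ h₁₂ h₂ hnr
    have hn0 : (0 : ℝ) < n := by exact_mod_cast hn
    have hsub := Icc_subset_Ioo_zero_pi h₁ h₂
    have b1 : |∫ r in r₁..r₂,
        (gegenbauerNormalized d n).eval (Real.cos r) ^ q * Real.sin r ^ (d - 1)| ≤
        ∫ r in r₁..r₂, (2 * |gegenbauerAmplitude d n|) ^ q * Real.sin r ^ (-p) := by
      rw [← Real.norm_eq_abs]
      refine intervalIntegral.norm_integral_le_of_norm_le h₁₂ (MeasureTheory.ae_of_all _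
        fun r hr => ?_) ((intervalIntegrable_sin_rpow h₁ h₁₂ h₂).const_mul _)
      have hr' : r ∈ Set.Icc r₁ r₂ := ⟨hr.1.le, hr.2⟩
      have hs : 0 ≤ Real.sin r ^ (-p) :=
        Real.rpow_nonneg (Real.sin_pos_of_pos_of_lt_pi (hsub hr').1 (hsub hr').2).le _
      rw [integrand_eq_liouville hd q n (hsub hr'), ← hp, Real.norm_eq_abs, abs_mul, abs_pow,
        abs_of_nonneg hs]
      gcongr
      exact abs_liouville_le hd hn (hsub hr').1 (hr.2.trans h₂)
        (hnr.trans (by gcongr; exact hr.1.le))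
    have b2 := amplitude_pow_le hd hn hb q
    rw [intervalIntegral.integral_const_mul] at b1
    have b3 := integral_sin_rpow_neg_le hp1 h₁ h₁₂ h₂
    set a := gegenbauerAmplitude d n
    calc _ ≤ (n : ℝ) ^ d * ((2 * |a|) ^ q * ((Real.pi / 2) ^ p / (p - 1) * r₁ ^ (1 - p))) := by
          gcongr
          exact b1.trans (by gcongr)
      _ = (|a| ^ q * (n : ℝ) ^ (d - 1)) *
          (n * 2 ^ q * ((Real.pi / 2) ^ p / (p - 1)) * r₁ ^ (1 - p)) := by
          have : (n : ℝ) ^ d = n ^ (d - 1) * n := by rw [← pow_succ]; congr 1; omega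
          rw [this, mul_pow]; ring
      _ ≤ (B ^ q * (n : ℝ) ^ (-p)) *
          (n * 2 ^ q * ((Real.pi / 2) ^ p / (p - 1)) * r₁ ^ (1 - p)) := by
          have : 0 < p - 1 := by linarith
          have : 0 ≤ r₁ ^ (1 - p) := Real.rpow_nonneg h₁.le _
          gcongr
      _ = 2 ^ q * B ^ q * ((Real.pi / 2) ^ p / (p - 1)) * (((n : ℝ) ^ (-p) * n) * r₁ ^ (1 - p)) := by
          ring
      _ = _ := by
          rw [← Real.rpow_add_one hn0.ne', neg_sub, Real.mul_rpow hn0.le h₁.le]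
          ring_nf
  · obtain ⟨H, hH, hH₀⟩ := exists_primitive_cos_pow_odd ho
    refine ⟨B ^ q * (Real.pi / 2) ^ p * (q * 2 ^ q * κ / p + 2), p, by positivity, hp0, ?_⟩
    filter_upwards [eventually_ge_atTop 1, hbound] with n hn hb r₁ r₂ h₁ h₁₂ h₂ hnr
    have hn0 : (0 : ℝ) < n := by exact_mod_cast hn
    have b1 := abs_bulk_integral_sub_le hd (by omega : 2 ≤ q) hn hH hH₀ h₁ h₁₂ h₂ hnr
    rw [zero_mul, zero_mul, sub_zero, ← hp, ← hκ] at b1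
    have b2 := amplitude_pow_le hd hn hb q
    have b3 := integral_inv_mul_sin_rpow_neg_le hp0 h₁ h₁₂ h₂
    have b4 := sin_rpow_neg_le hp0.le h₁ (h₁₂.trans h₂)
    set a := gegenbauerAmplitude d n
    have h5 : 0 ≤ r₁ ^ (-p) := Real.rpow_nonneg h₁.le _
    calc _ ≤ (n : ℝ) ^ d * (|a| ^ q / n * (q * 2 ^ q * κ * ((Real.pi / 2) ^ p / p * r₁ ^ (-p)) +
          2 * 1 * ((Real.pi / 2) ^ p * r₁ ^ (-p)))) := by
          gcongr
          exact b1.trans (by gcongr)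
      _ = (|a| ^ q * (n : ℝ) ^ (d - 1)) *
          ((Real.pi / 2) ^ p * (q * 2 ^ q * κ / p + 2) * r₁ ^ (-p)) := by
          have : (n : ℝ) ^ d = n ^ (d - 1) * n := by rw [← pow_succ]; congr 1; omega
          rw [this]; field_simp
      _ ≤ (B ^ q * (n : ℝ) ^ (-p)) *
          ((Real.pi / 2) ^ p * (q * 2 ^ q * κ / p + 2) * r₁ ^ (-p)) := by
          gcongr
      _ = _ := by
          rw [Real.mul_rpow hn0.le h₁.le]
          ring

/-! ### Limits of the integrals -/

theorem continuous_integrand (d q n : ℕ) : Continuous fun r : ℝ =>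
    (gegenbauerNormalized d n).eval (Real.cos r) ^ q * Real.sin r ^ (d - 1) := by
  have h : Continuous fun r : ℝ => (gegenbauerNormalized d n).eval (Real.cos r) :=
    (gegenbauerNormalized d n).continuous.comp Real.continuous_cos
  fun_prop

/-- The part of the integral within distance `K / n` of the pole, rescaled. -/
theorem tendsto_core_integral {d : ℕ} (hd : 2 ≤ d) (q : ℕ) {K : ℝ} (hK : 0 ≤ K) :
    Tendsto (fun n : ℕ => (n : ℝ) ^ d * gegenbauerIntegral d q n (K / n)) atTop
      (𝓝 (∫ t in (0 : ℝ)..K, sphereFourier d t ^ q * t ^ (d - 1))) := by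
  have hν := nuOf_nonneg hd
  have key : Tendsto (fun n : ℕ => ∫ t in (0 : ℝ)..K,
      (gegenbauerNormalized d n).eval (Real.cos (t / n)) ^ q *
        ((n : ℝ) * Real.sin (t / n)) ^ (d - 1)) atTop
      (𝓝 (∫ t in (0 : ℝ)..K, sphereFourier d t ^ q * t ^ (d - 1))) := by
    refine intervalIntegral.tendsto_integral_filter_of_dominated_convergence
      (fun _ => Real.exp ((1 + nuOf d) * (K / 2) ^ 2) ^ q * K ^ (d - 1)) ?_ ?_ ?_ ?_
    · filter_upwards with n
      have h : Continuous fun r : ℝ => (gegenbauerNormalized d n).eval (Real.cos (r / n)) :=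
        (gegenbauerNormalized d n).continuous.comp (Real.continuous_cos.comp (by fun_prop))
      exact Continuous.aestronglyMeasurable (by fun_prop)
    · filter_upwards [eventually_ge_atTop 1] with n hn
      have hn0 : (0 : ℝ) < n := by exact_mod_cast hn
      refine MeasureTheory.ae_of_all _ fun t ht => ?_
      rw [Set.uIoc_of_le hK] at ht
      rw [Real.norm_eq_abs, abs_mul, abs_pow, abs_pow]
      have h1 := abs_gegenbauer_le_exp hd hn t
      have h2 : |(n : ℝ) * Real.sin (t / n)| ≤ K := by
        rw [abs_mul, abs_of_pos hn0]
        have h3 : |Real.sin (t / n)| ≤ |t / n| := Real.abs_sin_le_abs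
        rw [abs_of_pos (div_pos ht.1 hn0)] at h3
        calc (n : ℝ) * |Real.sin (t / n)| ≤ n * (t / n) := by gcongr
          _ = t := by field_simp
          _ ≤ K := ht.2
      have h4 : Real.exp ((1 + nuOf d) * (t / 2) ^ 2) ≤
          Real.exp ((1 + nuOf d) * (K / 2) ^ 2) := by
        have := ht.1.le
        have := ht.2
        gcongr
      have h5 := h1.trans h4
      gcongr
    · exact intervalIntegrable_const
    · refine MeasureTheory.ae_of_all _ fun t ht => ?_
      rw [Set.uIoc_of_le hK] at ht
      exact ((tendsto_gegenbauer_cos hd ht.1.le).pow q).mul ((tendsto_mul_sin_div t).pow _)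
  refine key.congr' ?_
  filter_upwards [eventually_ge_atTop 1] with n hn
  have hn0 : (n : ℝ) ≠ 0 := Nat.cast_ne_zero.2 (by omega)
  have h := intervalIntegral.integral_comp_div (a := 0) (b := K) (fun r : ℝ =>
    (gegenbauerNormalized d n).eval (Real.cos r) ^ q * Real.sin r ^ (d - 1)) hn0
  rw [zero_div, smul_eq_mul] at h
  have e : (n : ℝ) ^ d = n ^ (d - 1) * n := by rw [← pow_succ]; congr 1; omega
  rw [gegenbauerIntegral, e, mul_assoc, ← h, ← intervalIntegral.integral_const_mul]
  refine intervalIntegral.integral_congr fun t _ => ?_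
  simp only [mul_pow]
  ring

theorem gegenbauerIntegral_sub (d q n : ℕ) (a b : ℝ) :
    gegenbauerIntegral d q n b - gegenbauerIntegral d q n a = ∫ r in a..b,
      (gegenbauerNormalized d n).eval (Real.cos r) ^ q * Real.sin r ^ (d - 1) := by
  have h := continuous_integrand d q n
  exact intervalIntegral.integral_interval_sub_left (h.intervalIntegrable _ _)
    (h.intervalIntegrable _ _)

/-- The reflection `r ↦ π - r` reduces all upper limits to the range `(0, π / 2]`. -/
theorem gegenbauerIntegral_reflect {d : ℕ} (hd : 2 ≤ d) (q n : ℕ) (a : ℝ) :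
    gegenbauerIntegral d q n a = gegenbauerIntegral d q n (Real.pi / 2) + (-1) ^ (n * q) *
      (gegenbauerIntegral d q n (Real.pi / 2) - gegenbauerIntegral d q n (Real.pi - a)) := by
  rw [← sub_eq_iff_eq_add', gegenbauerIntegral_sub, gegenbauerIntegral_sub]
  have h := intervalIntegral.integral_comp_sub_left (a := Real.pi / 2) (b := a) (fun r : ℝ =>
    (gegenbauerNormalized d n).eval (Real.cos r) ^ q * Real.sin r ^ (d - 1)) Real.pi
  rw [show Real.pi - Real.pi / 2 = Real.pi / 2 by ring] at h
  rw [← h, ← intervalIntegral.integral_const_mul]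
  refine intervalIntegral.integral_congr fun r _ => ?_
  simp only [Real.cos_pi_sub, Real.sin_pi_sub, gegenbauer_neg hd, mul_pow]
  rw [← pow_mul, ← mul_assoc, ← mul_assoc, ← pow_add, Even.neg_one_pow ⟨n * q, rfl⟩, one_mul]

theorem gegenbauerIntegral_pi {d : ℕ} (hd : 2 ≤ d) (q n : ℕ) :
    gegenbauerIntegral d q n Real.pi =
      (1 + (-1) ^ (n * q)) * gegenbauerIntegral d q n (Real.pi / 2) := by
  rw [gegenbauerIntegral_reflect hd q n Real.pi, sub_self,
    show gegenbauerIntegral d q n 0 = 0 from intervalIntegral.integral_same]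
  ring

/-- If `S n` is approximated by `E n K` with an error `τ K` uniform in `n`, and `E n K → Φ K`, then
`S` and `Φ` have a common limit. In particular the convergence of the improper integral `Φ` is part
of the conclusion. -/
theorem tendsto_of_uniform_tail {S : ℕ → ℝ} {E : ℕ → ℝ → ℝ} {Φ τ : ℝ → ℝ} {K₀ : ℝ}
    (hE : ∀ K ≥ K₀, Tendsto (fun n => E n K) atTop (𝓝 (Φ K))) (hτ : Tendsto τ atTop (𝓝 0))
    (h : ∀ K ≥ K₀, ∀ᶠ n in atTop, |S n - E n K| ≤ τ K) :
    ∃ I, Tendsto S atTop (𝓝 I) ∧ Tendsto Φ atTop (𝓝 I) := by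
  obtain ⟨I, hI⟩ : ∃ I, Tendsto S atTop (𝓝 I) := by
    refine tendsto_of_approx fun ε hε => ?_
    obtain ⟨K, hK, hK₀⟩ := ((hτ.eventually (gt_mem_nhds (show 0 < ε / 2 by positivity))).and
      (eventually_ge_atTop K₀)).exists
    refine ⟨Φ K, ?_⟩
    filter_upwards [h K hK₀, Metric.tendsto_nhds.1 (hE K hK₀) (ε / 2) (by positivity)]
      with n h1 h2
    rw [Real.dist_eq, abs_lt] at h2
    rw [abs_le] at h1 ⊢
    constructor <;> linarith [h1.1, h1.2, h2.1, h2.2]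
  refine ⟨I, hI, ?_⟩
  rw [tendsto_iff_norm_sub_tendsto_zero]
  refine squeeze_zero' (Eventually.of_forall fun K => norm_nonneg _) ?_ hτ
  filter_upwards [eventually_ge_atTop K₀] with K hK
  rw [← norm_sub_rev, Real.norm_eq_abs]
  exact le_of_tendsto (hI.sub (hE K hK)).abs (h K hK)

theorem exists_moment_upper_half {d q : ℕ} (hd : 2 ≤ d) (hq : 3 ≤ q)
    (hdq : ¬ (d = 2 ∧ q = 4)) :
    ∃ I : ℝ, IsBesselMoment d q I ∧ ∀ a ∈ Set.Ioc 0 (Real.pi / 2),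
      Tendsto (fun n : ℕ => (n : ℝ) ^ d * gegenbauerIntegral d q n a) atTop (𝓝 I) := by
  obtain ⟨C, δ, hC, hδ, hbulk⟩ := exists_bulk_integral_le hd hq hdq
  set κ := |lamOf d * (lamOf d - 1)| with hκ
  have hκ0 : 0 ≤ κ := abs_nonneg _
  have main : ∀ a ∈ Set.Ioc 0 (Real.pi / 2), ∃ I : ℝ,
      Tendsto (fun n : ℕ => (n : ℝ) ^ d * gegenbauerIntegral d q n a) atTop (𝓝 I) ∧
        IsBesselMoment d q I := by
    intro a ha
    refine tendsto_of_uniform_tail (K₀ := 2 * κ + 1)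
      (E := fun n K => (n : ℝ) ^ d * gegenbauerIntegral d q n (K / n))
      (τ := fun K => C * K ^ (-δ)) (fun K hK => tendsto_core_integral hd q (by linarith))
      ?_ fun K hK => ?_
    · simpa using (tendsto_rpow_neg_atTop hδ).const_mul C
    · have hK0 : 0 < K := by linarith
      filter_upwards [hbulk, eventually_ge_atTop 1,
        (tendsto_const_div_atTop_nhds_zero_nat K).eventually (gt_mem_nhds ha.1)] with n hn hn1 hKa
      have hn0 : (0 : ℝ) < n := by exact_mod_cast hn1
      have e : (n : ℝ) * (K / n) = K := by field_simp
      have h := hn (K / n) a (by positivity) hKa.le ha.2 (by rw [e]; linarith)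
      rw [e] at h
      rw [← mul_sub, gegenbauerIntegral_sub, abs_mul, abs_of_pos (pow_pos hn0 d)]
      exact h
  have hpi := Real.pi_div_two_pos
  obtain ⟨I, -, hI⟩ := main (Real.pi / 2) ⟨hpi, le_rfl⟩
  refine ⟨I, hI, fun a ha => ?_⟩
  obtain ⟨I', h1, h2⟩ := main a ha
  rwa [tendsto_nhds_unique hI h2]

theorem exists_moment {d q : ℕ} (hd : 2 ≤ d) (hq : 3 ≤ q) (hdq : ¬ (d = 2 ∧ q = 4)) :
    ∃ I : ℝ, IsBesselMoment d q I ∧ ∀ a ∈ Set.Ioo 0 Real.pi,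
      Tendsto (fun n : ℕ => (n : ℝ) ^ d * gegenbauerIntegral d q n a) atTop (𝓝 I) := by
  obtain ⟨I, hI, h⟩ := exists_moment_upper_half hd hq hdq
  have hpi := Real.pi_div_two_pos
  refine ⟨I, hI, fun a ha => ?_⟩
  rcases le_or_gt a (Real.pi / 2) with h2 | h2
  · exact h a ⟨ha.1, h2⟩
  have h3 := h (Real.pi / 2) ⟨hpi, le_rfl⟩
  have h4 := h (Real.pi - a) ⟨by linarith [ha.2], by linarith⟩
  have h5 : Tendsto (fun n : ℕ => (-1 : ℝ) ^ (n * q) *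
      ((n : ℝ) ^ d * gegenbauerIntegral d q n (Real.pi / 2) -
        (n : ℝ) ^ d * gegenbauerIntegral d q n (Real.pi - a))) atTop (𝓝 0) := by
    have h6 := h3.sub h4
    rw [sub_self] at h6
    refine squeeze_zero_norm (fun n => ?_) (tendsto_norm_zero.comp h6)
    simp
  have h7 := h3.add h5
  rw [add_zero] at h7
  refine h7.congr fun n => ?_
  rw [gegenbauerIntegral_reflect hd q n a]
  ring

theorem tendsto_amplitude_sq {d : ℕ} (hd : 2 ≤ d) {c : ℝ}
    (hc : Tendsto (fun n : ℕ => gegenbauerAmplitude d n * (n : ℝ) ^ lamOf d) atTop (𝓝 c)) :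
    Tendsto (fun n : ℕ => (n : ℝ) ^ (d - 1) * gegenbauerAmplitude d n ^ 2) atTop (𝓝 (c ^ 2)) := by
  refine (hc.pow 2).congr fun n => ?_
  have e : ((n : ℝ) ^ lamOf d) ^ 2 = (n : ℝ) ^ (d - 1) := by
    rw [← Real.rpow_mul_natCast (Nat.cast_nonneg n), ← Real.rpow_natCast _ (d - 1),
      Nat.cast_sub (by omega)]
    congr 1
    unfold lamOf
    push_cast
    ring
  rw [mul_pow, e, mul_comm]

/-- For `q = 2` the weight is constant, and the square of the oscillation averages to `1 / 2`. -/
theorem tendsto_two_upper_half {d : ℕ} (hd : 2 ≤ d) {c : ℝ}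
    (hc : Tendsto (fun n : ℕ => gegenbauerAmplitude d n * (n : ℝ) ^ lamOf d) atTop (𝓝 c)) {a : ℝ}
    (ha : a ∈ Set.Ioc 0 (Real.pi / 2)) :
    Tendsto (fun n : ℕ => (n : ℝ) ^ (d - 1) * gegenbauerIntegral d 2 n a) atTop
      (𝓝 (c ^ 2 / 2 * a)) := by
  set κ := |lamOf d * (lamOf d - 1)| with hκ
  have hκ0 : 0 ≤ κ := abs_nonneg _
  set K := 2 * κ + 1 with hK
  have hK0 : 0 < K := by linarith
  set A : ℕ → ℝ := fun n => (n : ℝ) ^ (d - 1) * gegenbauerAmplitude d n ^ 2 with hA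
  have hA2 := tendsto_amplitude_sq hd hc
  have hinv : Tendsto (fun n : ℕ => (1 : ℝ) / n) atTop (𝓝 0) := tendsto_one_div_atTop_nhds_zero_nat
  have hlog : Tendsto (fun n : ℕ => Real.log n / n) atTop (𝓝 0) := by
    exact (Real.isLittleO_log_id_atTop.tendsto_div_nhds_zero).comp tendsto_natCast_atTop_atTop
  -- The pole contributes at the scale `n ^ (-d)` only.
  have core : Tendsto (fun n : ℕ => (n : ℝ) ^ (d - 1) * gegenbauerIntegral d 2 n (K / n)) atTop
      (𝓝 0) := by
    have h := (tendsto_core_integral hd 2 hK0.le).mul hinv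
    rw [mul_zero] at h
    refine h.congr' ?_
    filter_upwards [eventually_ge_atTop 1] with n hn
    have hn0 : (n : ℝ) ≠ 0 := Nat.cast_ne_zero.2 (by omega)
    have e : (n : ℝ) ^ d = n ^ (d - 1) * n := by rw [← pow_succ]; congr 1; omega
    rw [e]; field_simp
  have mainterm : Tendsto (fun n : ℕ => A n * ((a - K * (1 / n)) / 2)) atTop
      (𝓝 (c ^ 2 * ((a - K * 0) / 2))) :=
    hA2.mul (((hinv.const_mul K).const_sub a).div_const 2)
  have err : Tendsto (fun n : ℕ => A n * ((2 : ℕ) * 2 ^ 2 * κ *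
      ((Real.log a - Real.log K) * (1 / n) + Real.log n / n) + 2 * 1 * (1 / n))) atTop
      (𝓝 (c ^ 2 * ((2 : ℕ) * 2 ^ 2 * κ * ((Real.log a - Real.log K) * 0 + 0) + 2 * 1 * 0))) :=
    hA2.mul ((((hinv.const_mul _).add hlog).const_mul _).add (hinv.const_mul _))
  have bulk : Tendsto (fun n : ℕ => (n : ℝ) ^ (d - 1) *
      (gegenbauerIntegral d 2 n a - gegenbauerIntegral d 2 n (K / n)) -
        A n * ((a - K * (1 / n)) / 2)) atTop (𝓝 0) := by
    simp only [mul_zero, add_zero] at err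
    refine squeeze_zero_norm' ?_ err
    filter_upwards [eventually_ge_atTop 1,
      (tendsto_const_div_atTop_nhds_zero_nat K).eventually (gt_mem_nhds ha.1)] with n hn hKa
    have hn0 : (0 : ℝ) < n := by exact_mod_cast hn
    have e : (n : ℝ) * (K / n) = K := by field_simp
    have hH : ∀ y, HasDerivAt (fun y => Real.sin (2 * y) / 4) (Real.cos y ^ 2 - 1 / 2) y := by
      intro y
      have hl : HasDerivAt (fun y : ℝ => 2 * y) 2 y := by
        simpa using (hasDerivAt_id y).const_mul (2 : ℝ)
      refine (hl.sin.div_const 4).congr_deriv ?_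
      rw [Real.cos_two_mul]; ring
    have h := abs_bulk_integral_sub_le hd (q := 2) le_rfl hn (H₀ := 1) hH
      (fun y => by
        rw [abs_div, abs_of_pos (by norm_num : (0 : ℝ) < 4)]
        linarith [Real.abs_sin_le_one (2 * y)])
      (by positivity : 0 < K / n) hKa.le ha.2 (by rw [e]; linarith)
    have e2 : -((((2 : ℕ) : ℝ) - 2) * lamOf d) = 0 := by push_cast; ring
    have e3 : ∫ r in (K / n)..a, 1 / r = Real.log a - Real.log K + Real.log n := by
      rw [integral_one_div_of_pos (by positivity) ha.1, Real.log_div ha.1.ne' (by positivity),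
        Real.log_div hK0.ne' hn0.ne']
      ring
    simp only [e2, Real.rpow_zero, mul_one, e3, intervalIntegral.integral_const, smul_eq_mul] at h
    rw [← gegenbauerIntegral_sub] at h
    have hp : 0 < (n : ℝ) ^ (d - 1) := by positivity
    have h' := mul_le_mul_of_nonneg_left h hp.le
    rw [← abs_of_pos hp, ← abs_mul, abs_of_pos hp, sq_abs] at h'
    rw [Real.norm_eq_abs]
    calc _ = _ := by congr 1; simp only [hA]; ring
      _ ≤ _ := h'
      _ = _ := by simp only [hA]; ring
  have total := (bulk.add mainterm).add core
  rw [show 0 + c ^ 2 * ((a - K * 0) / 2) + 0 = c ^ 2 / 2 * a by ring] at total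
  exact total.congr fun n => by ring

theorem integral_inv_sin {r₁ r₂ : ℝ} (h₁ : 0 < r₁) (h₁₂ : r₁ ≤ r₂) (h₂ : r₂ ≤ Real.pi / 2) :
    ∫ r in r₁..r₂, Real.sin r ^ (-1 : ℝ) =
      (Real.log (Real.sin r₂) - Real.log (1 + Real.cos r₂)) -
        (Real.log (Real.sin r₁) - Real.log (1 + Real.cos r₁)) := by
  refine intervalIntegral.integral_eq_sub_of_hasDerivAt
    (f := fun r => Real.log (Real.sin r) - Real.log (1 + Real.cos r)) (fun r hr => ?_)
    (intervalIntegrable_sin_rpow h₁ h₁₂ h₂)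
  rw [Set.uIcc_of_le h₁₂] at hr
  have h0 := Icc_subset_Ioo_zero_pi h₁ h₂ hr
  have hs := Real.sin_pos_of_pos_of_lt_pi h0.1 h0.2
  have hc : 0 ≤ Real.cos r := Real.cos_nonneg_of_mem_Icc ⟨by linarith [h0.1, Real.pi_pos],
    hr.2.trans h₂⟩
  have hc1 : 0 < 1 + Real.cos r := by linarith
  refine (((Real.hasDerivAt_sin r).log hs.ne').sub
    (((Real.hasDerivAt_cos r).const_add 1).log hc1.ne')).congr_deriv ?_
  rw [Real.rpow_neg_one]
  field_simp
  linear_combination Real.sin_sq_add_cos_sq r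

/-- For `d = 2` and `q = 4` the weight is `1 / sin`, and `cos ^ 4` averages to `3 / 8`. -/
theorem tendsto_four_upper_half {c : ℝ}
    (hc : Tendsto (fun n : ℕ => gegenbauerAmplitude 2 n * (n : ℝ) ^ lamOf 2) atTop (𝓝 c)) {a : ℝ}
    (ha : a ∈ Set.Ioc 0 (Real.pi / 2)) :
    Tendsto (fun n : ℕ => (n : ℝ) ^ 2 / Real.log n * gegenbauerIntegral 2 4 n a) atTop
      (𝓝 (3 / 8 * c ^ 4)) := by
  set κ := |lamOf 2 * (lamOf 2 - 1)| with hκ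
  have hκ0 : 0 ≤ κ := abs_nonneg _
  set K := 2 * κ + 1 with hK
  have hK0 : 0 < K := by linarith
  set A : ℕ → ℝ := fun n => (n : ℝ) ^ 2 * gegenbauerAmplitude 2 n ^ 4 with hA
  have hA4 : Tendsto A atTop (𝓝 (c ^ 4)) := by
    have h := (tendsto_amplitude_sq le_rfl hc).pow 2
    rw [← pow_mul] at h
    exact h.congr fun n => by simp only [hA]; ring
  have hlog : Tendsto (fun n : ℕ => Real.log n) atTop atTop :=
    Real.tendsto_log_atTop.comp tendsto_natCast_atTop_atTop
  have hinv : Tendsto (fun n : ℕ => 1 / Real.log n) atTop (𝓝 0) := by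
    simp only [one_div]
    exact hlog.inv_tendsto_atTop
  have core : Tendsto (fun n : ℕ => (n : ℝ) ^ 2 / Real.log n * gegenbauerIntegral 2 4 n (K / n))
      atTop (𝓝 0) := by
    have h := (tendsto_core_integral le_rfl 4 hK0.le).mul hinv
    rw [mul_zero] at h
    exact h.congr fun n => by ring
  -- The integral of `1 / sin` diverges logarithmically at the pole.
  have hsin : Tendsto (fun n : ℕ => (∫ r in (K / n)..a, Real.sin r ^ (-1 : ℝ)) * (1 / Real.log n))
      atTop (𝓝 1) := by
    have h1 : Tendsto (fun n : ℕ => Real.log ((n : ℝ) * Real.sin (K / n))) atTop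
        (𝓝 (Real.log K)) := (tendsto_mul_sin_div K).log hK0.ne'
    have h2 : Tendsto (fun n : ℕ => Real.log (1 + Real.cos (K / n))) atTop
        (𝓝 (Real.log (1 + Real.cos 0))) :=
      (((Real.continuous_cos.tendsto 0).comp
        (tendsto_const_div_atTop_nhds_zero_nat K)).const_add 1).log (by norm_num)
    have h3 := (((h2.sub h1).const_add
      (Real.log (Real.sin a) - Real.log (1 + Real.cos a))).mul hinv).add_const 1
    rw [mul_zero, zero_add] at h3
    refine h3.congr' ?_
    filter_upwards [eventually_ge_atTop 1, hlog.eventually_gt_atTop 0,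
      (tendsto_const_div_atTop_nhds_zero_nat K).eventually (gt_mem_nhds ha.1)] with n hn hl hKa
    have hn0 : (0 : ℝ) < n := by exact_mod_cast hn
    have hs : 0 < Real.sin (K / n) := Real.sin_pos_of_pos_of_lt_pi (by positivity)
      (by linarith [ha.2, Real.pi_pos])
    rw [integral_inv_sin (by positivity) hKa.le ha.2, Real.log_mul hn0.ne' hs.ne']
    field_simp
    ring
  have mainterm := (hA4.mul hsin).const_mul (3 / 8)
  set D := ((4 : ℕ) : ℝ) * 2 ^ 4 * κ * ((Real.pi / 2) ^ (1 : ℝ) / 1 * K ^ (-1 : ℝ)) +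
    2 * 1 * ((Real.pi / 2) ^ (1 : ℝ) * K ^ (-1 : ℝ)) with hD
  have err : Tendsto (fun n : ℕ => A n * D * (1 / Real.log n)) atTop (𝓝 (c ^ 4 * D * 0)) :=
    (hA4.mul_const D).mul hinv
  have bulk : Tendsto (fun n : ℕ => (n : ℝ) ^ 2 / Real.log n *
      (gegenbauerIntegral 2 4 n a - gegenbauerIntegral 2 4 n (K / n)) -
        3 / 8 * (A n * ((∫ r in (K / n)..a, Real.sin r ^ (-1 : ℝ)) * (1 / Real.log n))))
        atTop (𝓝 0) := by
    rw [mul_zero] at err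
    refine squeeze_zero_norm' ?_ err
    filter_upwards [eventually_ge_atTop 1, hlog.eventually_gt_atTop 0,
      (tendsto_const_div_atTop_nhds_zero_nat K).eventually (gt_mem_nhds ha.1)] with n hn hl hKa
    have hn0 : (0 : ℝ) < n := by exact_mod_cast hn
    have e : (n : ℝ) * (K / n) = K := by field_simp
    have hH : ∀ y, HasDerivAt (fun y => Real.sin (2 * y) / 4 + Real.sin (4 * y) / 32)
        (Real.cos y ^ 4 - 3 / 8) y := by
      intro y
      have hl : HasDerivAt (fun y : ℝ => 2 * y) 2 y := by
        simpa using (hasDerivAt_id y).const_mul (2 : ℝ)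
      have hl' : HasDerivAt (fun y : ℝ => 4 * y) 4 y := by
        simpa using (hasDerivAt_id y).const_mul (4 : ℝ)
      refine ((hl.sin.div_const 4).add (hl'.sin.div_const 32)).congr_deriv ?_
      rw [show 4 * y = 2 * (2 * y) by ring, Real.cos_two_mul (2 * y), Real.cos_two_mul]; ring
    have hKn : 0 < K / n := by positivity
    have h := abs_bulk_integral_sub_le le_rfl (q := 4) (by norm_num) hn (H₀ := 1) hH
      (fun y => by
        have h2 := abs_le.1 (Real.abs_sin_le_one (2 * y))
        have h4 := abs_le.1 (Real.abs_sin_le_one (4 * y))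
        rw [abs_le]
        constructor <;> linarith [h2.1, h2.2, h4.1, h4.2])
      hKn hKa.le ha.2 (by rw [e]; linarith)
    have e2 : -((((4 : ℕ) : ℝ) - 2) * lamOf 2) = -1 := by unfold lamOf; push_cast; ring
    rw [e2, ← gegenbauerIntegral_sub] at h
    have b3 := integral_inv_mul_sin_rpow_neg_le one_pos hKn hKa.le ha.2
    have b4 := sin_rpow_neg_le zero_le_one hKn (hKa.le.trans ha.2)
    have e5 : (K / n) ^ (-1 : ℝ) = n * K ^ (-1 : ℝ) := by
      rw [Real.rpow_neg_one, Real.rpow_neg_one]; field_simp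
    rw [e5] at b3 b4
    have h' := h.trans (mul_le_mul_of_nonneg_left
      (add_le_add (mul_le_mul_of_nonneg_left b3 (by positivity))
        (mul_le_mul_of_nonneg_left b4 (by norm_num))) (by positivity))
    have hp : 0 < (n : ℝ) ^ 2 / Real.log n := by positivity
    have h'' := mul_le_mul_of_nonneg_left h' hp.le
    rw [← abs_of_pos hp, ← abs_mul, abs_of_pos hp, Even.pow_abs (by decide)] at h''
    rw [Real.norm_eq_abs]
    calc _ = _ := by congr 1; simp only [hA]; ring
      _ ≤ _ := h''
      _ = _ := by simp only [hA, hD, ← hκ]; field_simp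
  have total := (bulk.add mainterm).add core
  rw [show 0 + 3 / 8 * (c ^ 4 * 1) + 0 = 3 / 8 * c ^ 4 by ring] at total
  exact total.congr fun n => by ring

/-! ### The uniform measure on the sphere -/

open MeasureTheory Metric in
open scoped Pointwise in
theorem measurePreserving_sphere_isometry {E : Type*} [NormedAddCommGroup E]
    [InnerProductSpace ℝ E] [FiniteDimensional ℝ E] [MeasurableSpace E] [BorelSpace E]
    (L : E ≃ₗᵢ[ℝ] E) :
    MeasurePreserving (fun u : sphere (0 : E) 1 => (⟨L u, by simp⟩ : sphere (0 : E) 1))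
      (volume : Measure E).toSphere (volume : Measure E).toSphere := by
  have hm : Measurable (fun u : sphere (0 : E) 1 => (⟨L u, by simp⟩ : sphere (0 : E) 1)) :=
    (L.continuous.comp continuous_subtype_val).measurable.subtype_mk
  refine ⟨hm, Measure.ext fun s hs => ?_⟩
  rw [Measure.map_apply hm hs, Measure.toSphere_apply' _ hs, Measure.toSphere_apply' _ (hm hs)]
  congr 1
  refine Eq.trans ?_
    (L.measurePreserving.measure_preimage_emb L.toHomeomorph.measurableEmbedding _)
  congr 1
  ext x
  simp only [Set.mem_preimage, Set.mem_smul, Set.mem_image]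
  constructor
  · rintro ⟨r, hr, _, ⟨u, hu, rfl⟩, rfl⟩
    exact ⟨r, hr, L u, ⟨_, hu, rfl⟩, by simp⟩
  · rintro ⟨r, hr, _, ⟨u, hu, rfl⟩, hx⟩
    refine ⟨r, hr, L.symm u, ⟨⟨L.symm u, by simp⟩, by simpa using hu, rfl⟩, ?_⟩
    rw [← map_smul, hx, L.symm_apply_apply]

open MeasureTheory Metric in
open scoped Pointwise in
/-- A set in the punctured unit ball whose radial projection lies in `s` bounds the spherical measure
of `s` from below. -/
theorem finrank_mul_volume_le_toSphere {E : Type*} [NormedAddCommGroup E]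
    [InnerProductSpace ℝ E] [FiniteDimensional ℝ E] [MeasurableSpace E] [BorelSpace E]
    {s : Set (sphere (0 : E) 1)} (hs : MeasurableSet s) {B : Set E}
    (hB : ∀ x ∈ B, 0 < ‖x‖ ∧ ‖x‖ < 1) (hBs : ∀ x ∈ B, ∀ u : sphere (0 : E) 1,
      (u : E) = ‖x‖⁻¹ • x → u ∈ s) :
    Module.finrank ℝ E * (volume : Measure E).real B ≤ (volume : Measure E).toSphere.real s := by
  rw [measureReal_def, measureReal_def, Measure.toSphere_apply' _ hs, ENNReal.toReal_mul,
    ENNReal.toReal_natCast]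
  have hsub : (Set.Ioo (0 : ℝ) 1 • ((↑) '' s : Set E)) ⊆ ball 0 1 := by
    rintro _ ⟨r, hr, _, ⟨u, -, rfl⟩, rfl⟩
    have hu : ‖(u : E)‖ = 1 := by simp
    rw [mem_ball_zero_iff]
    simp only [norm_smul, hu, mul_one, Real.norm_eq_abs, abs_of_pos hr.1]
    exact hr.2
  gcongr
  · exact ((measure_mono hsub).trans_lt measure_ball_lt_top).ne
  · intro x hx
    obtain ⟨h0, h1⟩ := hB x hx
    have hn : ‖‖x‖⁻¹ • x‖ = 1 := by rw [norm_smul, norm_inv, norm_norm, inv_mul_cancel₀ h0.ne']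
    refine ⟨‖x‖, ⟨h0, h1⟩, ‖x‖⁻¹ • x, ⟨⟨‖x‖⁻¹ • x, by simpa using hn⟩, ?_, rfl⟩, ?_⟩
    · exact hBs x hx _ rfl
    · simp [smul_smul, h0.ne']

theorem norm_normalize_sub_le {E : Type*} [NormedAddCommGroup E] [NormedSpace ℝ E] {x y : E}
    (hx : 0 < ‖x‖) (hy : 0 < ‖y‖) : ‖‖x‖⁻¹ • x - ‖y‖⁻¹ • y‖ ≤ 2 * ‖x - y‖ / ‖y‖ := by
  have e : ‖x‖⁻¹ • x - ‖y‖⁻¹ • y = ‖y‖⁻¹ • ((x - y) + (‖y‖ - ‖x‖) • (‖x‖⁻¹ • x)) := by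
    rw [sub_smul, smul_smul ‖x‖, mul_inv_cancel₀ hx.ne', one_smul, smul_add, smul_sub, smul_sub,
      smul_smul ‖y‖⁻¹ ‖y‖, inv_mul_cancel₀ hy.ne', one_smul]
    abel
  have hn : ‖‖x‖⁻¹ • x‖ = 1 := by rw [norm_smul, norm_inv, norm_norm, inv_mul_cancel₀ hx.ne']
  have h1 : |‖y‖ - ‖x‖| ≤ ‖x - y‖ := by rw [norm_sub_rev]; exact abs_norm_sub_norm_le y x
  rw [e, norm_smul, norm_inv, norm_norm, inv_mul_eq_div]
  gcongr
  refine (norm_add_le _ _).trans ?_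
  rw [norm_smul, hn, mul_one, Real.norm_eq_abs]
  linarith

/-- Euclidean space of dimension `n + 1`, with a distinguished first coordinate. -/
abbrev AxisSpace (n : ℕ) : Type := WithLp 2 (ℝ × EuclideanSpace ℝ (Fin n))

/-- The uniform measure on the unit sphere of `AxisSpace n`, of total mass the surface area. -/
noncomputable abbrev sphereMeasure (n : ℕ) :
    MeasureTheory.Measure (Metric.sphere (0 : AxisSpace n) 1) :=
  (MeasureTheory.volume : MeasureTheory.Measure (AxisSpace n)).toSphere

theorem finrank_axisSpace (n : ℕ) : Module.finrank ℝ (AxisSpace n) = n + 1 := by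
  rw [(WithLp.linearEquiv 2 ℝ (ℝ × EuclideanSpace ℝ (Fin n))).finrank_eq]
  simp [add_comm]

theorem norm_axisSpace_sq {n : ℕ} (x : AxisSpace n) : ‖x‖ ^ 2 = x.fst ^ 2 + ‖x.snd‖ ^ 2 := by
  rw [WithLp.prod_norm_sq_eq_of_L2, Real.norm_eq_abs, sq_abs]

theorem volume_axisSpace {n : ℕ} (T : Set (ℝ × EuclideanSpace ℝ (Fin n))) :
    MeasureTheory.volume {x : AxisSpace n | (x.fst, x.snd) ∈ T} = MeasureTheory.volume T :=
  (WithLp.volume_preserving_ofLp ℝ (EuclideanSpace ℝ (Fin n))).measure_preimage_emb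
    (MeasurableEquiv.toLp 2 (ℝ × EuclideanSpace ℝ (Fin n))).symm.measurableEmbedding T

/-- The pole of the sphere. -/
noncomputable def axis (n : ℕ) : AxisSpace n := WithLp.toLp 2 (1, 0)

theorem norm_axis (n : ℕ) : ‖axis n‖ = 1 := by
  have h : ‖axis n‖ ^ 2 = 1 := by rw [norm_axisSpace_sq]; simp [axis]
  nlinarith [norm_nonneg (axis n)]

theorem inner_axis {n : ℕ} (x : AxisSpace n) : inner ℝ (axis n) x = x.fst := by
  simp [axis, WithLp.prod_inner_apply]

open MeasureTheory in
/-- A spherical cap of radius `δ` about the pole has measure at least of order `δ ^ n`. -/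
theorem exists_cap_axis_ge (n : ℕ) : ∃ c : ℝ, 0 < c ∧ ∀ δ ∈ Set.Ioc (0 : ℝ) 1,
    c * δ ^ n ≤ (sphereMeasure n).real
      {u : Metric.sphere (0 : AxisSpace n) 1 | ‖(u : AxisSpace n) - axis n‖ ≤ δ} := by
  set F := EuclideanSpace ℝ (Fin n)
  have hV : 0 < (volume : Measure F).real (Metric.ball 0 1) :=
    ENNReal.toReal_pos (Metric.measure_ball_pos _ _ one_pos).ne' measure_ball_lt_top.ne
  refine ⟨(n + 1) * ((1 / 4) * ((1 / 8) ^ n * (volume : Measure F).real (Metric.ball 0 1))),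
    by positivity, fun δ hδ => ?_⟩
  have hδ0 := hδ.1
  have hδ1 := hδ.2
  -- A thin cylinder about the axis, whose radial projection lies in the cap.
  set T : Set (ℝ × F) := Set.Ioo (1 / 4) (1 / 2) ×ˢ Metric.ball 0 (δ / 8) with hT
  set B : Set (AxisSpace n) := {x | (x.fst, x.snd) ∈ T} with hB
  have hvol : (volume : Measure (AxisSpace n)).real B =
      (1 / 4) * ((δ / 8) ^ n * (volume : Measure F).real (Metric.ball 0 1)) := by
    rw [measureReal_def, hB, volume_axisSpace, hT, Measure.volume_eq_prod, Measure.prod_prod,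
      Real.volume_Ioo, Measure.addHaar_ball_of_pos _ _ (by positivity), ENNReal.toReal_mul,
      ENNReal.toReal_mul, ENNReal.toReal_ofReal (by norm_num),
      ENNReal.toReal_ofReal (by positivity), finrank_euclideanSpace_fin, measureReal_def]
    norm_num
  have hx : ∀ x ∈ B, 1 / 4 < x.fst ∧ x.fst < 1 / 2 ∧ ‖x.snd‖ < δ / 8 := by
    rintro x ⟨⟨h1, h2⟩, h3⟩
    exact ⟨h1, h2, by simpa using h3⟩
  have key := finrank_mul_volume_le_toSphere
    (s := {u : Metric.sphere (0 : AxisSpace n) 1 | ‖(u : AxisSpace n) - axis n‖ ≤ δ})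
    (measurableSet_le (by fun_prop) measurable_const) (B := B) ?_ ?_
  · rw [hvol, finrank_axisSpace] at key
    refine le_trans (le_of_eq ?_) key
    rw [div_pow, div_pow, one_pow]; push_cast; ring
  · intro x hxB
    obtain ⟨h1, h2, h3⟩ := hx x hxB
    have h4 := norm_axisSpace_sq x
    have h5 := norm_nonneg x.snd
    have h6 := norm_nonneg x
    constructor
    · by_contra h; nlinarith
    · by_contra h; push Not at h; nlinarith
  · intro x hxB u hu
    obtain ⟨h1, h2, h3⟩ := hx x hxB
    have hx0 : 0 < ‖x‖ := by
      have h4 := norm_axisSpace_sq x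
      have h6 := norm_nonneg x
      by_contra h; nlinarith [norm_nonneg x.snd]
    have hy : ‖x.fst • axis n‖ = x.fst := by
      rw [norm_smul, norm_axis, mul_one, Real.norm_eq_abs, abs_of_pos (by linarith)]
    have h7 := norm_normalize_sub_le hx0 (y := x.fst • axis n) (by rw [hy]; linarith)
    have h8 : ‖x - x.fst • axis n‖ = ‖x.snd‖ := by
      have h9 := norm_axisSpace_sq (x - x.fst • axis n)
      simp [axis] at h9 ⊢
      exact h9
    rw [hy, smul_smul, inv_mul_cancel₀ (by linarith), one_smul, h8, ← hu] at h7
    refine h7.trans ?_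
    rw [div_le_iff₀ (by linarith)]
    nlinarith

open MeasureTheory in
/-- The slice of the sphere of thickness `η` at height `s` has measure at least of order `η`,
uniformly for `|s| ≤ 3 / 4`. -/
theorem exists_slice_axis_ge {n : ℕ} (hn : 1 ≤ n) : ∃ c : ℝ, 0 < c ∧ ∀ η ∈ Set.Ioc (0 : ℝ) 1,
    ∀ s : ℝ, |s| ≤ 3 / 4 → c * η ≤ (sphereMeasure n).real
      {u : Metric.sphere (0 : AxisSpace n) 1 | |(u : AxisSpace n).fst - s| ≤ η} := by
  set F := EuclideanSpace ℝ (Fin n) with hF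
  set A : Set F := {y | 1 / 8 < ‖y‖ ∧ ‖y‖ < 1 / 4} with hA
  have hAo : IsOpen A := (isOpen_lt continuous_const continuous_norm).inter
    (isOpen_lt continuous_norm continuous_const)
  have hne : A.Nonempty := by
    refine ⟨EuclideanSpace.single ⟨0, hn⟩ (3 / 16), ?_⟩
    have e : ‖(EuclideanSpace.single ⟨0, hn⟩ (3 / 16) : F)‖ = 3 / 16 := by
      simp only [EuclideanSpace.single, PiLp.norm_single]; norm_num
    change 1 / 8 < ‖(EuclideanSpace.single ⟨0, hn⟩ (3 / 16) : F)‖ ∧ _ < _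
    rw [e]
    norm_num
  have hAb : A ⊆ Metric.ball 0 1 := fun y hy => by
    rw [mem_ball_zero_iff]; linarith [hy.2]
  have hAfin : volume A ≠ ⊤ := ((measure_mono hAb).trans_lt measure_ball_lt_top).ne
  have hV : 0 < (volume : Measure F).real A :=
    ENNReal.toReal_pos (hAo.measure_pos volume hne).ne' hAfin
  refine ⟨(n + 1) * ((volume : Measure F).real A / 8), by positivity, fun η hη s hs => ?_⟩
  have hη0 := hη.1
  have hη1 := hη.2
  -- The ray through `(c ‖y‖, y)` meets the sphere at height `s`; so the radial projections of the
  -- points `(t, y)` with `|t - c ‖y‖| < η / 16` and `1 / 8 < ‖y‖ < 1 / 4` lie in the slice.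
  have hs2 : s ^ 2 ≤ 9 / 16 := by
    have := sq_le_sq' (by linarith [abs_nonneg s] : -(3 / 4) ≤ |s|) hs
    rw [sq_abs] at this; linarith
  set w := Real.sqrt (1 - s ^ 2) with hw
  have hw2 : w ^ 2 = 1 - s ^ 2 := Real.sq_sqrt (by linarith)
  have hw0 : 1 / 2 < w := by rw [hw]; exact Real.lt_sqrt_of_sq_lt (by linarith)
  set c := s / w with hc
  have hcw : c * w = s := by rw [hc]; field_simp
  have hc2 : c ^ 2 ≤ 9 / 7 := by
    have h1 : c ^ 2 * w ^ 2 = s ^ 2 := by rw [← mul_pow, hcw]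
    nlinarith [sq_nonneg c]
  set T : Set (ℝ × F) := {z | z.2 ∈ A ∧ |z.1 - c * ‖z.2‖| < η / 16} with hT
  have hTo : IsOpen T := by
    have h1 : IsOpen {z : ℝ × F | |z.1 - c * ‖z.2‖| < η / 16} :=
      isOpen_lt (by fun_prop) continuous_const
    exact (hAo.preimage continuous_snd).inter h1
  set B : Set (AxisSpace n) := {x | (x.fst, x.snd) ∈ T} with hB
  have hvol : (volume : Measure (AxisSpace n)).real B = η / 8 * (volume : Measure F).real A := by
    rw [measureReal_def, hB, volume_axisSpace, Measure.volume_eq_prod,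
      Measure.prod_apply_symm hTo.measurableSet]
    have h1 : ∀ y : F, volume ((fun x : ℝ => (x, y)) ⁻¹' T) =
        A.indicator (fun _ => ENNReal.ofReal (η / 8)) y := by
      intro y
      by_cases hy : y ∈ A
      · rw [Set.indicator_of_mem hy]
        have h2 : (fun x : ℝ => (x, y)) ⁻¹' T = Metric.ball (c * ‖y‖) (η / 16) := by
          ext x; simp [hT, hy, Real.dist_eq]
        rw [h2, Real.volume_ball]
        congr 1; ring
      · rw [Set.indicator_of_notMem hy]
        have h2 : (fun x : ℝ => (x, y)) ⁻¹' T = ∅ := by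
          ext x; simp [hT, hy]
        rw [h2, measure_empty]
    simp_rw [h1]
    rw [lintegral_indicator_const hAo.measurableSet, ENNReal.toReal_mul,
      ENNReal.toReal_ofReal (by positivity), measureReal_def]
  have hx : ∀ x ∈ B, 1 / 8 < ‖x.snd‖ ∧ ‖x.snd‖ < 1 / 4 ∧ |x.fst - c * ‖x.snd‖| < η / 16 := by
    rintro x ⟨⟨h1, h2⟩, h3⟩
    exact ⟨h1, h2, h3⟩
  have hx0 : ∀ x ∈ B, 0 < ‖x‖ := by
    intro x hxB
    obtain ⟨h1, h2, h3⟩ := hx x hxB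
    have h4 := norm_axisSpace_sq x
    by_contra h
    nlinarith [norm_nonneg x, sq_nonneg x.fst]
  have key := finrank_mul_volume_le_toSphere
    (s := {u : Metric.sphere (0 : AxisSpace n) 1 | |(u : AxisSpace n).fst - s| ≤ η})
    (measurableSet_le (Continuous.measurable (by fun_prop)) measurable_const) (B := B) ?_ ?_
  · rw [hvol, finrank_axisSpace] at key
    refine le_trans (le_of_eq ?_) key
    push_cast; ring
  · intro x hxB
    obtain ⟨h1, h2, h3⟩ := hx x hxB
    refine ⟨hx0 x hxB, ?_⟩
    have h4 := norm_axisSpace_sq x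
    have h6 := norm_nonneg x
    rw [abs_lt] at h3
    set ρ := ‖x.snd‖
    set z := x.fst
    have h7 : (c * ρ) ^ 2 ≤ 9 / 7 / 16 := by
      rw [mul_pow]; nlinarith [sq_nonneg c, sq_nonneg ρ]
    have h8 : z ^ 2 ≤ 2 * (c * ρ) ^ 2 + 2 * (1 / 16) ^ 2 := by
      have h9 : (z - c * ρ) ^ 2 ≤ (1 / 16) ^ 2 := by
        apply sq_le_sq' <;> linarith [h3.1, h3.2]
      nlinarith [sq_nonneg (z - 2 * (c * ρ))]
    by_contra h
    push Not at h
    nlinarith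
  · intro x hxB u hu
    obtain ⟨h1, h2, h3⟩ := hx x hxB
    set ρ := ‖x.snd‖ with hρ
    set y : AxisSpace n := WithLp.toLp 2 (c * ρ, x.snd) with hy
    have hy2 : ‖y‖ ^ 2 = (c * ρ) ^ 2 + ρ ^ 2 := norm_axisSpace_sq y
    have hyn : ‖y‖ * w = ρ := by
      have h4 : (‖y‖ * w) ^ 2 = ρ ^ 2 := by
        rw [mul_pow, hy2]
        have : c ^ 2 * w ^ 2 = s ^ 2 := by rw [← mul_pow, hcw]
        linear_combination ρ ^ 2 * this + ρ ^ 2 * hw2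
      exact (pow_left_inj₀ (by positivity) (by positivity) two_ne_zero).1 h4
    have hy1 : ρ ≤ ‖y‖ := by
      have : 0 ≤ (c * ρ) ^ 2 := sq_nonneg _
      exact le_of_sq_le_sq (by linarith) (norm_nonneg _)
    have hyρ : 0 < ‖y‖ := by linarith
    have h7 := norm_normalize_sub_le (hx0 x hxB) hyρ
    have h8 : ‖x - y‖ = |x.fst - c * ρ| := by
      have h9 : ‖x - y‖ ^ 2 = (x.fst - c * ρ) ^ 2 + ‖x.snd - x.snd‖ ^ 2 :=
        norm_axisSpace_sq (x - y)
      rw [sub_self, norm_zero, zero_pow two_ne_zero, add_zero] at h9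
      rw [← abs_of_nonneg (norm_nonneg (x - y))]
      exact (sq_eq_sq_iff_abs_eq_abs _ _).1 h9
    have h10 : |(u : AxisSpace n).fst - s| ≤ ‖(u : AxisSpace n) - ‖y‖⁻¹ • y‖ := by
      have h11 : ((u : AxisSpace n) - ‖y‖⁻¹ • y).fst = (u : AxisSpace n).fst - s := by
        have h12 : ‖y‖⁻¹ * (c * ρ) = s := by
          rw [← hcw, ← hyn]; field_simp
        rw [← h12]; rfl
      rw [← h11]
      refine abs_le_of_sq_le_sq ?_ (norm_nonneg _)
      rw [norm_axisSpace_sq]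
      linarith [sq_nonneg ‖((u : AxisSpace n) - ‖y‖⁻¹ • y).snd‖]
    change |(u : AxisSpace n).fst - s| ≤ η
    rw [← hu] at h7
    refine h10.trans (h7.trans ?_)
    rw [h8, div_le_iff₀ hyρ]
    nlinarith

theorem exists_isometry_axis {n : ℕ} (v : AxisSpace n) :
    ∃ L : AxisSpace n ≃ₗᵢ[ℝ] AxisSpace n, L v = ‖v‖ • axis n := by
  refine ⟨(ℝ ∙ (v - ‖v‖ • axis n))ᗮ.reflection, Submodule.reflection_sub ?_⟩
  rw [norm_smul, norm_axis, mul_one, norm_norm]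

theorem sphereMeasure_real_preimage {n : ℕ} (L : AxisSpace n ≃ₗᵢ[ℝ] AxisSpace n)
    {s : Set (Metric.sphere (0 : AxisSpace n) 1)} (hs : MeasurableSet s) :
    (sphereMeasure n).real ((fun u : Metric.sphere (0 : AxisSpace n) 1 =>
      (⟨L u, by simp⟩ : Metric.sphere (0 : AxisSpace n) 1)) ⁻¹' s) = (sphereMeasure n).real s := by
  rw [MeasureTheory.measureReal_def, MeasureTheory.measureReal_def,
    (measurePreserving_sphere_isometry L).measure_preimage hs.nullMeasurableSet]

theorem exists_cap_ge (n : ℕ) : ∃ c : ℝ, 0 < c ∧ ∀ δ ∈ Set.Ioc (0 : ℝ) 1,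
    ∀ e : AxisSpace n, ‖e‖ = 1 → c * δ ^ n ≤ (sphereMeasure n).real
      {u : Metric.sphere (0 : AxisSpace n) 1 | ‖(u : AxisSpace n) - e‖ ≤ δ} := by
  obtain ⟨c, hc, h⟩ := exists_cap_axis_ge n
  refine ⟨c, hc, fun δ hδ e he => (h δ hδ).trans (le_of_eq ?_)⟩
  obtain ⟨L, hL⟩ := exists_isometry_axis e
  rw [he, one_smul] at hL
  rw [← sphereMeasure_real_preimage L (measurableSet_le (by fun_prop) measurable_const)]
  congr 1
  ext u
  simp only [Set.preimage_ofPred_eq, Set.mem_ofPred_eq]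
  rw [← hL, ← map_sub, LinearIsometryEquiv.norm_map]

theorem exists_slice_ge {n : ℕ} (hn : 1 ≤ n) : ∃ c : ℝ, 0 < c ∧ ∀ η ∈ Set.Ioc (0 : ℝ) 1,
    ∀ s : ℝ, |s| ≤ 3 / 4 → ∀ e : AxisSpace n, ‖e‖ = 1 → c * η ≤ (sphereMeasure n).real
      {u : Metric.sphere (0 : AxisSpace n) 1 | |inner ℝ e (u : AxisSpace n) - s| ≤ η} := by
  obtain ⟨c, hc, h⟩ := exists_slice_axis_ge hn
  refine ⟨c, hc, fun η hη s hs e he => (h η hη s hs).trans (le_of_eq ?_)⟩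
  obtain ⟨L, hL⟩ := exists_isometry_axis e
  rw [he, one_smul] at hL
  rw [← sphereMeasure_real_preimage L
    (measurableSet_le (Continuous.measurable (by fun_prop)) measurable_const)]
  congr 1
  ext u
  simp only [Set.preimage_ofPred_eq, Set.mem_ofPred_eq]
  rw [← inner_axis, ← hL, LinearIsometryEquiv.inner_map_map]

open MeasureTheory in
/-- Integration in polar coordinates of a product of a radial and an angular function. -/
theorem integral_polar {n : ℕ} (f : AxisSpace n → ℝ)
    (g : Metric.sphere (0 : AxisSpace n) 1 → ℝ) (φ : ℝ → ℝ)
    (hf : ∀ (r : ℝ) (u : Metric.sphere (0 : AxisSpace n) 1), 0 < r →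
      f (r • (u : AxisSpace n)) = g u * φ r) :
    ∫ x, f x = (∫ u, g u ∂(sphereMeasure n)) * ∫ r in Set.Ioi (0 : ℝ), r ^ n * φ r := by
  have hdim : Module.finrank ℝ (AxisSpace n) - 1 = n := by rw [finrank_axisSpace]; rfl
  calc
    ∫ x, f x = ∫ x : ({(0)}ᶜ : Set (AxisSpace n)), f x.1 ∂(volume.comap Subtype.val) := by
      rw [integral_subtype_comap (measurableSet_singleton _).compl f,
        restrict_compl_singleton]
    _ = ∫ p : Metric.sphere (0 : AxisSpace n) 1 × Set.Ioi (0 : ℝ), g p.1 * φ p.2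
          ∂((sphereMeasure n).prod (.volumeIoiPow (Module.finrank ℝ (AxisSpace n) - 1))) := by
      rw [← (Measure.measurePreserving_homeomorphUnitSphereProd
        (volume : Measure (AxisSpace n))).integral_comp (Homeomorph.measurableEmbedding _)]
      refine integral_congr_ae (ae_of_all _ fun x => ?_)
      have h := hf (homeomorphUnitSphereProd (AxisSpace n) x).2
        (homeomorphUnitSphereProd (AxisSpace n) x).1 (homeomorphUnitSphereProd (AxisSpace n) x).2.2
      refine Eq.trans ?_ h
      change f x = f _
      congr 1
      have hx : ‖(x : AxisSpace n)‖ ≠ 0 := norm_ne_zero_iff.2 x.2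
      simp [smul_smul, hx]
    _ = (∫ u, g u ∂(sphereMeasure n)) *
        ∫ r : Set.Ioi (0 : ℝ), φ r ∂(.volumeIoiPow (Module.finrank ℝ (AxisSpace n) - 1)) :=
      integral_prod_mul g (fun r : Set.Ioi (0 : ℝ) => φ r)
    _ = _ := by
      congr 1
      simp only [Measure.volumeIoiPow, ENNReal.ofReal]
      rw [integral_withDensity_eq_integral_smul,
        integral_subtype_comap measurableSet_Ioi fun a ↦ Real.toNNReal
          (a ^ (Module.finrank ℝ (AxisSpace n) - 1)) • φ a,
        setIntegral_congr_fun measurableSet_Ioi fun x hx ↦ ?_]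
      · rw [NNReal.smul_def, Real.coe_toNNReal _ (pow_nonneg hx.out.le _), hdim, smul_eq_mul]
      · exact (measurable_subtype_coe.pow_const _).real_toNNReal

open MeasureTheory in
theorem integral_Ioi_pow_mul_gaussian (m : ℕ) :
    ∫ r in Set.Ioi (0 : ℝ), r ^ m * Real.exp (-r ^ 2) = 1 / 2 * Real.Gamma (((m : ℝ) + 1) / 2) := by
  rw [← integral_rpow_mul_exp_neg_rpow (p := 2) two_pos (q := m) (by
    have : (0 : ℝ) ≤ m := Nat.cast_nonneg m
    linarith)]
  refine setIntegral_congr_fun measurableSet_Ioi fun r _ => ?_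
  simp only [Real.rpow_natCast]
  norm_num

open MeasureTheory in
theorem integral_even_pow_mul_gaussian (k : ℕ) :
    ∫ t : ℝ, t ^ (2 * k) * Real.exp (-t ^ 2) = Real.Gamma ((k : ℝ) + 1 / 2) := by
  have h := integral_comp_abs (f := fun t : ℝ => t ^ (2 * k) * Real.exp (-t ^ 2))
  rw [integral_Ioi_pow_mul_gaussian] at h
  have e : ∀ t : ℝ, |t| ^ (2 * k) * Real.exp (-|t| ^ 2) = t ^ (2 * k) * Real.exp (-t ^ 2) := by
    intro t; rw [pow_mul, sq_abs, pow_mul]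
  simp_rw [e] at h
  rw [h]
  push_cast
  ring_nf

open MeasureTheory in
/-- The Gaussian moments of the first coordinate, computed in Cartesian and in polar
coordinates, give the moments of the first coordinate on the sphere. -/
theorem sphere_moment_gamma (n k : ℕ) :
    (∫ u : Metric.sphere (0 : AxisSpace n) 1, (u : AxisSpace n).fst ^ (2 * k) ∂(sphereMeasure n)) *
      (1 / 2 * Real.Gamma ((n : ℝ) / 2 + k + 1 / 2)) =
      Real.Gamma ((k : ℝ) + 1 / 2) *
        ∫ y : EuclideanSpace ℝ (Fin n), Real.exp (-‖y‖ ^ 2) := by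
  have h1 := integral_polar (n := n) (fun x => x.fst ^ (2 * k) * Real.exp (-‖x‖ ^ 2))
    (fun u => (u : AxisSpace n).fst ^ (2 * k)) (fun r => r ^ (2 * k) * Real.exp (-r ^ 2)) ?_
  · have h2 : ∫ r in Set.Ioi (0 : ℝ), r ^ n * (r ^ (2 * k) * Real.exp (-r ^ 2)) =
        1 / 2 * Real.Gamma ((n : ℝ) / 2 + k + 1 / 2) := by
      have h3 := integral_Ioi_pow_mul_gaussian (n + 2 * k)
      simp_rw [← mul_assoc, ← pow_add]
      rw [h3]
      push_cast
      ring_nf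
    rw [h2] at h1
    rw [← h1, ← (WithLp.volume_preserving_toLp ℝ (EuclideanSpace ℝ (Fin n))).integral_comp
      (MeasurableEquiv.toLp 2 (ℝ × EuclideanSpace ℝ (Fin n))).measurableEmbedding]
    rw [← integral_even_pow_mul_gaussian, ← integral_prod_mul, ← Measure.volume_eq_prod]
    refine integral_congr_ae (ae_of_all _ fun z => ?_)
    simp only [norm_axisSpace_sq]
    rw [neg_add, Real.exp_add]
    change z.1 ^ (2 * k) * (Real.exp (-z.1 ^ 2) * Real.exp (-‖z.2‖ ^ 2)) = _
    ring
  · intro r u hr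
    have hu : ‖(u : AxisSpace n)‖ = 1 := by simp
    have e1 : (r • (u : AxisSpace n)).fst = r * (u : AxisSpace n).fst := rfl
    simp only [norm_smul, hu, mul_one, Real.norm_eq_abs, sq_abs, e1, mul_pow]
    ring

/-- The even moments of a coordinate on the sphere. -/
theorem sphere_moment (n k : ℕ) :
    ∫ u : Metric.sphere (0 : AxisSpace n) 1, (u : AxisSpace n).fst ^ (2 * k) ∂(sphereMeasure n) =
      (sphereMeasure n).real Set.univ *
        ((2 * k).factorial / 4 ^ k * besselCoeff (nuOf (n + 1)) k) := by
  induction k with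
  | zero => simp [besselCoeff]
  | succ k ih =>
    have h0 := sphere_moment_gamma n k
    have h1 := sphere_moment_gamma n (k + 1)
    set P := ∫ y : EuclideanSpace ℝ (Fin n), Real.exp (-‖y‖ ^ 2)
    have hG : 0 < Real.Gamma ((n : ℝ) / 2 + k + 1 / 2) := Real.Gamma_pos_of_pos (by positivity)
    have g1 : Real.Gamma ((n : ℝ) / 2 + (k + 1 : ℕ) + 1 / 2) =
        (n / 2 + k + 1 / 2) * Real.Gamma ((n : ℝ) / 2 + k + 1 / 2) := by
      rw [← Real.Gamma_add_one (by positivity)]; push_cast; ring_nf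
    have g2 : Real.Gamma (((k + 1 : ℕ) : ℝ) + 1 / 2) = (k + 1 / 2) * Real.Gamma (k + 1 / 2) := by
      rw [← Real.Gamma_add_one (by positivity)]; push_cast; ring_nf
    rw [g1, g2, mul_assoc, ← h0] at h1
    set M := ∫ u : Metric.sphere (0 : AxisSpace n) 1,
      (u : AxisSpace n).fst ^ (2 * (k + 1)) ∂(sphereMeasure n)
    have h2 : M * (n / 2 + k + 1 / 2) = (k + 1 / 2) * ((sphereMeasure n).real Set.univ *
        ((2 * k).factorial / 4 ^ k * besselCoeff (nuOf (n + 1)) k)) := by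
      rw [← ih]
      have := mul_right_cancel₀ (b := 1 / 2 * Real.Gamma ((n : ℝ) / 2 + k + 1 / 2))
        (a := M * (n / 2 + k + 1 / 2)) (c := (k + 1 / 2) * ∫ u : Metric.sphere (0 : AxisSpace n) 1,
          (u : AxisSpace n).fst ^ (2 * k) ∂(sphereMeasure n)) (by positivity) (by linarith)
      exact this
    have h3 : (n : ℝ) / 2 + k + 1 / 2 ≠ 0 := by positivity
    have e : (k : ℝ) + 1 + nuOf (n + 1) = n / 2 + k + 1 / 2 := by
      unfold nuOf; push_cast; ring
    have e2 : 2 * (k + 1) = 2 * k + 1 + 1 := by ring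
    rw [← eq_div_iff h3] at h2
    rw [h2, besselCoeff, e, e2, Nat.factorial_succ, Nat.factorial_succ]
    push_cast
    field_simp
    ring

/-- The Fourier transform of the uniform measure on the sphere. -/
noncomputable def sphereChar (n : ℕ) (ξ : AxisSpace n) : ℝ :=
  ∫ u : Metric.sphere (0 : AxisSpace n) 1, Real.cos (inner ℝ ξ (u : AxisSpace n)) ∂(sphereMeasure n)

open MeasureTheory in
theorem integral_comp_isometry {n : ℕ} (L : AxisSpace n ≃ₗᵢ[ℝ] AxisSpace n)
    {f : AxisSpace n → ℝ} (hf : Continuous f) :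
    ∫ u : Metric.sphere (0 : AxisSpace n) 1, f (L u) ∂(sphereMeasure n) =
      ∫ u : Metric.sphere (0 : AxisSpace n) 1, f u ∂(sphereMeasure n) := by
  have h := measurePreserving_sphere_isometry L
  have h2 := integral_map (μ := sphereMeasure n) h.measurable.aemeasurable
    (f := fun u : Metric.sphere (0 : AxisSpace n) 1 => f u)
    (Continuous.aestronglyMeasurable (by fun_prop))
  rw [h.map_eq] at h2
  exact h2.symm

open MeasureTheory in
/-- The power series of the cosine, integrated term by term with the moments of a coordinate, is the
power series of `j_d`. -/
theorem sphereChar_eq {n : ℕ} (hn : 1 ≤ n) (ξ : AxisSpace n) :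
    sphereChar n ξ = (sphereMeasure n).real Set.univ * sphereFourier (n + 1) ‖ξ‖ := by
  obtain ⟨L, hL⟩ := exists_isometry_axis ξ
  have h1 : sphereChar n ξ = ∫ u : Metric.sphere (0 : AxisSpace n) 1,
      Real.cos (‖ξ‖ * (u : AxisSpace n).fst) ∂(sphereMeasure n) := by
    rw [sphereChar, ← integral_comp_isometry L (f := fun x => Real.cos (‖ξ‖ * x.fst))
      (by fun_prop)]
    refine integral_congr_ae (ae_of_all _ fun u => ?_)
    simp only
    rw [← inner_axis, ← real_inner_smul_left, ← hL, LinearIsometryEquiv.inner_map_map]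
  rw [h1, sphereFourier_eq_tsum (by omega) (norm_nonneg _)]
  set t := ‖ξ‖
  have hle : ∀ u : Metric.sphere (0 : AxisSpace n) 1, |(u : AxisSpace n).fst| ≤ 1 := by
    intro u
    have h2 := norm_axisSpace_sq (u : AxisSpace n)
    have hu : ‖(u : AxisSpace n)‖ = 1 := by simp
    rw [hu] at h2
    exact (sq_le_one_iff_abs_le_one _).1 (by nlinarith [sq_nonneg ‖(u : AxisSpace n).snd‖])
  have key := hasSum_integral_of_dominated_convergence (μ := sphereMeasure n)
    (F := fun k (u : Metric.sphere (0 : AxisSpace n) 1) =>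
      (-1 : ℝ) ^ k * (t * (u : AxisSpace n).fst) ^ (2 * k) / ((2 * k).factorial : ℝ))
    (f := fun u => Real.cos (t * (u : AxisSpace n).fst))
    (fun k _ => |t| ^ (2 * k) / ((2 * k).factorial : ℝ)) (fun k => ?_) (fun k => ?_) ?_ ?_ ?_
  · rw [← key.tsum_eq, ← tsum_mul_left]
    refine tsum_congr fun k => ?_
    have e : ∀ u : Metric.sphere (0 : AxisSpace n) 1,
        (-1 : ℝ) ^ k * (t * (u : AxisSpace n).fst) ^ (2 * k) / ((2 * k).factorial : ℝ) =
        ((-1 : ℝ) ^ k * t ^ (2 * k) / ((2 * k).factorial : ℝ)) *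
          (u : AxisSpace n).fst ^ (2 * k) := by
      intro u; rw [mul_pow]; ring
    simp_rw [e]
    rw [integral_const_mul, sphere_moment, div_pow, pow_mul 2 2 k]
    have : ((2 * k).factorial : ℝ) ≠ 0 := by positivity
    field_simp
    norm_num
    ring
  · exact Continuous.aestronglyMeasurable (by fun_prop)
  · refine ae_of_all _ fun u => ?_
    rw [norm_div, norm_mul, norm_pow, norm_neg, norm_one, one_pow, one_mul, norm_pow, norm_mul,
      Real.norm_natCast, Real.norm_eq_abs, Real.norm_eq_abs]
    gcongr
    exact mul_le_of_le_one_right (abs_nonneg _) (hle u)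
  · refine ae_of_all _ fun u => ?_
    have h := (Real.summable_pow_div_factorial |t|).comp_injective
      (mul_right_injective₀ (two_ne_zero (α := ℕ)))
    exact h
  · exact integrable_const _
  · exact ae_of_all _ fun u => Real.hasSum_cos _

/-! ### Positivity of the Bessel moments -/

section GaussianWalk

open MeasureTheory

theorem continuous_sphereChar (n : ℕ) : Continuous (sphereChar n) := by
  refine continuous_of_dominated (bound := fun _ => 1) (fun ξ => ?_) (fun ξ => ?_)
    (integrable_const _) ?_
  · exact Continuous.aestronglyMeasurable (by fun_prop)
  · exact ae_of_all _ fun u => by simpa using Real.abs_cos_le_one _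
  · exact ae_of_all _ fun u => by fun_prop

theorem abs_sphereChar_le (n : ℕ) (ξ : AxisSpace n) :
    |sphereChar n ξ| ≤ (sphereMeasure n).real Set.univ := by
  have h := norm_integral_le_of_norm_le_const (μ := sphereMeasure n) (C := 1)
    (f := fun u : Metric.sphere (0 : AxisSpace n) 1 => Real.cos (inner ℝ ξ (u : AxisSpace n)))
    (ae_of_all _ fun u => by simpa using Real.abs_cos_le_one _)
  simpa only [one_mul, Real.norm_eq_abs, sphereChar] using h

theorem integral_sin_inner (n : ℕ) (ξ : AxisSpace n) :
    ∫ u : Metric.sphere (0 : AxisSpace n) 1, Real.sin (inner ℝ ξ (u : AxisSpace n))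
      ∂(sphereMeasure n) = 0 := by
  have h := integral_comp_isometry (n := n) (LinearIsometryEquiv.neg ℝ)
    (f := fun x => Real.sin (inner ℝ ξ x)) (by fun_prop)
  simp only [LinearIsometryEquiv.coe_neg, inner_neg_right, Real.sin_neg, integral_neg] at h
  linarith

theorem integrable_gaussian_axisSpace (n : ℕ) {ε : ℝ} (hε : 0 < ε) :
    Integrable fun ξ : AxisSpace n => Real.exp (-ε * ‖ξ‖ ^ 2) := by
  have h := (GaussianFourier.integrable_cexp_neg_mul_sq_norm_add (V := AxisSpace n) (b := (ε : ℂ))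
    (by simpa using hε) 0 0).norm
  refine h.congr (ae_of_all _ fun ξ => ?_)
  simp only [Complex.norm_exp]
  congr 1
  simp [← Complex.ofReal_pow]

/-- Up to normalization, the value at `x` of the convolution of a Gaussian of width `√ε` with the
`m`-fold convolution power of the uniform measure on the sphere, written as a Fourier integral. -/
noncomputable def gaussianWalk (n m : ℕ) (ε : ℝ) (x : AxisSpace n) : ℝ :=
  ∫ ξ : AxisSpace n, Real.cos (inner ℝ x ξ) * (sphereChar n ξ ^ m * Real.exp (-ε * ‖ξ‖ ^ 2))

theorem gaussianWalk_zero (n : ℕ) {ε : ℝ} (hε : 0 < ε) (x : AxisSpace n) :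
    gaussianWalk n 0 ε x =
      (Real.pi / ε) ^ (((n : ℝ) + 1) / 2) * Real.exp (-‖x‖ ^ 2 / (4 * ε)) := by
  have hb : 0 < (ε : ℂ).re := by simpa using hε
  have h := GaussianFourier.integral_cexp_neg_mul_sq_norm_add (V := AxisSpace n) hb Complex.I x
  have hi := GaussianFourier.integrable_cexp_neg_mul_sq_norm_add (V := AxisSpace n) hb Complex.I x
  have h2 := congrArg Complex.re h
  have h3 := integral_re hi
  simp only [RCLike.re_to_complex] at h3
  rw [← h3] at h2
  rw [gaussianWalk]
  calc _ = ∫ ξ : AxisSpace n, (Complex.exp (-(ε : ℂ) * (‖ξ‖ : ℂ) ^ 2 +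
        Complex.I * ((inner ℝ x ξ : ℝ) : ℂ))).re := by
        refine integral_congr_ae (ae_of_all _ fun ξ => ?_)
        simp only [Complex.exp_re]
        simp [← Complex.ofReal_pow]
        ring
    _ = _ := h2
    _ = _ := by
        rw [finrank_axisSpace]
        have e1 : ((Real.pi : ℂ) / (ε : ℂ)) ^ (((n + 1 : ℕ) : ℂ) / 2) =
            (((Real.pi / ε) ^ (((n : ℝ) + 1) / 2) : ℝ) : ℂ) := by
          rw [Complex.ofReal_cpow (by positivity)]
          push_cast
          rfl
        have e2 : Complex.exp (Complex.I ^ 2 * (‖x‖ : ℂ) ^ 2 / (4 * (ε : ℂ))) =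
            ((Real.exp (-‖x‖ ^ 2 / (4 * ε)) : ℝ) : ℂ) := by
          rw [Complex.I_sq]; push_cast; ring_nf
        rw [e1, e2, ← Complex.ofReal_mul, Complex.ofReal_re]

theorem gaussianWalk_integrand_bound (n m : ℕ) (ε : ℝ) (x ξ : AxisSpace n) :
    ‖Real.cos (inner ℝ x ξ) * (sphereChar n ξ ^ m * Real.exp (-ε * ‖ξ‖ ^ 2))‖ ≤
      (sphereMeasure n).real Set.univ ^ m * Real.exp (-ε * ‖ξ‖ ^ 2) := by
  rw [Real.norm_eq_abs, abs_mul, abs_mul, abs_pow, Real.abs_exp]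
  have h1 := abs_sphereChar_le n ξ
  have h2 := Real.abs_cos_le_one (inner ℝ x ξ)
  calc _ ≤ 1 * ((sphereMeasure n).real Set.univ ^ m * Real.exp (-ε * ‖ξ‖ ^ 2)) := by gcongr
    _ = _ := one_mul _

theorem continuous_gaussianWalk (n m : ℕ) {ε : ℝ} (hε : 0 < ε) :
    Continuous (gaussianWalk n m ε) := by
  have hc := continuous_sphereChar n
  refine continuous_of_dominated
    (bound := fun ξ => (sphereMeasure n).real Set.univ ^ m * Real.exp (-ε * ‖ξ‖ ^ 2))
    (fun x => ?_) (fun x => ae_of_all _ fun ξ => gaussianWalk_integrand_bound n m ε x ξ)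
    ((integrable_gaussian_axisSpace n hε).const_mul _) (ae_of_all _ fun ξ => by fun_prop)
  exact Continuous.aestronglyMeasurable (by fun_prop)

/-- One more step of the random walk. -/
theorem gaussianWalk_succ (n m : ℕ) {ε : ℝ} (hε : 0 < ε) (x : AxisSpace n) :
    gaussianWalk n (m + 1) ε x = ∫ u : Metric.sphere (0 : AxisSpace n) 1,
      gaussianWalk n m ε (x + u) ∂(sphereMeasure n) := by
  have hc := continuous_sphereChar n
  simp only [gaussianWalk]
  rw [integral_integral_swap]
  · refine integral_congr_ae (ae_of_all _ fun ξ => ?_)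
    simp only
    rw [integral_mul_const]
    have e : ∀ u : Metric.sphere (0 : AxisSpace n) 1, Real.cos (inner ℝ (x + (u : AxisSpace n)) ξ) =
        Real.cos (inner ℝ x ξ) * Real.cos (inner ℝ ξ (u : AxisSpace n)) -
          Real.sin (inner ℝ x ξ) * Real.sin (inner ℝ ξ (u : AxisSpace n)) := by
      intro u
      rw [inner_add_left, Real.cos_add, real_inner_comm ξ (u : AxisSpace n)]
    simp_rw [e]
    rw [integral_sub, integral_const_mul, integral_const_mul, integral_sin_inner, mul_zero, sub_zero,
      pow_succ, sphereChar]
    · ring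
    · refine Integrable.const_mul (Integrable.of_bound (C := 1)
        (Continuous.aestronglyMeasurable (by fun_prop)) (ae_of_all _ fun u => ?_)) _
      simpa using Real.abs_cos_le_one _
    · refine Integrable.const_mul (Integrable.of_bound (C := 1)
        (Continuous.aestronglyMeasurable (by fun_prop)) (ae_of_all _ fun u => ?_)) _
      simpa using Real.abs_sin_le_one _
  · have h1 : Integrable (fun p : Metric.sphere (0 : AxisSpace n) 1 × AxisSpace n =>
        (1 : ℝ) * ((sphereMeasure n).real Set.univ ^ m * Real.exp (-ε * ‖p.2‖ ^ 2)))
        ((sphereMeasure n).prod volume) :=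
      Integrable.mul_prod (f := fun _ => (1 : ℝ)) (integrable_const _)
        ((integrable_gaussian_axisSpace n hε).const_mul _)
    refine h1.mono' (Continuous.aestronglyMeasurable ?_) (ae_of_all _ fun p => ?_)
    · simp only [Function.uncurry_def]
      fun_prop
    · rw [one_mul]
      exact gaussianWalk_integrand_bound n m ε _ _

theorem gaussianWalk_nonneg (n m : ℕ) {ε : ℝ} (hε : 0 < ε) (x : AxisSpace n) :
    0 ≤ gaussianWalk n m ε x := by
  induction m generalizing x with
  | zero => rw [gaussianWalk_zero n hε]; positivity
  | succ m ih =>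
    rw [gaussianWalk_succ n m hε]
    exact integral_nonneg fun u => ih _

theorem mul_measure_le_gaussianWalk_succ (n m : ℕ) {ε : ℝ} (hε : 0 < ε) (x : AxisSpace n)
    {c : ℝ} (hc : 0 ≤ c) {A : Set (Metric.sphere (0 : AxisSpace n) 1)}
    (hA : ∀ u ∈ A, c ≤ gaussianWalk n m ε (x + u)) :
    c * (sphereMeasure n).real A ≤ gaussianWalk n (m + 1) ε x := by
  rw [gaussianWalk_succ n m hε]
  have hcont := continuous_gaussianWalk n m hε
  have hint : Integrable (fun u : Metric.sphere (0 : AxisSpace n) 1 =>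
      gaussianWalk n m ε (x + u)) (sphereMeasure n) := by
    have h : Continuous (fun u : Metric.sphere (0 : AxisSpace n) 1 =>
      gaussianWalk n m ε (x + u)) := by fun_prop
    exact h.integrable_of_hasCompactSupport (HasCompactSupport.of_compactSpace _)
  refine le_trans ?_ (mul_meas_ge_le_integral_of_nonneg
    (ae_of_all _ fun u => gaussianWalk_nonneg n m hε _) hint c)
  gcongr
  · exact measure_ne_top _ _
  · exact fun u hu => hA u hu

/-- After one step, the density near the unit sphere is at least of order `1 / δ`, if the Gaussian
has width of order `δ`. -/
theorem exists_gaussianWalk_one_ge (n : ℕ) : ∃ c : ℝ, 0 < c ∧ ∀ δ ∈ Set.Ioc (0 : ℝ) (1 / 2),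
    ∀ x : AxisSpace n, |‖x‖ - 1| ≤ δ → c / δ ≤ gaussianWalk n 1 (δ ^ 2 / 4) x := by
  obtain ⟨c, hc, hcap⟩ := exists_cap_ge n
  refine ⟨(4 * Real.pi) ^ (((n : ℝ) + 1) / 2) * Real.exp (-4) * c, by positivity,
    fun δ hδ x hx => ?_⟩
  have hδ0 := hδ.1
  have hε : 0 < δ ^ 2 / 4 := by positivity
  have hx0 : 0 < ‖x‖ := by linarith [(abs_le.1 hx).1, hδ.2]
  have he : ‖-(‖x‖⁻¹ • x)‖ = 1 := by
    rw [norm_neg, norm_smul, norm_inv, norm_norm, inv_mul_cancel₀ hx0.ne']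
  have h1 := hcap δ ⟨hδ0, by linarith [hδ.2]⟩ _ he
  have e1 : (Real.pi / (δ ^ 2 / 4)) ^ (((n : ℝ) + 1) / 2) =
      (4 * Real.pi) ^ (((n : ℝ) + 1) / 2) / δ ^ (n + 1) := by
    rw [show Real.pi / (δ ^ 2 / 4) = 4 * Real.pi / δ ^ 2 by field_simp,
      Real.div_rpow (by positivity) (by positivity), ← Real.rpow_natCast δ 2,
      ← Real.rpow_mul hδ0.le, ← Real.rpow_natCast δ (n + 1)]
    congr 2
    push_cast; ring
  -- On the cap of radius `δ` about `-x / ‖x‖` the point `x + u` is within `2 δ` of the origin.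
  have h2 := mul_measure_le_gaussianWalk_succ n 0 hε x
    (c := (4 * Real.pi) ^ (((n : ℝ) + 1) / 2) / δ ^ (n + 1) * Real.exp (-4)) (by positivity)
    (A := {u : Metric.sphere (0 : AxisSpace n) 1 | ‖(u : AxisSpace n) - -(‖x‖⁻¹ • x)‖ ≤ δ}) ?_
  · refine le_trans ?_ (le_trans (mul_le_mul_of_nonneg_left h1 (by positivity)) h2)
    rw [pow_succ]
    refine le_of_eq ?_
    field_simp
  · intro u hu
    replace hu : ‖(u : AxisSpace n) - -(‖x‖⁻¹ • x)‖ ≤ δ := hu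
    rw [gaussianWalk_zero n hε, e1]
    have h3 : ‖x + u‖ ≤ 2 * δ := by
      have e2 : x + (u : AxisSpace n) =
          (‖x‖ - 1) • (‖x‖⁻¹ • x) + ((u : AxisSpace n) - -(‖x‖⁻¹ • x)) := by
        rw [sub_smul, smul_smul, mul_inv_cancel₀ hx0.ne', one_smul, one_smul]; abel
      rw [e2]
      refine (norm_add_le _ _).trans ?_
      rw [norm_neg] at he
      rw [norm_smul, he, mul_one, Real.norm_eq_abs]
      linarith
    gcongr
    rw [le_div_iff₀ (by positivity)]
    nlinarith [norm_nonneg (x + (u : AxisSpace n))]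

theorem exists_unit_direction {n : ℕ} (x : AxisSpace n) :
    ∃ e : AxisSpace n, ‖e‖ = 1 ∧ x = ‖x‖ • e := by
  rcases eq_or_ne x 0 with rfl | hx
  · exact ⟨axis n, norm_axis n, by simp⟩
  · have h := norm_ne_zero_iff.2 hx
    exact ⟨‖x‖⁻¹ • x, by rw [norm_smul, norm_inv, norm_norm, inv_mul_cancel₀ h],
      by rw [smul_smul, mul_inv_cancel₀ h, one_smul]⟩

theorem norm_add_sphere_sq {n : ℕ} {x e : AxisSpace n} (hx : x = ‖x‖ • e)
    (u : Metric.sphere (0 : AxisSpace n) 1) :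
    ‖x + u‖ ^ 2 = ‖x‖ ^ 2 + 2 * ‖x‖ * inner ℝ e (u : AxisSpace n) + 1 := by
  have hu : ‖(u : AxisSpace n)‖ = 1 := by simp
  have h : inner ℝ x (u : AxisSpace n) = ‖x‖ * inner ℝ e (u : AxisSpace n) := by
    conv_lhs => rw [hx]
    rw [real_inner_smul_left]
  rw [norm_add_sq_real, h, hu]
  ring

/-- After at least two steps, the density in the unit ball is bounded below. -/
theorem exists_gaussianWalk_ge {n : ℕ} (hn : 1 ≤ n) (m : ℕ) : ∃ c : ℝ, 0 < c ∧
    ∀ δ ∈ Set.Ioc (0 : ℝ) (1 / 2), ∀ x : AxisSpace n, ‖x‖ ≤ 1 →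
      c ≤ gaussianWalk n (m + 2) (δ ^ 2 / 4) x := by
  obtain ⟨b, hb, hslice⟩ := exists_slice_ge hn
  induction m with
  | zero =>
    obtain ⟨c, hc, h1⟩ := exists_gaussianWalk_one_ge n
    refine ⟨c * (b / 2), by positivity, fun δ hδ x hx => ?_⟩
    have hδ0 := hδ.1
    obtain ⟨e, he, hxe⟩ := exists_unit_direction x
    have hx0 := norm_nonneg x
    -- On the slice at height `-‖x‖ / 2` the point `x + u` is within `δ` of the unit sphere.
    have h2 := hslice (δ / 2) ⟨by positivity, by linarith [hδ.2]⟩ (-(‖x‖ / 2))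
      (by rw [abs_neg, abs_of_nonneg (by positivity)]; linarith) e he
    have h3 := mul_measure_le_gaussianWalk_succ n 1 (ε := δ ^ 2 / 4) (by positivity) x
      (c := c / δ) (by positivity) (A := {u : Metric.sphere (0 : AxisSpace n) 1 |
        |inner ℝ e (u : AxisSpace n) - -(‖x‖ / 2)| ≤ δ / 2}) ?_
    · refine le_trans (le_of_eq ?_) (le_trans (mul_le_mul_of_nonneg_left h2 (by positivity)) h3)
      field_simp
    · intro u hu
      refine h1 δ hδ _ ?_
      replace hu : |inner ℝ e (u : AxisSpace n) - -(‖x‖ / 2)| ≤ δ / 2 := hu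
      have h4 := norm_add_sphere_sq hxe u
      have h5 := norm_nonneg (x + (u : AxisSpace n))
      have h6 : |(‖x + (u : AxisSpace n)‖ - 1) * (‖x + (u : AxisSpace n)‖ + 1)| ≤ δ := by
        have e1 : (‖x + (u : AxisSpace n)‖ - 1) * (‖x + (u : AxisSpace n)‖ + 1) =
            2 * ‖x‖ * (inner ℝ e (u : AxisSpace n) - -(‖x‖ / 2)) := by
          linear_combination h4
        rw [e1, abs_mul, abs_of_nonneg (by positivity)]
        nlinarith [abs_nonneg (inner ℝ e (u : AxisSpace n) - -(‖x‖ / 2))]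
      rw [abs_mul, abs_of_nonneg (by positivity : 0 ≤ ‖x + (u : AxisSpace n)‖ + 1)] at h6
      nlinarith [abs_nonneg (‖x + (u : AxisSpace n)‖ - 1)]
  | succ m ih =>
    obtain ⟨c, hc, h1⟩ := ih
    refine ⟨c * (b * (1 / 4)), by positivity, fun δ hδ x hx => ?_⟩
    have hδ0 := hδ.1
    obtain ⟨e, he, hxe⟩ := exists_unit_direction x
    have hx0 := norm_nonneg x
    -- On the slice at height `-3 / 4` the point `x + u` stays in the unit ball.
    have h2 := hslice (1 / 4) (by norm_num) (-(3 / 4)) (by norm_num [abs_of_pos]) e he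
    have h3 := mul_measure_le_gaussianWalk_succ n (m + 2) (ε := δ ^ 2 / 4) (by positivity) x
      hc.le (A := {u : Metric.sphere (0 : AxisSpace n) 1 |
        |inner ℝ e (u : AxisSpace n) - -(3 / 4)| ≤ 1 / 4}) ?_
    · exact le_trans (mul_le_mul_of_nonneg_left h2 hc.le) h3
    · intro u hu
      refine h1 δ hδ _ ?_
      replace hu : |inner ℝ e (u : AxisSpace n) - -(3 / 4)| ≤ 1 / 4 := hu
      have h4 := norm_add_sphere_sq hxe u
      have h6 := (abs_le.1 hu).2
      have h7 : ‖x + (u : AxisSpace n)‖ ^ 2 ≤ 1 ^ 2 := by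
        rw [h4]; nlinarith
      exact le_of_sq_le_sq h7 zero_le_one

theorem sphereMeasure_univ_pos (n : ℕ) : 0 < (sphereMeasure n).real Set.univ := by
  rw [Measure.toSphere_real_apply_univ, finrank_axisSpace]
  have : 0 < (volume : Measure (AxisSpace n)).real (Metric.ball 0 1) :=
    ENNReal.toReal_pos (Metric.measure_ball_pos _ _ one_pos).ne' measure_ball_lt_top.ne
  positivity

theorem gaussianWalk_origin {n : ℕ} (hn : 1 ≤ n) (m : ℕ) (ε : ℝ) :
    gaussianWalk n m ε 0 = (sphereMeasure n).real Set.univ ^ (m + 1) *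
      ∫ r in Set.Ioi (0 : ℝ), sphereFourier (n + 1) r ^ m * r ^ n * Real.exp (-ε * r ^ 2) := by
  set s := (sphereMeasure n).real Set.univ with hs
  rw [gaussianWalk, integral_polar _ (fun _ => 1)
    (fun r => s ^ m * (sphereFourier (n + 1) r ^ m * Real.exp (-ε * r ^ 2)))]
  · rw [integral_const, smul_eq_mul, mul_one, ← hs, pow_succ', mul_assoc]
    congr 1
    rw [← integral_const_mul]
    refine setIntegral_congr_fun measurableSet_Ioi fun r _ => ?_
    ring
  · intro r u hr
    have hu : ‖(u : AxisSpace n)‖ = 1 := by simp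
    rw [inner_zero_left, Real.cos_zero, sphereChar_eq hn, norm_smul, hu, mul_one, Real.norm_eq_abs,
      abs_of_pos hr, mul_pow, ← hs]
    ring

theorem integrableOn_mul_exp_neg_sq : IntegrableOn (fun s : ℝ => 2 * s * Real.exp (-s ^ 2))
    (Set.Ioi 0) := by
  have h := (integrable_mul_exp_neg_mul_sq (b := 1) one_pos).const_mul 2
  refine (h.congr (ae_of_all _ fun s => ?_)).integrableOn
  simp only [neg_mul, one_mul]
  ring

theorem hasDerivAt_neg_exp_neg_sq (s : ℝ) :
    HasDerivAt (fun s : ℝ => -Real.exp (-s ^ 2)) (2 * s * Real.exp (-s ^ 2)) s := by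
  have h := ((hasDerivAt_pow 2 s).neg.exp).neg
  refine h.congr_deriv ?_
  simp only [Pi.neg_apply]
  push_cast
  ring

theorem tendsto_exp_neg_sq : Tendsto (fun s : ℝ => Real.exp (-s ^ 2)) atTop (𝓝 0) :=
  Real.tendsto_exp_atBot.comp (tendsto_neg_atTop_atBot.comp (tendsto_pow_atTop two_ne_zero))

theorem integral_mul_exp_neg_sq : ∫ s in Set.Ioi (0 : ℝ), 2 * s * Real.exp (-s ^ 2) = 1 := by
  have h := integral_Ioi_of_hasDerivAt_of_tendsto' (a := 0)
    (fun s _ => hasDerivAt_neg_exp_neg_sq s) integrableOn_mul_exp_neg_sq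
    (by simpa using tendsto_exp_neg_sq.neg)
  rw [h]; simp

/-- Abel summation with Gaussian factors: a convergent improper integral is the limit of its
Gaussian regularizations. -/
theorem tendsto_integral_gaussian {f : ℝ → ℝ} (hf : Continuous f)
    (hint : ∀ k : ℕ, 1 ≤ k → IntegrableOn (fun t => f t * Real.exp (-(t / k) ^ 2)) (Set.Ioi 0))
    {I : ℝ} (hI : Tendsto (fun T : ℝ => ∫ t in (0 : ℝ)..T, f t) atTop (𝓝 I)) :
    Tendsto (fun k : ℕ => ∫ t in Set.Ioi (0 : ℝ), f t * Real.exp (-(t / k) ^ 2)) atTop (𝓝 I) := by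
  set F : ℝ → ℝ := fun T => ∫ t in (0 : ℝ)..T, f t with hF
  have hder : ∀ t, HasDerivAt F (f t) t := fun t => hf.integral_hasStrictDerivAt 0 t |>.hasDerivAt
  have hFc : Continuous F := continuous_iff_continuousAt.2 fun t => (hder t).continuousAt
  obtain ⟨M, hM⟩ : ∃ M, ∀ t ∈ Set.Ioi (0 : ℝ), |F t| ≤ M := by
    obtain ⟨T, hT⟩ := eventually_atTop.1 (hI.abs.eventually (gt_mem_nhds (lt_add_one |I|)))
    obtain ⟨C, hC⟩ := (isCompact_Icc (a := (0 : ℝ)) (b := T)).exists_bound_of_continuousOn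
      hFc.continuousOn
    refine ⟨max C (|I| + 1), fun t ht => ?_⟩
    rcases le_total t T with h | h
    · exact le_max_of_le_left (hC t ⟨le_of_lt ht, h⟩)
    · exact le_max_of_le_right (hT t h).le
  have hdom : ∀ k : ℕ, IntegrableOn (fun s => F (k * s) * (2 * s * Real.exp (-s ^ 2)))
      (Set.Ioi 0) := by
    intro k
    refine (integrableOn_mul_exp_neg_sq.const_mul (max M |F 0|)).mono'
      (Continuous.aestronglyMeasurable (by fun_prop)) ?_
    refine (ae_restrict_iff' measurableSet_Ioi).2 (ae_of_all _ fun s hs => ?_)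
    replace hs : 0 < s := hs
    rw [Real.norm_eq_abs, abs_mul, abs_of_nonneg (by positivity : 0 ≤ 2 * s * Real.exp (-s ^ 2))]
    gcongr
    rcases Nat.eq_zero_or_pos k with rfl | hk
    · simp
    · exact le_max_of_le_left (hM _ (mul_pos (Nat.cast_pos.2 hk) hs))
  have hlim : Tendsto (fun k : ℕ => ∫ s in Set.Ioi (0 : ℝ), F (k * s) * (2 * s * Real.exp (-s ^ 2)))
      atTop (𝓝 (∫ s in Set.Ioi (0 : ℝ), I * (2 * s * Real.exp (-s ^ 2)))) := by
    refine tendsto_integral_of_dominated_convergence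
      (fun s => max M |F 0| * (2 * s * Real.exp (-s ^ 2))) (fun k => (hdom k).1)
      (integrableOn_mul_exp_neg_sq.const_mul _) (fun k => ?_) ?_
    · refine (ae_restrict_iff' measurableSet_Ioi).2 (ae_of_all _ fun s hs => ?_)
      replace hs : 0 < s := hs
      rw [Real.norm_eq_abs, abs_mul, abs_of_nonneg (by positivity : 0 ≤ 2 * s * Real.exp (-s ^ 2))]
      gcongr
      rcases Nat.eq_zero_or_pos k with rfl | hk
      · simp
      · exact le_max_of_le_left (hM _ (mul_pos (Nat.cast_pos.2 hk) hs))
    · refine (ae_restrict_iff' measurableSet_Ioi).2 (ae_of_all _ fun s hs => ?_)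
      exact (hI.comp (tendsto_natCast_atTop_atTop.atTop_mul_const hs)).mul_const _
  rw [integral_const_mul, integral_mul_exp_neg_sq, mul_one] at hlim
  refine hlim.congr' ?_
  filter_upwards [eventually_ge_atTop 1] with k hk
  have hk0 : (0 : ℝ) < k := by exact_mod_cast hk
  have hs := hint k hk
  have hs2 : IntegrableOn (fun s => k * (f (k * s) * Real.exp (-s ^ 2))) (Set.Ioi 0) := by
    have h := (integrableOn_Ioi_comp_mul_left_iff
      (fun t => f t * Real.exp (-(t / k) ^ 2)) 0 hk0).2 (by simpa using hs)
    refine (h.congr_fun (fun s _ => ?_) measurableSet_Ioi).const_mul _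
    simp only [mul_div_cancel_left₀ _ hk0.ne']
  have hsub : ∫ t in Set.Ioi (0 : ℝ), f t * Real.exp (-(t / k) ^ 2) =
      ∫ s in Set.Ioi (0 : ℝ), k * (f (k * s) * Real.exp (-s ^ 2)) := by
    have h := integral_comp_mul_left_Ioi (fun t => f t * Real.exp (-(t / k) ^ 2)) 0 hk0
    simp only [mul_div_cancel_left₀ _ hk0.ne', mul_zero, smul_eq_mul] at h
    rw [integral_const_mul, h, ← mul_assoc, mul_inv_cancel₀ hk0.ne', one_mul]
  rw [hsub]
  have hdF : ∀ s, HasDerivAt (fun s => F (k * s)) (k * f (k * s)) s := fun s => by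
    have := (hder (k * s)).comp s ((hasDerivAt_id s).const_mul (k : ℝ))
    refine this.congr_deriv ?_
    simp [mul_comm]
  have hF0 : F 0 = 0 := intervalIntegral.integral_same
  have hprod : ∀ s, HasDerivAt (fun s => F (k * s) * -Real.exp (-s ^ 2))
      (F (k * s) * (2 * s * Real.exp (-s ^ 2)) - k * (f (k * s) * Real.exp (-s ^ 2))) s := fun s =>
    ((hdF s).mul (hasDerivAt_neg_exp_neg_sq s)).congr_deriv (by ring)
  have h := integral_Ioi_of_hasDerivAt_of_tendsto' (a := 0) (fun s _ => hprod s)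
    ((hdom k).sub hs2)
    ((hI.comp (tendsto_id.const_mul_atTop hk0)).mul tendsto_exp_neg_sq.neg)
  rw [integral_sub (hdom k) hs2] at h
  simp only [neg_zero, mul_zero, hF0, zero_mul, sub_zero] at h
  linarith

theorem abs_sphereFourier_le_one {n : ℕ} (hn : 1 ≤ n) {t : ℝ} (ht : 0 ≤ t) :
    |sphereFourier (n + 1) t| ≤ 1 := by
  have h := abs_sphereChar_le n (t • axis n)
  have hσ := sphereMeasure_univ_pos n
  rw [sphereChar_eq hn, norm_smul, norm_axis, mul_one, Real.norm_eq_abs, abs_of_nonneg ht, abs_mul,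
    abs_of_pos hσ] at h
  nlinarith

/-- The Bessel moments are limits of densities at the origin of the smoothed random walk, which are
bounded below. -/
theorem IsBesselMoment.pos {n q : ℕ} (hn : 1 ≤ n) (hq : 2 ≤ q) {I : ℝ}
    (hI : IsBesselMoment (n + 1) q I) : 0 < I := by
  obtain ⟨m, rfl⟩ := Nat.exists_eq_add_of_le' hq
  obtain ⟨c, hc, hwalk⟩ := exists_gaussianWalk_ge hn m
  have hσ := sphereMeasure_univ_pos n
  set σ := (sphereMeasure n).real Set.univ with hσd
  set f : ℝ → ℝ := fun t => (sphereChar n (t • axis n) / σ) ^ (m + 2) * t ^ n with hf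
  have hfc : Continuous f := by
    have := continuous_sphereChar n
    fun_prop
  have hft : ∀ t, 0 ≤ t → f t = sphereFourier (n + 1) t ^ (m + 2) * t ^ n := fun t ht => by
    simp only [hf]
    rw [sphereChar_eq hn, norm_smul, norm_axis, mul_one, Real.norm_eq_abs, abs_of_nonneg ht,
      mul_div_cancel_left₀ _ hσ.ne']
  have hF : Tendsto (fun T : ℝ => ∫ t in (0 : ℝ)..T, f t) atTop (𝓝 I) := by
    refine Tendsto.congr' ?_ hI
    filter_upwards [eventually_ge_atTop 0] with T hT
    refine intervalIntegral.integral_congr fun t ht => ?_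
    rw [Set.uIcc_of_le hT] at ht
    simp only [hft t ht.1, Nat.add_sub_cancel]
  have hint : ∀ k : ℕ, 1 ≤ k →
      IntegrableOn (fun t => f t * Real.exp (-(t / k) ^ 2)) (Set.Ioi 0) := by
    intro k hk
    have hk0 : (0 : ℝ) < k := by exact_mod_cast hk
    have h := integrableOn_rpow_mul_exp_neg_mul_sq (b := 1 / (k : ℝ) ^ 2) (by positivity)
      (s := n) (neg_one_lt_zero.trans_le n.cast_nonneg)
    refine h.mono' (Continuous.aestronglyMeasurable (by fun_prop)) ?_
    refine (ae_restrict_iff' measurableSet_Ioi).2 (ae_of_all _ fun t ht => ?_)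
    replace ht : 0 < t := ht
    rw [hft t ht.le, Real.norm_eq_abs, abs_mul, abs_mul, abs_pow, Real.abs_exp,
      abs_of_nonneg (by positivity : 0 ≤ t ^ n), Real.rpow_natCast]
    have h1 := pow_le_one₀ (abs_nonneg _) (abs_sphereFourier_le_one hn ht.le) (n := m + 2)
    rw [show -(1 / (k : ℝ) ^ 2) * t ^ 2 = -(t / k) ^ 2 by ring]
    gcongr
    exact mul_le_of_le_one_left (by positivity) h1
  have hlim := tendsto_integral_gaussian hfc hint hF
  have hge : ∀ᶠ k : ℕ in atTop, c / σ ^ (m + 3) ≤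
      ∫ t in Set.Ioi (0 : ℝ), f t * Real.exp (-(t / k) ^ 2) := by
    filter_upwards [eventually_ge_atTop 4] with k hk
    have hk0 : (4 : ℝ) ≤ k := by exact_mod_cast hk
    have hk1 : (0 : ℝ) < k := by linarith
    -- The parameter `δ = 2 / k` turns the weight `exp (-(δ ^ 2 / 4) t ^ 2)` into
    -- `exp (-(t / k) ^ 2)`.
    have h := hwalk (2 / k) ⟨by positivity, by rw [div_le_iff₀ hk1]; linarith⟩ 0 (by simp)
    rw [gaussianWalk_origin hn, ← hσd] at h
    rw [div_le_iff₀' (by positivity)]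
    refine h.trans (le_of_eq ?_)
    congr 1
    refine setIntegral_congr_fun measurableSet_Ioi fun t ht => ?_
    simp only [hft t (le_of_lt ht)]
    congr 2
    ring
  exact lt_of_lt_of_le (by positivity) (ge_of_tendsto hlim hge)

/-- If the amplitude vanished in the limit, `sphereFourier` would have compact support, and the
density at the origin after two steps would stay bounded; but it blows up like `1 / δ` for a
Gaussian of width `δ`. -/
theorem amplitude_limit_ne_zero {n : ℕ} (hn : 1 ≤ n) {c : ℝ}
    (hc : Tendsto (fun l : ℕ => gegenbauerAmplitude (n + 1) l * (l : ℝ) ^ lamOf (n + 1)) atTop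
      (𝓝 c)) : c ≠ 0 := by
  rintro rfl
  obtain ⟨b, hb, hwalk⟩ := exists_gaussianWalk_one_ge n
  have hσ := sphereMeasure_univ_pos n
  set σ := (sphereMeasure n).real Set.univ with hσd
  set t₀ := 2 * |lamOf (n + 1) * (lamOf (n + 1) - 1)| with ht₀
  have ht₀0 : 0 ≤ t₀ := by positivity
  have hbound : ∀ ε : ℝ, 0 < ε → gaussianWalk n 2 ε 0 ≤ σ ^ 3 * (t₀ ^ n * t₀) := by
    intro ε hε
    rw [gaussianWalk_origin hn, ← hσd]
    gcongr
    rw [setIntegral_eq_of_subset_of_forall_sdiff_eq_zero (s := Set.Ioc 0 t₀) measurableSet_Ioi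
      Set.Ioc_subset_Ioi_self]
    · refine (Real.le_norm_self _).trans ?_
      have h := norm_setIntegral_le_of_norm_le_const (μ := volume) (s := Set.Ioc 0 t₀)
        (C := t₀ ^ n) (f := fun r => sphereFourier (n + 1) r ^ 2 * r ^ n * Real.exp (-ε * r ^ 2))
        (by simp) ?_
      · simpa [ht₀0] using h
      · intro r hr
        rw [Real.norm_eq_abs, abs_mul, abs_mul, abs_pow, Real.abs_exp,
          abs_of_nonneg (pow_nonneg hr.1.le n)]
        have h1 := pow_le_one₀ (abs_nonneg _) (abs_sphereFourier_le_one hn hr.1.le) (n := 2)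
        have h2 : Real.exp (-ε * r ^ 2) ≤ 1 := Real.exp_le_one_iff.2 (by nlinarith [sq_nonneg r])
        have h3 := pow_le_pow_left₀ hr.1.le hr.2 n
        have h4 := pow_nonneg hr.1.le n
        calc _ ≤ 1 * t₀ ^ n * 1 := by gcongr
          _ = _ := by ring
    · intro r hr
      have hr0 : 0 < r := hr.1
      have hr1 : t₀ < r := by
        by_contra! h
        exact hr.2 ⟨hr0, h⟩
      rw [sphereFourier_eq_zero_of_amplitude (by omega) hc hr0 hr1.le]
      ring
  set B := σ ^ 3 * (t₀ ^ n * t₀) with hB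
  have hB0 : 0 ≤ B := by positivity
  set δ := min (1 / 2) (b * σ / (2 * (B + 1))) with hδ
  have hδ0 : 0 < δ := by positivity
  have h1 := mul_measure_le_gaussianWalk_succ n 1 (ε := δ ^ 2 / 4) (by positivity) 0 (c := b / δ)
    (by positivity) (A := Set.univ) fun u _ =>
      hwalk δ ⟨hδ0, min_le_left _ _⟩ _ (by simpa using hδ0.le)
  have h2 := h1.trans (hbound _ (by positivity))
  rw [← hσd, div_mul_eq_mul_div, div_le_iff₀ hδ0] at h2
  have h3 : δ * (2 * (B + 1)) ≤ b * σ := (le_div_iff₀ (by positivity)).1 (min_le_right _ _)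
  nlinarith

end GaussianWalk

/-! ### The asymptotic equivalences -/

theorem isEquivalent_of_tendsto_mul {l : Filter ℕ} {u v w : ℕ → ℝ} {L : ℝ} (hL : L ≠ 0)
    (hu : Tendsto (fun n => w n * u n) l (𝓝 L)) (hv : ∀ᶠ n in l, w n * v n = L) : u ~[l] v := by
  refine isEquivalent_of_tendsto_one ?_
  have h := hu.div_const L
  rw [div_self hL] at h
  refine h.congr' ?_
  filter_upwards [hv] with n hn
  have hw : w n ≠ 0 := fun h => hL (by rw [← hn, h, zero_mul])
  rw [← hn, mul_div_mul_left _ _ hw, Pi.div_apply]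

/-- For even exponents the integral over `[0, π]` is symmetric about `π / 2`, so that a limit on
`(0, π / 2]` extends to `(0, π]`. -/
theorem tendsto_of_upper_half {d q : ℕ} (hd : 2 ≤ d) (hq : Even q) {w : ℕ → ℝ} {Φ : ℝ → ℝ}
    (h : ∀ a ∈ Set.Ioc 0 (Real.pi / 2),
      Tendsto (fun n : ℕ => w n * gegenbauerIntegral d q n a) atTop (𝓝 (Φ a)))
    {a : ℝ} (ha : a ∈ Set.Ioo (Real.pi / 2) Real.pi) :
    Tendsto (fun n : ℕ => w n * gegenbauerIntegral d q n a) atTop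
      (𝓝 (2 * Φ (Real.pi / 2) - Φ (Real.pi - a))) := by
  have h1 := h (Real.pi / 2) ⟨Real.pi_div_two_pos, le_rfl⟩
  have h2 := h (Real.pi - a) ⟨by linarith [ha.2], by linarith [ha.1]⟩
  refine ((h1.const_mul 2).sub h2).congr fun n => ?_
  rw [gegenbauerIntegral_reflect hd q n a, (hq.mul_left n).neg_one_pow]
  ring

theorem tendsto_integral_pi {d q : ℕ} (hd : 2 ≤ d) {l : Filter ℕ} {w : ℕ → ℝ} {L : ℝ}
    (h : Tendsto (fun n : ℕ => w n * gegenbauerIntegral d q n (Real.pi / 2)) l (𝓝 L))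
    (hl : ∀ᶠ n in l, Even (n * q)) :
    Tendsto (fun n : ℕ => w n * gegenbauerIntegral d q n Real.pi) l (𝓝 (2 * L)) := by
  refine (h.const_mul 2).congr' ?_
  filter_upwards [hl] with n hn
  rw [gegenbauerIntegral_pi hd, hn.neg_one_pow]
  ring

theorem corollary3p4 (d : ℕ) (hd : 2 ≤ d) :
    (∃ K : ℝ, 0 < K ∧
      (∀ a ∈ Set.Ioo 0 Real.pi,
        (fun l : ℕ => gegenbauerIntegral d 2 l a) ~[atTop]
          (fun l : ℕ => K * a * (l : ℝ) ^ (1 - (d : ℤ)))) ∧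
      (fun l : ℕ => gegenbauerIntegral d 2 l Real.pi) ~[atTop]
        (fun l : ℕ => 2 * (K * (Real.pi / 2) * (l : ℝ) ^ (1 - (d : ℤ))))) ∧
    (d = 2 →
      ∃ K : ℝ, 0 < K ∧
        (∀ a ∈ Set.Ioo 0 Real.pi,
          (fun l : ℕ => gegenbauerIntegral d 4 l a) ~[atTop]
            (fun l : ℕ => K * (Real.log l / (l : ℝ) ^ 2))) ∧
        (fun l : ℕ => gegenbauerIntegral d 4 l Real.pi) ~[atTop]
          (fun l : ℕ => 2 * (K * (Real.log l / (l : ℝ) ^ 2)))) ∧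
    (∀ q : ℕ, 3 ≤ q → ¬ (d = 2 ∧ q = 4) →
      ∃ I : ℝ, 0 < I ∧ IsBesselMoment d q I ∧
        (∀ a ∈ Set.Ioo 0 Real.pi,
          (fun l : ℕ => gegenbauerIntegral d q l a) ~[atTop]
            (fun l : ℕ => I / (l : ℝ) ^ d)) ∧
        (fun l : ℕ => gegenbauerIntegral d q l Real.pi)
          ~[atTop ⊓ 𝓟 {l : ℕ | ¬ (Odd q ∧ Odd l)}]
            (fun l : ℕ => 2 * (I / (l : ℝ) ^ d))) ∧
    (∀ q l : ℕ, Odd q → Odd l → gegenbauerIntegral d q l Real.pi = 0) := by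
  obtain ⟨c, hc⟩ := exists_tendsto_amplitude hd
  have hc0 : c ≠ 0 := by
    obtain ⟨n, rfl⟩ := Nat.exists_eq_add_of_le' (one_le_two.trans hd)
    exact amplitude_limit_ne_zero (by omega) hc
  have hpi := Real.pi_pos
  have hmid : Real.pi / 2 ∈ Set.Ioo 0 Real.pi := ⟨by linarith, by linarith⟩
  refine ⟨⟨c ^ 2 / 2, by positivity, ?_⟩, ?_, ?_, ?_⟩
  · have hweight : ∀ l : ℕ, 1 ≤ l → (l : ℝ) ^ (d - 1) * (l : ℝ) ^ (1 - (d : ℤ)) = 1 := by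
      intro l hl
      have hl0 : (l : ℝ) ≠ 0 := by positivity
      rw [← zpow_natCast, ← zpow_add₀ hl0, Nat.cast_sub (by omega)]
      simp
    have hlim : ∀ a ∈ Set.Ioo 0 Real.pi, Tendsto (fun n : ℕ => (n : ℝ) ^ (d - 1) *
        gegenbauerIntegral d 2 n a) atTop (𝓝 (c ^ 2 / 2 * a)) := by
      intro a ha
      have h := fun a ha => tendsto_two_upper_half hd hc (a := a) ha
      rcases le_or_gt a (Real.pi / 2) with h2 | h2
      · exact h a ⟨ha.1, h2⟩
      · convert tendsto_of_upper_half hd even_two h ⟨h2, ha.2⟩ using 2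
        ring
    refine ⟨fun a ha => ?_, ?_⟩
    · have ha0 := ha.1
      refine isEquivalent_of_tendsto_mul (by positivity) (hlim a ha) ?_
      filter_upwards [eventually_ge_atTop 1] with l hl
      rw [mul_left_comm, hweight l hl, mul_one]
    · refine isEquivalent_of_tendsto_mul (L := 2 * (c ^ 2 / 2 * (Real.pi / 2))) (by positivity)
        (tendsto_integral_pi hd (hlim _ hmid) (Eventually.of_forall fun n => even_two.mul_left n)) ?_
      filter_upwards [eventually_ge_atTop 1] with l hl
      rw [mul_left_comm, mul_left_comm (_ ^ (d - 1)), hweight l hl, mul_one]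
  · rintro rfl
    have hweight : ∀ l : ℕ, 2 ≤ l →
        (l : ℝ) ^ 2 / Real.log l * (Real.log l / (l : ℝ) ^ 2) = 1 := by
      intro l hl
      have hl0 : (1 : ℝ) < l := by exact_mod_cast hl
      have := Real.log_pos hl0
      field_simp
    have hlim : ∀ a ∈ Set.Ioo 0 Real.pi, Tendsto (fun n : ℕ => (n : ℝ) ^ 2 / Real.log n *
        gegenbauerIntegral 2 4 n a) atTop (𝓝 (3 / 8 * c ^ 4)) := by
      intro a ha
      have h := fun a ha => tendsto_four_upper_half hc (a := a) ha
      rcases le_or_gt a (Real.pi / 2) with h2 | h2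
      · exact h a ⟨ha.1, h2⟩
      · convert tendsto_of_upper_half hd (by decide) h ⟨h2, ha.2⟩ using 2
        ring
    have hK : 0 < 3 / 8 * c ^ 4 := by positivity
    refine ⟨3 / 8 * c ^ 4, hK, fun a ha => ?_, ?_⟩
    · refine isEquivalent_of_tendsto_mul hK.ne' (hlim a ha) ?_
      filter_upwards [eventually_ge_atTop 2] with l hl
      rw [mul_left_comm, hweight l hl, mul_one]
    · refine isEquivalent_of_tendsto_mul (L := 2 * (3 / 8 * c ^ 4)) (by positivity)
        (tendsto_integral_pi hd (hlim _ hmid)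
          (Eventually.of_forall fun n => (show Even 4 by decide).mul_left n)) ?_
      filter_upwards [eventually_ge_atTop 2] with l hl
      rw [mul_left_comm, mul_left_comm (_ / _), hweight l hl, mul_one]
  · intro q hq hdq
    obtain ⟨I, hI, hlim⟩ := exists_moment hd hq hdq
    have hI0 : 0 < I := by
      obtain ⟨n, rfl⟩ := Nat.exists_eq_add_of_le' (one_le_two.trans hd)
      exact hI.pos (by omega) (by omega)
    have hweight : ∀ l : ℕ, 1 ≤ l → (l : ℝ) ^ d * (I / (l : ℝ) ^ d) = I := by
      intro l hl
      have hl0 : (0 : ℝ) < l := by exact_mod_cast hl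
      field_simp
    refine ⟨I, hI0, hI, fun a ha => ?_, ?_⟩
    · refine isEquivalent_of_tendsto_mul hI0.ne' (hlim a ha) ?_
      filter_upwards [eventually_ge_atTop 1] with l hl using hweight l hl
    · refine isEquivalent_of_tendsto_mul (L := 2 * I) (by positivity)
        (tendsto_integral_pi hd ((hlim _ hmid).mono_left inf_le_left) ?_) ?_
      · refine mem_inf_of_right fun l hl => ?_
        simp only [Set.mem_ofPred_eq, not_and_or, Nat.not_odd_iff_even] at hl
        exact Nat.even_mul.2 hl.symm
      · refine Eventually.filter_mono inf_le_left ?_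
        filter_upwards [eventually_ge_atTop 1] with l hl
        rw [mul_left_comm, hweight l hl]
  · intro q l hq hl
    rw [gegenbauerIntegral_pi hd, (hl.mul hq).neg_one_pow]
    ring
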